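/- A pseudo-triangle is a simple polygon $\mathcal{P}$ in the plane (with its closed region, also denoted $\mathcal{P}$) with exactly three vertices $A,B,C$, called corners, at which the interior angle is less than $\pi$, while the interior angle at every other vertex is greater than $\pi$; the corners split the boundary into three side-chains $AB$, $BC$, $AC$ (each possibly a single edge). A tower polygon with base edge $e$ is a pseudo-triangle one of whose side-chains is the single edge $e$; its corner opposite to $e$ is called the corner of the tower. The visibility graph $\mathcal{G}$ of $\mathcal{P}$ has the vertices of $\mathcal{P}$ as its vertices, two distinct ones being adjacent (seeing each other) if and only if the line segment between them is contained in $\mathcal{P}$; the boundary order of the vertices gives a Hamiltonian cycle $\mathcal{H}$ of $\mathcal{G}$. Call a vertex detected if its two neighbours on $\mathcal{H}$ are adjacent in $\mathcal{G}$; this depends only on the pair $(\mathcal{G},\mathcal{H})$. Lemma 1. Let $\mathcal{P}$ be a pseudo-triangle with visibility graph $\mathcal{G}$ and boundary Hamiltonian cycle $\mathcal{H}$. Every detected vertex is a corner, and at least two of the three corners are detected. Moreover, suppose that a corner $A$ is not detected, and let $u$ and $v$ be the neighbours of $A$ on the side-chains $AB$ and $AC$. Then $B$ and $C$ are both detected,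 and both are isolated vertices of the graph obtained from $\mathcal{G}$ by removing the edges of $\mathcal{H}$. Furthermore, there are vertices $w,w'$ on $BC$, different from $B$ and $C$, with $w$ equal to $w'$ or closer to $B$ than $w'$ along $BC$, such that $(u,w)$ and $(w',v)$ are edges of $\mathcal{G}$ and the path from $u$ to $v$ composed of the segment $uw$, the subchain $[w,\ldots,w']$ of $BC$ and the segment $w'v$ is a shortest Euclidean path from $u$ to $v$ inside $\mathcal{P}$, and such that the following holds. Either $u\neq B$ and $\langle u,\ldots,B,\ldots,w\rangle$ is a tower polygon with base $(u,w)$ and corner $B$, and $B$ is the only isolated vertex of the graph obtained from the visibility graph of this tower by removing all its boundary edges except the base; or $u=B$ and $w$ is the neighbour of $B$ on $BC$. Symmetrically, either $v\neq C$ and $\langle w',\ldots,C,\ldots,v\rangle$ is a tower polygon with base $(w',v)$ and corner $C$, and $C$ is the only isolated vertex of the graph obtained from the visibility graph of this tower by removing all its boundary edges except the base; or $v=C$ and $w'$ is the neighbour of $C$ on $BC$. -/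

import Mathlib

open scoped Topology ENNReal

/-- The Euclidean plane. -/
abbrev Plane : Type := EuclideanSpace ℝ (Fin 2)

/-! ### Combinatorics of a graph with a Hamiltonian cycle -/

/-- The vertices picked out by the neighbour test in a graph `G` with a Hamiltonian cycle `H`
(given as a graph on the same vertices): those whose two neighbours along `H` are adjacent in `G`.
The rule uses nothing but `G` and `H`. -/
def detected {V : Type*} (G H : SimpleGraph V) : Set V :=
  {x | ∃ y z, y ≠ z ∧ H.Adj x y ∧ H.Adj x z ∧ G.Adj y z}

/-! ### Polygonal paths and shortest paths in a set -/

/-- The length of the polygonal path through the listed points. -/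
noncomputable def polylineLength : List Plane → ℝ≥0∞
  | [] => 0
  | [_] => 0
  | x :: y :: l => edist x y + polylineLength (y :: l)

/-- The polygonal path through the points of `L` is a shortest path from `x` to `y` inside `S`:
it goes from `x` to `y`, stays in `S`, and no continuous curve in `S` from `x` to `y` is shorter
(the length of a curve is its total variation). -/
def IsShortestPath (S : Set Plane) (x y : Plane) (L : List Plane) : Prop :=
  L.head? = some x ∧ L.getLast? = some y ∧
  L.IsChain (fun p q => segment ℝ p q ⊆ S) ∧
  ∀ γ : ℝ → Plane, ContinuousOn γ (Set.Icc 0 1) → γ 0 = x → γ 1 = y →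
    (∀ t ∈ Set.Icc (0 : ℝ) 1, γ t ∈ S) →
    polylineLength L ≤ eVariationOn γ (Set.Icc 0 1)

namespace Polygon

/-! ### Simple polygons in the plane

The vertices are indexed cyclically by `Fin n` (so `i + 1` and `i - 1` are the two boundary
neighbours of `i`), and the polygon may be traversed clockwise or counterclockwise. -/

/-- A simple polygon: at least three vertices, all distinct, and two different edges meet at most
in a common endpoint of consecutive edges. -/
def IsSimple {n : ℕ} [NeZero n] (P : Polygon Plane n) : Prop :=
  3 ≤ n ∧ Function.Injective P.vertices ∧
  ∀ i j : Fin n, i ≠ j → ∀ x ∈ P.edgeSet ℝ i ∩ P.edgeSet ℝ j,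
    (j = i + 1 ∧ x = P j) ∨ (i = j + 1 ∧ x = P i)

/-- The edge from `P i` to `P (i + 1)` crosses the horizontal ray that starts at `x` and goes in
the direction of increasing first coordinate. (An edge contains its lower endpoint but not its
upper one for this purpose, and horizontal edges do not count.) -/
def CrossesRay {n : ℕ} [NeZero n] (P : Polygon Plane n) (x : Plane) (i : Fin n) : Prop :=
  ((P i 1 ≤ x 1 ∧ x 1 < P (i + 1) 1) ∨ (P (i + 1) 1 ≤ x 1 ∧ x 1 < P i 1)) ∧
  ∃ z ∈ segment ℝ (P i) (P (i + 1)), z 1 = x 1 ∧ x 0 < z 0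

/-- The closed region bounded by a simple polygon: the boundary together with the interior, that
is, the points from which a ray crosses the boundary an odd number of times. -/
def region {n : ℕ} [NeZero n] (P : Polygon Plane n) : Set Plane :=
  P.boundary ℝ ∪ {x | Odd (Set.ncard {i | P.CrossesRay x i})}

/-- The interior angle at the vertex `P i` is strictly between `0` and `π`: the two edges there are
not collinear, and the wedge between them (represented by the points near `P i` on the median
through `P i` of the triangle of `P i` and its boundary neighbours) lies inside the polygon. -/
def IsConvexVertex {n : ℕ} [NeZero n] (P : Polygon Plane n) (i : Fin n) : Prop :=
  ¬ Collinear ℝ {P (i - 1), P i, P (i + 1)} ∧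
  ∀ᶠ t : ℝ in 𝓝[>] 0, P i + t • ((P (i - 1) - P i) + (P (i + 1) - P i)) ∈ P.region

/-- The interior angle at the vertex `P i` is strictly between `π` and `2π`: the two edges there are
not collinear, and the wedge between them lies outside the polygon. -/
def IsReflexVertex {n : ℕ} [NeZero n] (P : Polygon Plane n) (i : Fin n) : Prop :=
  ¬ Collinear ℝ {P (i - 1), P i, P (i + 1)} ∧
  ∀ᶠ t : ℝ in 𝓝[>] 0, P i + t • ((P (i - 1) - P i) + (P (i + 1) - P i)) ∉ P.region

/-- `P` is a pseudo-triangle with corners `P a`, `P b`, `P c`, met in this order on the boundary: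
a simple polygon whose corners are convex vertices and whose other vertices, the interior vertices
of the three side-chains from `a` to `b`, from `b` to `c` and from `c` to `a`, are all reflex.
The order on `Fin n` of `b - a` and `c - a` compares distances along the boundary from `a`. -/
def IsPseudoTriangle {n : ℕ} [NeZero n] (P : Polygon Plane n) (a b c : Fin n) : Prop :=
  P.IsSimple ∧ 0 < b - a ∧ b - a < c - a ∧
  P.IsConvexVertex a ∧ P.IsConvexVertex b ∧ P.IsConvexVertex c ∧
  ∀ i, i ≠ a → i ≠ b → i ≠ c → P.IsReflexVertex i

/-- `P` is a tower polygon with corner `P a` and base edge from `P b` to `P c`: a pseudo-triangle in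
which the side-chain from `b` to `c` is a single edge. -/
def IsTower {n : ℕ} [NeZero n] (P : Polygon Plane n) (a b c : Fin n) : Prop :=
  P.IsPseudoTriangle a b c ∧ c = b + 1

/-- The visibility graph: two distinct vertices are adjacent when the line segment between them
lies in the closed polygonal region. -/
def visibilityGraph {n : ℕ} [NeZero n] (P : Polygon Plane n) : SimpleGraph (Fin n) where
  Adj i j := i ≠ j ∧ segment ℝ (P i) (P j) ⊆ P.region
  symm := ⟨fun i j h => ⟨h.1.symm, by rw [segment_symm]; exact h.2⟩⟩
  loopless := ⟨fun _ h => h.1 rfl⟩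

/-- The vertices met on the boundary when going forward from `i` to `j`, both included. -/
def boundaryChain {n : ℕ} [NeZero n] (P : Polygon Plane n) (i j : Fin n) : List Plane :=
  (List.range ((j - i).val + 1)).map (fun k => P (i + Fin.ofNat n k))

/-- The polygon cut off by the chord from `P j` to `P i`: its vertices are those met on the boundary
when going forward from `i` to `j`, and its last edge is the chord. -/
def subPolygon {n : ℕ} [NeZero n] (P : Polygon Plane n) (i j : Fin n) :
    Polygon Plane ((j - i).val + 1) :=
  ⟨fun k => P (i + Fin.ofNat n k.val)⟩

/-- The polygon cut off by the chord from `P j` to `P i` is a tower polygon whose base is the chord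
and whose corner is `P x`, where `x` lies on the boundary between `i` and `j`. Moreover, this corner
is the only isolated vertex of the graph left when the edges of the two side-chains of the tower
(all its boundary edges except the base) are removed from its visibility graph. -/
def CutsOffTower {n : ℕ} [NeZero n] (P : Polygon Plane n) (i j x : Fin n) : Prop :=
  x - i ≤ j - i ∧
  (P.subPolygon i j).IsTower (Fin.ofNat _ (x - i).val) (Fin.last _) 0 ∧
  ∀ y, ((P.subPolygon i j).visibilityGraph \ SimpleGraph.pathGraph _).IsIsolated y ↔
    y = Fin.ofNat _ (x - i).val

end Polygon

/-!
Measure the turning from one directed edge to the next by an angle in `(-π, π)`. Around a simple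
polygon the turning angles add up to `±2π`, and in a pseudo-triangle their sign at the three corners
is opposite to that at all other vertices. Hence the turning between any two edges is confined to an
interval that depends only on how many corners lie between them, and the hypotheses reduce to sign
conditions on the cross products of edge vectors. Conversely these sign conditions make the polygon
a pseudo-triangle with region described by linear inequalities: a point belongs to the region unless
one of the three chains cuts it off.

Two vertices of one chain that are not consecutive never see each other, so a detected vertex is a
corner. If the two neighbours of a corner do not see each other, only the opposite chain can block
the view. The tangents from the two neighbours to that chain are the first and last edges of the
path; what they cut off satisfies the sign conditions again and is a tower. A curve inside the
region does not pass beyond the opposite chain, so it can be shortened successively along the lines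
through the edges of the path until the path itself is left.
-/

namespace Plane

/-! ### Angles between complex numbers -/

section ComplexAngles

open Complex

lemma arg_div_eq_toReal {z w : ℂ} (hz : z ≠ 0) (hw : w ≠ 0) :
    arg (w / z) = ((arg w - arg z : ℝ) : Real.Angle).toReal := by
  rw [Real.Angle.coe_sub, ← arg_div_coe_angle hw hz, arg_coe_angle_toReal_eq_arg]

lemma ne_zero_and_ne_zero_of_div_mem_slitPlane {z w : ℂ} (h : w / z ∈ slitPlane) :
    z ≠ 0 ∧ w ≠ 0 := by
  simpa [and_comm] using slitPlane_ne_zero h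

lemma arg_div_of_im_nonneg {u z w : ℂ} (hu : u ≠ 0) (hz : 0 ≤ (z / u).im)
    (hw : 0 ≤ (w / u).im) (h : w / z ∈ slitPlane) :
    arg (w / z) = arg (w / u) - arg (z / u) := by
  obtain ⟨hz0, hw0⟩ := ne_zero_and_ne_zero_of_div_mem_slitPlane h
  have hdiv : arg (w / z) = ((arg (w / u) - arg (z / u) : ℝ) : Real.Angle).toReal := by
    rw [← arg_div_eq_toReal (div_ne_zero hz0 hu) (div_ne_zero hw0 hu), div_div_div_cancel_right₀ hu]
  have hlower : -Real.pi ≤ arg (w / u) - arg (z / u) := by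
    linarith [arg_nonneg_iff.2 hw, arg_le_pi (z / u)]
  have hupper : arg (w / u) - arg (z / u) ≤ Real.pi := by
    linarith [arg_nonneg_iff.2 hz, arg_le_pi (w / u)]
  rw [hdiv, Real.Angle.toReal_coe_eq_self_iff]
  refine ⟨hlower.lt_of_ne fun heq => (mem_slitPlane_iff_arg.1 h).1 ?_, hupper⟩
  rw [hdiv, ← heq, Real.Angle.coe_neg, Real.Angle.neg_coe_pi, Real.Angle.toReal_pi]

lemma sum_arg_div_of_im_nonneg {u : ℂ} (hu : u ≠ 0) (z : ℕ → ℂ) {a b : ℕ} (hab : a ≤ b)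
    (hz : ∀ k, a ≤ k → k ≤ b → 0 ≤ (z k / u).im)
    (h : ∀ k, a ≤ k → k < b → z (k + 1) / z k ∈ slitPlane) :
    ∑ k ∈ Finset.Ico a b, arg (z (k + 1) / z k) = arg (z b / u) - arg (z a / u) := by
  rw [← Finset.sum_Ico_sub (fun k => arg (z k / u)) hab]
  refine Finset.sum_congr rfl fun k hk => ?_
  obtain ⟨hak, hkb⟩ := Finset.mem_Ico.1 hk
  exact arg_div_of_im_nonneg hu (hz k hak hkb.le) (hz (k + 1) (by omega) hkb) (h k hak hkb)

lemma im_div_eq (z w : ℂ) : (w / z).im = (z.re * w.im - z.im * w.re) / normSq z := by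
  rw [div_im]; ring

lemma im_div_pos_iff {z w : ℂ} (hz : z ≠ 0) :
    0 < (w / z).im ↔ 0 < z.re * w.im - z.im * w.re := by
  rw [im_div_eq, div_pos_iff_of_pos_right (normSq_pos.2 hz)]

lemma im_div_nonneg_iff {z w : ℂ} (hz : z ≠ 0) :
    0 ≤ (w / z).im ↔ 0 ≤ z.re * w.im - z.im * w.re := by
  rw [im_div_eq, le_div_iff₀ (normSq_pos.2 hz), zero_mul]

lemma im_div_eq_zero_iff {z w : ℂ} (hz : z ≠ 0) :
    (w / z).im = 0 ↔ z.re * w.im - z.im * w.re = 0 := by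
  rw [im_div_eq, div_eq_zero_iff, or_iff_left (normSq_pos.2 hz).ne']

lemma arg_pos_iff_of_im_ne_zero {z : ℂ} (h : z.im ≠ 0) : 0 < arg z ↔ 0 < z.im := by
  rw [← not_le, ← not_le, not_iff_not]
  refine ⟨fun harg => ?_, fun him => (arg_neg_iff.2 (him.lt_of_ne h)).le⟩
  by_contra! him
  exact h (arg_eq_zero_iff.1 (harg.antisymm (arg_nonneg_iff.2 him.le))).2

lemma arg_mem_Ioo_of_im_pos {z : ℂ} (h : 0 < z.im) : arg z ∈ Set.Ioo 0 Real.pi :=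
  ⟨(arg_pos_iff_of_im_ne_zero h.ne').2 h,
    (arg_le_pi z).lt_of_ne fun heq => h.ne' (arg_eq_pi_iff.1 heq).2⟩

lemma arg_mem_Ioo_of_im_neg {z : ℂ} (h : z.im < 0) : arg z ∈ Set.Ioo (-Real.pi) 0 :=
  ⟨neg_pi_lt_arg z, arg_neg_iff.2 h⟩

lemma arg_div_add_arg_div {a b : ℂ} (h : (b / a).im ≠ 0) :
    arg ((a + b) / a) + arg (b / (a + b)) = arg (b / a) := by
  have ha : a ≠ 0 := by rintro rfl; simp at h
  have hb : b / a ≠ 0 := by rintro hb; simp [hb] at h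
  have him : ((a + b) / a).im = (b / a).im := by simp [add_div, ha]
  have hab : (a + b) / a ≠ 0 := by rintro hab; simp [← him, hab] at h
  rw [← div_div_div_cancel_right₀ ha b (a + b), arg_div_eq_toReal hab hb,
    Real.Angle.toReal_coe_eq_self_iff.2, add_sub_cancel]
  rcases h.lt_or_gt with h | h
  · have hlt := arg_mem_Ioo_of_im_neg h
    have hlt' := arg_mem_Ioo_of_im_neg (him ▸ h)
    exact ⟨by linarith [hlt.1, hlt'.2], by linarith [hlt.2, hlt'.1]⟩
  · have hgt := arg_mem_Ioo_of_im_pos h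
    have hgt' := arg_mem_Ioo_of_im_pos (him ▸ h)
    exact ⟨by linarith [hgt.1, hgt'.2], by linarith [hgt.2, hgt'.1]⟩

lemma notMem_segment_iff_div_mem_slitPlane {x z w : ℂ} :
    x ∉ segment ℝ z w ↔ (w - x) / (z - x) ∈ slitPlane := by
  rw [mem_segment_iff_sameRay, SameRay.sameRay_comm, sameRay_iff_arg_div_eq_zero, arg_eq_zero_iff,
    ← neg_sub z x, div_neg, neg_re, neg_im, mem_slitPlane_iff]
  grind

lemma exists_mem_segment_im_eq_zero_re_neg_iff {z w : ℂ} (hz : 0 ≤ z.im) (hw : w.im < 0) :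
    (∃ t ∈ segment ℝ z w, t.im = 0 ∧ t.re < 0) ↔ 0 < z.re * w.im - z.im * w.re := by
  have hpos : 0 < z.im - w.im := by linarith
  constructor
  · rintro ⟨_, ⟨a, b, -, -, hab, rfl⟩, him, hre⟩
    simp only [add_im, add_re, real_smul, mul_im, mul_re, ofReal_re, ofReal_im, zero_mul, add_zero,
      sub_zero] at him hre
    obtain rfl : b = 1 - a := by linarith
    have hcross : (a * z.re + (1 - a) * w.re) * (z.im - w.im) = -(z.re * w.im - z.im * w.re) := by
      linear_combination (z.re - w.re) * him
    linarith [mul_neg_of_neg_of_pos hre hpos]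
  · intro hcross
    refine ⟨_, ⟨-w.im / (z.im - w.im), z.im / (z.im - w.im), div_nonneg (by linarith) hpos.le,
      div_nonneg hz hpos.le, by field_simp; ring, rfl⟩, ?_, ?_⟩
    · simp only [real_smul, add_im, mul_im, ofReal_re, ofReal_im, zero_mul, add_zero]
      field_simp
      ring
    · have hre : (((-w.im / (z.im - w.im)) • z + (z.im / (z.im - w.im)) • w : ℂ)).re =
          -(z.re * w.im - z.im * w.re) / (z.im - w.im) := by
        simp only [real_smul, add_re, mul_re, ofReal_re, ofReal_im, zero_mul, sub_zero]
        ring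
      rw [hre]
      exact div_neg_of_neg_of_pos (by linarith) hpos

lemma arg_div_of_im_nonneg_of_im_neg {z w : ℂ} (h : w / z ∈ slitPlane) (hz : 0 ≤ z.im)
    (hw : w.im < 0) :
    arg (w / z) = arg w - arg z + if 0 < (w / z).im then 2 * Real.pi else 0 := by
  obtain ⟨hz0, hw0⟩ := ne_zero_and_ne_zero_of_div_mem_slitPlane h
  have hw_arg := arg_mem_Ioo_of_im_neg hw
  have hz_arg : arg z ∈ Set.Icc 0 Real.pi := ⟨arg_nonneg_iff.2 hz, arg_le_pi z⟩
  have hdiv := arg_div_eq_toReal hz0 hw0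
  rcases lt_or_ge (-Real.pi) (arg w - arg z) with hθ | hθ
  · rw [Real.Angle.toReal_coe_eq_self_iff.2 ⟨hθ, by linarith [hz_arg.1, hw_arg.2, Real.pi_pos]⟩]
      at hdiv
    have him : (w / z).im < 0 := arg_neg_iff.1 (by linarith [hz_arg.1, hw_arg.2])
    rw [if_neg him.not_gt, hdiv, add_zero]
  · rw [Real.Angle.toReal_coe_eq_self_add_two_pi_iff.2
      ⟨by linarith [hz_arg.2, hw_arg.1, Real.pi_pos], hθ⟩] at hdiv
    have harg_pos : 0 < arg (w / z) := by linarith [hz_arg.2, hw_arg.1]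
    have him : 0 < (w / z).im := by
      refine (arg_nonneg_iff.1 harg_pos.le).lt_of_ne fun him => ?_
      have hre : 0 < (w / z).re := (mem_slitPlane_iff.1 h).resolve_right (by simp [← him])
      exact harg_pos.ne' (arg_eq_zero_iff.2 ⟨hre.le, him.symm⟩)
    rw [if_pos him, hdiv]

/-- The half-open conditions on the signs of the imaginary parts are those of
`Polygon.CrossesRay`. -/
lemma exists_arg_div_eq_and_odd_iff {z w : ℂ} (h : w / z ∈ slitPlane) :
    ∃ k : ℤ, arg (w / z) = arg w - arg z + 2 * Real.pi * k ∧
      (Odd k ↔ ((0 ≤ z.im ∧ w.im < 0) ∨ (0 ≤ w.im ∧ z.im < 0)) ∧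
        ∃ t ∈ segment ℝ z w, t.im = 0 ∧ t.re < 0) := by
  have hdown : ∀ {z w : ℂ}, w / z ∈ slitPlane → 0 ≤ z.im → w.im < 0 →
      ∃ k : ℤ, arg (w / z) = arg w - arg z + 2 * Real.pi * k ∧
        (Odd k ↔ ∃ t ∈ segment ℝ z w, t.im = 0 ∧ t.re < 0) := by
    intro z w h hz hw
    rw [exists_mem_segment_im_eq_zero_re_neg_iff hz hw,
      ← im_div_pos_iff (ne_zero_and_ne_zero_of_div_mem_slitPlane h).1,
      arg_div_of_im_nonneg_of_im_neg h hz hw]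
    by_cases him : 0 < (w / z).im
    · exact ⟨1, by simp [him], by simp [him]⟩
    · exact ⟨0, by simp [him], by simp [him]⟩
  rcases le_or_gt 0 z.im with hz | hz <;> rcases le_or_gt 0 w.im with hw | hw
  · refine ⟨0, ?_, by simp [hz.not_gt, hw.not_gt]⟩
    simpa using arg_div_of_im_nonneg (u := 1) one_ne_zero (by simpa using hz) (by simpa using hw) h
  · simpa [hz, hw] using hdown h hz hw
  · have h' : z / w ∈ slitPlane := by
      have hseg := notMem_segment_iff_div_mem_slitPlane (x := 0) (z := z) (w := w)
      rw [segment_symm, notMem_segment_iff_div_mem_slitPlane] at hseg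
      simpa using hseg.2 (by simpa using h)
    obtain ⟨k, hk, hodd⟩ := hdown h' hw hz
    refine ⟨-k, ?_, by simp [hodd, segment_symm ℝ z w, hz, hw]⟩
    rw [← inv_div, arg_inv, if_neg (mem_slitPlane_iff_arg.1 h).1] at hk
    push_cast
    linarith
  · refine ⟨0, ?_, by simp [hz.not_ge, hw.not_ge]⟩
    have hsub := arg_div_of_im_nonneg (u := -1) (by norm_num)
      (by simpa [div_neg] using hz.le) (by simpa [div_neg] using hw.le) h
    rw [div_neg, div_neg, div_one, div_one, arg_neg_eq_arg_add_pi_of_im_neg hz,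
      arg_neg_eq_arg_add_pi_of_im_neg hw] at hsub
    rw [hsub]
    push_cast
    ring

end ComplexAngles

/-! ### The winding angle of a polygon -/

/-- The identification of the plane with the complex numbers. -/
noncomputable def toComplex : Plane ≃ₗᵢ[ℝ] ℂ := Complex.orthonormalBasisOneI.repr.symm

@[simp] lemma toComplex_re (x : Plane) : (toComplex x).re = x 0 := by
  simp [toComplex]

@[simp] lemma toComplex_im (x : Plane) : (toComplex x).im = x 1 := by
  simp [toComplex]

lemma notMem_segment_iff_toComplex {x y z : Plane} :
    x ∉ segment ℝ y z ↔
      (toComplex z - toComplex x) / (toComplex y - toComplex x) ∈ Complex.slitPlane := by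
  rw [← notMem_segment_iff_div_mem_slitPlane, not_iff_not]
  have himage := image_segment ℝ toComplex.toLinearEquiv.toLinearMap.toAffineMap y z
  change toComplex '' _ = segment ℝ (toComplex y) (toComplex z) at himage
  rw [← himage, toComplex.injective.mem_set_image]

section Winding

variable {n : ℕ} [NeZero n] {P : Polygon Plane n} {x y : Plane}

lemma edgeSet_eq_segment (P : Polygon Plane n) (i : Fin n) :
    P.edgeSet ℝ i = segment ℝ (P i) (P (i + 1)) := by
  rw [Polygon.edgeSet, affineSegment_eq_segment, finRotate_apply]

lemma notMem_boundary_iff : x ∉ P.boundary ℝ ↔ ∀ i, x ∉ segment ℝ (P i) (P (i + 1)) := by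
  simp [Polygon.boundary, edgeSet_eq_segment]

/-- The total angle under which the boundary of `P`, traversed once, is seen from `x`: the winding
number times `2 * π` if `x` is off the boundary. -/
noncomputable def windingAngle (P : Polygon Plane n) (x : Plane) : ℝ :=
  ∑ i, Complex.arg ((toComplex (P (i + 1)) - toComplex x) / (toComplex (P i) - toComplex x))

lemma crossesRay_iff_toComplex (i : Fin n) :
    P.CrossesRay x i ↔
      ((0 ≤ (toComplex x - toComplex (P i)).im ∧ (toComplex x - toComplex (P (i + 1))).im < 0) ∨
        (0 ≤ (toComplex x - toComplex (P (i + 1))).im ∧ (toComplex x - toComplex (P i)).im < 0)) ∧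
      ∃ t ∈ segment ℝ (toComplex x - toComplex (P i)) (toComplex x - toComplex (P (i + 1))),
        t.im = 0 ∧ t.re < 0 := by
  have himage := image_segment ℝ (AffineMap.const ℝ Plane (toComplex x) -
    toComplex.toLinearEquiv.toLinearMap.toAffineMap) (P i) (P (i + 1))
  change (fun z => toComplex x - toComplex z) '' _ =
    segment ℝ (toComplex x - toComplex (P i)) (toComplex x - toComplex (P (i + 1))) at himage
  rw [← himage, Set.exists_mem_image]
  simp only [Polygon.CrossesRay, Complex.sub_im, Complex.sub_re, toComplex_im, toComplex_re,
    sub_nonneg, sub_neg, sub_eq_zero, eq_comm (b := x 1)]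

lemma odd_sum_int_iff_odd_card {ι : Type*} (s : Finset ι) (k : ι → ℤ) :
    Odd (∑ i ∈ s, k i) ↔ Odd {i ∈ s | Odd (k i)}.card := by
  have hcast (m : ℤ) : (m : ZMod 2) = if Odd m then 1 else 0 := by
    split_ifs with h
    · exact ZMod.intCast_eq_one_iff_odd.2 h
    · exact ZMod.intCast_eq_zero_iff_even.2 (Int.not_odd_iff_even.1 h)
  rw [← ZMod.intCast_eq_one_iff_odd, ← ZMod.natCast_eq_one_iff_odd, Int.cast_sum]
  simp only [hcast, Finset.sum_boole]

lemma exists_windingAngle_eq (hx : x ∉ P.boundary ℝ) :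
    ∃ k : ℤ, windingAngle P x = 2 * Real.pi * k ∧ (x ∈ P.region ↔ Odd k) := by
  have hedge (i : Fin n) : ∃ k : ℤ,
      Complex.arg ((toComplex (P (i + 1)) - toComplex x) / (toComplex (P i) - toComplex x)) =
        Complex.arg (toComplex x - toComplex (P (i + 1))) -
          Complex.arg (toComplex x - toComplex (P i)) + 2 * Real.pi * k ∧
      (Odd k ↔ P.CrossesRay x i) := by
    have hslit := notMem_segment_iff_toComplex.1 (notMem_boundary_iff.1 hx i)
    rw [← neg_sub, ← neg_sub (toComplex x) (toComplex (P i)), neg_div_neg_eq] at hslit ⊢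
    rw [crossesRay_iff_toComplex]
    exact exists_arg_div_eq_and_odd_iff hslit
  choose k hangle hodd using hedge
  refine ⟨∑ i, k i, ?_, ?_⟩
  · have hshift : ∑ i, Complex.arg (toComplex x - toComplex (P (i + 1))) =
        ∑ i, Complex.arg (toComplex x - toComplex (P i)) :=
      Equiv.sum_comp (Equiv.addRight (1 : Fin n)) fun i =>
        Complex.arg (toComplex x - toComplex (P i))
    simp only [windingAngle, hangle, Finset.sum_add_distrib, Finset.sum_sub_distrib, hshift,
      sub_self, zero_add, Int.cast_sum, Finset.mul_sum]
  · rw [odd_sum_int_iff_odd_card, ← Set.ncard_coe_finset]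
    simp [Polygon.region, hx, hodd]

lemma continuousAt_windingAngle (hx : x ∉ P.boundary ℝ) : ContinuousAt (windingAngle P) x := by
  refine tendsto_finsetSum _ fun i _ => ?_
  have hslit := notMem_segment_iff_toComplex.1 (notMem_boundary_iff.1 hx i)
  have hne := (ne_zero_and_ne_zero_of_div_mem_slitPlane hslit).1
  exact (Complex.continuousAt_arg hslit).comp (f := fun y =>
    (toComplex (P (i + 1)) - toComplex y) / (toComplex (P i) - toComplex y))
    (ContinuousAt.div (by fun_prop) (by fun_prop) hne)

lemma mem_region_iff_of_segment (h : ∀ z ∈ segment ℝ x y, z ∉ P.boundary ℝ) :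
    x ∈ P.region ↔ y ∈ P.region := by
  have hmaps : Set.MapsTo (windingAngle P) (segment ℝ x y)
      (AddSubgroup.zmultiples (2 * Real.pi)) := fun z hz => by
    obtain ⟨k, hk, -⟩ := exists_windingAngle_eq (h z hz)
    exact AddSubgroup.mem_zmultiples_iff.2 ⟨k, by rw [hk, zsmul_eq_mul, mul_comm]⟩
  have hconst : windingAngle P x = windingAngle P y :=
    (convex_segment (𝕜 := ℝ) x y).isPreconnected.constant_of_mapsTo
      ⟨inferInstanceAs (DiscreteTopology (AddSubgroup.zmultiples (2 * Real.pi)))⟩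
      (fun z hz => (continuousAt_windingAngle (h z hz)).continuousWithinAt) hmaps
      (left_mem_segment ℝ x y) (right_mem_segment ℝ x y)
  obtain ⟨k, hk, hk_odd⟩ := exists_windingAngle_eq (h x (left_mem_segment ℝ x y))
  obtain ⟨l, hl, hl_odd⟩ := exists_windingAngle_eq (h y (right_mem_segment ℝ x y))
  rw [hk, hl, mul_right_inj' (by positivity), Int.cast_inj] at hconst
  rw [hk_odd, hl_odd, hconst]

end Winding

/-- The area form of the plane multiplied by `ε`. The orientation of a polygon is recorded by the
choice of `ε` in `{1, -1}`, so that one set of inequalities serves both orientations. -/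
noncomputable def wedge (ε : ℝ) : Plane →ₗ[ℝ] Plane →ₗ[ℝ] ℝ :=
  LinearMap.mk₂ ℝ (fun x y => ε * (x 0 * y 1 - x 1 * y 0))
    (by intros; simp; ring) (by intros; simp; ring) (by intros; simp; ring) (by intros; simp; ring)

lemma wedge_apply (ε : ℝ) (x y : Plane) : wedge ε x y = ε * (x 0 * y 1 - x 1 * y 0) := rfl

@[simp] lemma wedge_self (ε : ℝ) (x : Plane) : wedge ε x x = 0 := by
  rw [wedge_apply]; ring

lemma wedge_swap (ε : ℝ) (x y : Plane) : wedge ε y x = -wedge ε x y := by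
  rw [wedge_apply, wedge_apply]; ring

lemma wedge_neg_sign (ε : ℝ) (x y : Plane) : wedge (-ε) x y = -wedge ε x y := by
  rw [wedge_apply, wedge_apply]; ring

lemma wedge_smul_eq (ε : ℝ) (x y z : Plane) :
    wedge ε x y • z = wedge ε z y • x + wedge ε x z • y := by
  ext i
  fin_cases i <;> simp [wedge_apply] <;> ring

lemma continuous_wedge (ε : ℝ) (x : Plane) : Continuous (wedge ε x) :=
  (wedge ε x).continuous_of_finiteDimensional

lemma im_div_toComplex_nonneg_iff {d z : Plane} (hd : d ≠ 0) :
    0 ≤ (toComplex z / toComplex d).im ↔ 0 ≤ wedge 1 d z := by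
  rw [im_div_nonneg_iff (by simpa using hd), wedge_apply, one_mul]
  simp

lemma exists_im_div_nonneg_of_wedge_nonneg {ε : ℝ} (hε : ε = 1 ∨ ε = -1) {d : Plane} (hd : d ≠ 0) :
    ∃ u : ℂ, u ≠ 0 ∧ ∀ z, 0 ≤ wedge ε d z → 0 ≤ (toComplex z / u).im := by
  rcases hε with rfl | rfl
  · exact ⟨toComplex d, by simpa using hd, fun z => (im_div_toComplex_nonneg_iff hd).2⟩
  · refine ⟨toComplex (-d), by simpa using hd, fun z hz =>
      (im_div_toComplex_nonneg_iff (neg_ne_zero.2 hd)).2 ?_⟩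
    simpa [wedge_neg_sign] using hz

lemma notMem_region_of_wedge_nonneg {n : ℕ} [NeZero n] {P : Polygon Plane n} {x d : Plane} {ε : ℝ}
    (hε : ε = 1 ∨ ε = -1) (hx : x ∉ P.boundary ℝ) (hd : d ≠ 0)
    (h : ∀ i, 0 ≤ wedge ε d (P i - x)) : x ∉ P.region := by
  obtain ⟨u, hu, him⟩ := exists_im_div_nonneg_of_wedge_nonneg hε hd
  have hvertex (i : Fin n) : 0 ≤ ((toComplex (P i) - toComplex x) / u).im := by
    rw [← map_sub]; exact him _ (h i)
  have hwinding : windingAngle P x = 0 := by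
    have hedge (i : Fin n) := arg_div_of_im_nonneg hu (hvertex i) (hvertex (i + 1))
      (notMem_segment_iff_toComplex.1 (notMem_boundary_iff.1 hx i))
    simp only [windingAngle, hedge, Finset.sum_sub_distrib, sub_eq_zero]
    exact Equiv.sum_comp (Equiv.addRight (1 : Fin n))
      fun i => Complex.arg ((toComplex (P i) - toComplex x) / u)
  obtain ⟨k, hk, hodd⟩ := exists_windingAngle_eq hx
  obtain rfl : k = 0 := by simpa [hwinding, Real.pi_ne_zero, eq_comm] using hk
  simp [hodd]

/-! ### The sum of the turning angles -/

section TurningAngles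

open Complex Finset

lemma exists_im_div_pos_of_disjoint_segment {a b c d : ℂ}
    (h : Disjoint (segment ℝ a b) (segment ℝ c d)) :
    ∃ u : ℂ, ∀ x ∈ segment ℝ a b, ∀ y ∈ segment ℝ c d, 0 < ((y - x) / u).im := by
  have hcompact (x y : ℂ) : IsCompact (segment ℝ x y) := by
    rw [segment_eq_image_lineMap]
    exact isCompact_Icc.image (by fun_prop)
  obtain ⟨f, s, t, hs, hst, ht⟩ := geometric_hahn_banach_compact_closed (convex_segment a b)
    (hcompact a b) (convex_segment c d) (hcompact c d).isClosed h
  refine ⟨(⟨f I, f 1⟩ : ℂ)⁻¹, fun x hx y hy => ?_⟩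
  have hf (z : ℂ) : (z / (⟨f I, f 1⟩ : ℂ)⁻¹).im = f z := by
    rw [div_inv_eq_mul, mul_im, ← smul_eq_mul, ← smul_eq_mul (a := z.im), ← map_smul, ← map_smul,
      ← map_add]
    simp [re_add_im]
  rw [hf, map_sub]
  linarith [hs x hx, ht y hy]

lemma arg_div_of_im_pos {u z w : ℂ} (hz : 0 < (z / u).im) (hw : 0 < (w / u).im) :
    arg (w / z) = arg (w / u) - arg (z / u) := by
  have hu : u ≠ 0 := by rintro rfl; simp at hz
  have hslit : w / u / (z / u) ∈ slitPlane := by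
    have hseg : (0 : ℂ) ∉ segment ℝ (z / u) (w / u) := fun h0 =>
      lt_irrefl (0 : ℝ) ((convex_halfSpace_im_gt 0).segment_subset hz hw h0)
    simpa using notMem_segment_iff_div_mem_slitPlane.1 hseg
  rw [div_div_div_cancel_right₀ hu] at hslit
  exact arg_div_of_im_nonneg hu hz.le hw.le hslit

lemma arg_add_arg_of_disjoint_segment {a b c d : ℂ}
    (h : Disjoint (segment ℝ a b) (segment ℝ c d)) :
    arg ((c - b) / (c - a)) + arg ((d - b) / (c - b)) =
      arg ((d - a) / (c - a)) + arg ((d - b) / (d - a)) := by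
  obtain ⟨u, hu⟩ := exists_im_div_pos_of_disjoint_segment h
  have hca := hu a (left_mem_segment ℝ a b) c (left_mem_segment ℝ c d)
  have hda := hu a (left_mem_segment ℝ a b) d (right_mem_segment ℝ c d)
  have hcb := hu b (right_mem_segment ℝ a b) c (left_mem_segment ℝ c d)
  have hdb := hu b (right_mem_segment ℝ a b) d (right_mem_segment ℝ c d)
  rw [arg_div_of_im_pos hca hcb, arg_div_of_im_pos hcb hdb, arg_div_of_im_pos hca hda,
    arg_div_of_im_pos hda hdb]
  ring

/-- The exterior angle at the vertex `q (k + 1)` of a polygonal line `q`. -/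
noncomputable def turnAngle (q : ℕ → ℂ) (k : ℕ) : ℝ :=
  arg ((q (k + 2) - q (k + 1)) / (q (k + 1) - q k))

/-- The angle by which the line of sight from `q i` rotates when its other end moves along the
polygonal line from `q (i + 1)` to `q j`. -/
noncomputable def sweptAngle (q : ℕ → ℂ) (i j : ℕ) : ℝ :=
  ∑ k ∈ Ico (i + 1) j, arg ((q (k + 1) - q i) / (q k - q i))

variable {q : ℕ → ℂ} {m : ℕ}

lemma sweptAngle_succ_right {i j : ℕ} (h : i < j) :
    sweptAngle q i (j + 1) = sweptAngle q i j + arg ((q (j + 1) - q i) / (q j - q i)) :=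
  sum_Ico_succ_top h _

lemma turnAngle_add_sweptAngle {i j : ℕ} (hij : i + 2 ≤ j)
    (hdisj : ∀ k, i + 2 ≤ k → k < j →
      Disjoint (segment ℝ (q i) (q (i + 1))) (segment ℝ (q k) (q (k + 1))))
    (hturn : ((q (i + 2) - q (i + 1)) / (q (i + 1) - q i)).im ≠ 0) :
    turnAngle q i + sweptAngle q (i + 1) j =
      sweptAngle q i j + arg ((q j - q (i + 1)) / (q j - q i)) := by
  induction j, hij using Nat.le_induction with
  | base =>
    have hadd := arg_div_add_arg_div hturn
    rw [sub_add_sub_cancel'] at hadd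
    simp [sweptAngle, turnAngle, hadd]
  | succ j hij ih =>
    rw [sweptAngle_succ_right (by omega), sweptAngle_succ_right (by omega)]
    linarith [ih fun k hik hkj => hdisj k hik (hkj.trans j.lt_succ_self),
      arg_add_arg_of_disjoint_segment (hdisj j hij j.lt_succ_self)]

/-- This is Hopf's argument: deform the tangent directions into the directions of the chords
`q j - q i`, letting first `j` and then `i` run once around the polygon. -/
theorem sum_turnAngle_eq (hm : 2 ≤ m) (hq_zero : q (m + 1) = q 0) (hq_one : q (m + 2) = q 1)
    (hdisj : ∀ i j, i + 1 < j → j ≤ m → ¬ (i = 0 ∧ j = m) →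
      Disjoint (segment ℝ (q i) (q (i + 1))) (segment ℝ (q j) (q (j + 1))))
    (hturn : ∀ k, k ≤ m → ((q (k + 2) - q (k + 1)) / (q (k + 1) - q k)).im ≠ 0) :
    ∑ k ∈ range (m + 1), turnAngle q k = 2 * sweptAngle q 0 m + 2 * turnAngle q m := by
  have hfirst : turnAngle q 0 + sweptAngle q 1 m =
      sweptAngle q 0 m + arg ((q m - q 1) / (q m - q 0)) :=
    turnAngle_add_sweptAngle hm (fun k hk hkm => hdisj 0 k (by omega) (by omega) (by omega))
      (hturn 0 (by omega))
  have hclose : sweptAngle q 1 (m + 1) = sweptAngle q 1 m + arg ((q 0 - q 1) / (q m - q 1)) := by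
    rw [sweptAngle_succ_right (by omega), hq_zero]
  have hlast : arg ((q m - q 1) / (q m - q 0)) + arg ((q 0 - q 1) / (q m - q 1)) =
      turnAngle q m := by
    have hratio : (q 0 - q 1) / (q m - q 0) = (q 1 - q 0) / (q 0 - q m) := by
      rw [← neg_sub, ← neg_sub (q 0) (q m), neg_div_neg_eq]
    have hbend := hturn m le_rfl
    rw [hq_zero, hq_one, ← hratio] at hbend
    have hadd := arg_div_add_arg_div hbend
    rw [turnAngle, hq_zero, hq_one, ← hratio]
    rwa [sub_add_sub_cancel] at hadd
  have hmiddle (i : ℕ) (hi : 1 ≤ i) : i ≤ m →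
      ∑ k ∈ Ico 1 i, turnAngle q k + sweptAngle q i (m + 1) =
        sweptAngle q 1 (m + 1) + sweptAngle q 0 i := by
    induction i, hi using Nat.le_induction with
    | base => simp [sweptAngle]
    | succ i hi ih =>
      intro him
      have hstep := turnAngle_add_sweptAngle (q := q) (i := i) (j := m + 1) (by omega)
        (fun k hk hkm => hdisj i k (by omega) (by omega) (by omega)) (hturn i (by omega))
      rw [hq_zero, ← neg_sub (q (i + 1)), ← neg_sub (q i), neg_div_neg_eq] at hstep
      rw [sum_Ico_succ_top hi, sweptAngle_succ_right (j := i) (by omega)]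
      linarith [ih (by omega)]
  have hend : sweptAngle q m (m + 1) = 0 := by simp [sweptAngle]
  rw [sum_range_succ, range_eq_Ico, sum_eq_sum_Ico_succ_bot (by omega)]
  linarith [hmiddle m (by omega) le_rfl]

lemma exists_pos_im_div_sub_eq {a b : ℂ} (h : (b / a).im ≠ 0) :
    ∃ r : ℝ, 0 < r ∧ (b / (a - b)).im = r * (b / a).im := by
  have ha : a ≠ 0 := by rintro rfl; simp at h
  have hab : a - b ≠ 0 := by rintro hab; simp [← sub_eq_zero.1 hab, ha] at h
  have ha_sq := normSq_pos.2 ha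
  refine ⟨normSq a / normSq (a - b), div_pos ha_sq (normSq_pos.2 hab), ?_⟩
  rw [im_div_eq, im_div_eq, div_mul_div_comm, mul_comm (normSq a), mul_div_mul_right _ _ ha_sq.ne',
    sub_re, sub_im]
  ring

/-- The angle from `-a` to `b` through the outer bisector of the corner with sides `-a` and `b`. -/
lemma arg_add_arg_outer {a b : ℂ} (h : (b / a).im ≠ 0) :
    arg ((a - b) / (-a)) + arg (b / (a - b)) =
      if 0 < arg (b / a) then arg (b / a) + Real.pi else arg (b / a) - Real.pi := by
  have ha : a ≠ 0 := by rintro rfl; simp at h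
  obtain ⟨r, hr, him⟩ := exists_pos_im_div_sub_eq h
  have him_sub : ((a - b) / a).im = -(b / a).im := by simp [sub_div, ha]
  have hadd := arg_div_add_arg_div (a := a) (b := -b) (by simpa [neg_div] using h)
  rw [← sub_eq_add_neg, neg_div, neg_div] at hadd
  rw [div_neg]
  rcases h.lt_or_gt with hneg | hpos
  · rw [arg_neg_eq_arg_add_pi_of_im_neg hneg,
      arg_neg_eq_arg_add_pi_of_im_neg (him ▸ mul_neg_of_pos_of_neg hr hneg)] at hadd
    rw [if_neg (arg_neg_iff.2 hneg).not_gt, arg_neg_eq_arg_sub_pi_of_im_pos (by linarith)]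
    linarith
  · rw [arg_neg_eq_arg_sub_pi_of_im_pos hpos,
      arg_neg_eq_arg_sub_pi_of_im_pos (him ▸ mul_pos hr hpos)] at hadd
    rw [if_pos (arg_mem_Ioo_of_im_pos hpos).1, arg_neg_eq_arg_add_pi_of_im_neg (by linarith)]
    linarith

end TurningAngles

section Orientation

open Fin.CommRing

variable {n : ℕ} [NeZero n] {P : Polygon Plane n}

lemma natCast_ne_natCast_of_lt {a b : ℕ} (hab : a < b) (hba : b < a + n) :
    (a : Fin n) ≠ (b : Fin n) := fun h => by
  rw [CharP.natCast_eq_natCast (Fin n) n, Nat.modEq_iff_dvd' hab.le] at h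
  have := Nat.le_of_dvd (by omega) h
  omega

lemma sum_add_natCast {M : Type*} [AddCommMonoid M] (i : Fin n) (f : Fin n → M) :
    ∑ k ∈ Finset.range n, f (i + (k : Fin n)) = ∑ j, f j := by
  rw [Finset.sum_range]
  simp only [Fin.cast_val_eq_self]
  exact Equiv.sum_comp (Equiv.addLeft i) f

lemma exists_wedge_ne_zero {ε : ℝ} (hε : ε ≠ 0) {x : Plane} (hx : x ≠ 0) :
    ∃ y, wedge ε x y ≠ 0 := by
  by_contra! h
  refine hx (PiLp.ext fun i => ?_)
  fin_cases i
  · simpa [wedge_apply, hε] using h !₂[0, 1]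
  · simpa [wedge_apply, hε] using h !₂[1, 0]

lemma collinear_iff_wedge {ε : ℝ} (hε : ε ≠ 0) {x y z : Plane} :
    Collinear ℝ {x, y, z} ↔ wedge ε (y - x) (z - y) = 0 := by
  refine ⟨fun h => ?_, fun h => ?_⟩
  · obtain ⟨v, hv⟩ := (collinear_iff_of_mem (p₀ := y) (by simp)).1 h
    obtain ⟨r, hr⟩ := hv x (by simp)
    obtain ⟨s, hs⟩ := hv z (by simp)
    simp [hr, hs]
  · rcases eq_or_ne x y with rfl | hxy
    · simpa using collinear_pair ℝ x z
    obtain ⟨w, hw⟩ := exists_wedge_ne_zero hε (sub_ne_zero.2 hxy.symm)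
    have hparallel : z - y = (wedge ε (z - y) w / wedge ε (y - x) w) • (y - x) := by
      have hcramer := wedge_smul_eq ε (y - x) w (z - y)
      rw [h, zero_smul, add_zero] at hcramer
      rw [div_eq_inv_mul, mul_smul, ← hcramer, inv_smul_smul₀ hw]
    refine (collinear_iff_of_mem (p₀ := y) (by simp)).2 ⟨y - x, ?_⟩
    simp only [Set.mem_insert_iff, Set.mem_singleton_iff, forall_eq_or_imp, forall_eq]
    exact ⟨⟨-1, by simp⟩, ⟨0, by simp⟩, ⟨_, by rw [← hparallel]; simp⟩⟩

lemma im_div_toComplex_ne_zero {a b : Plane} (h : wedge 1 a b ≠ 0) :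
    (toComplex b / toComplex a).im ≠ 0 := by
  have ha : toComplex a ≠ 0 := fun ha => h (by simp [show a = 0 by simpa using ha])
  rw [Ne, im_div_eq_zero_iff ha]
  simpa [wedge_apply] using h

lemma disjoint_segment_toComplex {a b c d : Plane}
    (h : Disjoint (segment ℝ a b) (segment ℝ c d)) :
    Disjoint (segment ℝ (toComplex a) (toComplex b)) (segment ℝ (toComplex c) (toComplex d)) := by
  have himage (x y : Plane) : segment ℝ (toComplex x) (toComplex y) = toComplex '' segment ℝ x y :=
    (image_segment ℝ toComplex.toLinearEquiv.toLinearMap.toAffineMap x y).symm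
  rw [himage, himage]
  exact (Set.disjoint_image_iff toComplex.injective).2 h

lemma disjoint_edge_of_isSimple (h : P.IsSimple) {i j : Fin n} (hij : i ≠ j) (hj : j ≠ i + 1)
    (hi : i ≠ j + 1) : Disjoint (segment ℝ (P i) (P (i + 1))) (segment ℝ (P j) (P (j + 1))) := by
  rw [← edgeSet_eq_segment, ← edgeSet_eq_segment, Set.disjoint_left]
  intro x hxi hxj
  rcases h.2.2 i j hij x ⟨hxi, hxj⟩ with ⟨heq, -⟩ | ⟨heq, -⟩
  exacts [hj heq, hi heq]

lemma vertex_notMem_edge_of_isSimple (h : P.IsSimple) {i j : Fin n} (hij : i ≠ j)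
    (hi : i ≠ j + 1) : P i ∉ segment ℝ (P j) (P (j + 1)) := by
  rw [← edgeSet_eq_segment]
  intro hmem
  have hself : P i ∈ P.edgeSet ℝ i := edgeSet_eq_segment P i ▸ left_mem_segment ℝ _ _
  rcases h.2.2 i j hij (P i) ⟨hself, hmem⟩ with ⟨-, heq⟩ | ⟨heq, -⟩
  exacts [hij (h.2.1 heq), hi heq]

/-- The signed exterior angle of a polygon at a vertex. -/
noncomputable def turn (P : Polygon Plane n) (i : Fin n) : ℝ :=
  Complex.arg (toComplex (P (i + 1) - P i) / toComplex (P i - P (i - 1)))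

/-- The vertices of a polygon as complex numbers, listed periodically from the `i`-th one on. -/
noncomputable def vertexSeq (P : Polygon Plane n) (i : Fin n) (k : ℕ) : ℂ :=
  toComplex (P (i + (k : Fin n)))

lemma vertexSeq_add_self (P : Polygon Plane n) (i : Fin n) (k : ℕ) :
    vertexSeq P i (k + n) = vertexSeq P i k := by
  rw [vertexSeq, Nat.cast_add, CharP.cast_eq_zero (Fin n) n, add_zero, vertexSeq]

lemma vertexSeq_zero (P : Polygon Plane n) (i : Fin n) : vertexSeq P i 0 = toComplex (P i) := by
  simp [vertexSeq]

lemma vertexSeq_succ (P : Polygon Plane n) (i : Fin n) (k : ℕ) :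
    vertexSeq P i (k + 1) = toComplex (P (i + (k : Fin n) + 1)) := by
  simp [vertexSeq, add_assoc]

lemma vertexSeq_one (P : Polygon Plane n) (i : Fin n) :
    vertexSeq P i 1 = toComplex (P (i + 1)) := by
  simp [vertexSeq]

lemma vertexSeq_pred (P : Polygon Plane n) (i : Fin n) {m : ℕ} (hm : m + 1 = n) :
    vertexSeq P i m = toComplex (P (i - 1)) := by
  have hcast : ((m + 1 : ℕ) : Fin n) = 0 := by rw [hm, CharP.cast_eq_zero]
  rw [Nat.cast_succ] at hcast
  rw [vertexSeq, sub_eq_add_neg, ← eq_neg_of_add_eq_zero_left hcast]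

/-- No three consecutive vertices are collinear. -/
def Bends (P : Polygon Plane n) : Prop :=
  ∀ i, (toComplex (P (i + 1) - P i) / toComplex (P i - P (i - 1))).im ≠ 0

lemma bends_of_not_collinear (h : ∀ i, ¬ Collinear ℝ {P (i - 1), P i, P (i + 1)}) : Bends P :=
  fun i => im_div_toComplex_ne_zero fun hzero => h i ((collinear_iff_wedge one_ne_zero).2 hzero)

lemma vertexSeq_div_eq (P : Polygon Plane n) (i : Fin n) (k : ℕ) :
    (vertexSeq P i (k + 2) - vertexSeq P i (k + 1)) / (vertexSeq P i (k + 1) - vertexSeq P i k) =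
      toComplex (P (i + (k : Fin n) + 1 + 1) - P (i + (k : Fin n) + 1)) /
        toComplex (P (i + (k : Fin n) + 1) - P (i + (k : Fin n) + 1 - 1)) := by
  rw [vertexSeq_succ P i k, vertexSeq_succ P i (k + 1), map_sub, map_sub, add_sub_cancel_right,
    Nat.cast_succ, ← add_assoc, vertexSeq]

lemma turnAngle_vertexSeq (P : Polygon Plane n) (i : Fin n) (k : ℕ) :
    turnAngle (vertexSeq P i) k = turn P (i + (k : Fin n) + 1) := by
  rw [turnAngle, vertexSeq_div_eq, turn]

lemma sum_turnAngle_vertexSeq (P : Polygon Plane n) (i : Fin n) :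
    ∑ k ∈ Finset.range n, turnAngle (vertexSeq P i) k = ∑ j, turn P j := by
  simp only [turnAngle_vertexSeq, add_right_comm i _ 1, sum_add_natCast]

lemma disjoint_segment_vertexSeq (h : P.IsSimple) (i : Fin n) {a b : ℕ} (hab : a + 1 < b)
    (hb : b + 1 < a + n) :
    Disjoint (segment ℝ (vertexSeq P i a) (vertexSeq P i (a + 1)))
      (segment ℝ (vertexSeq P i b) (vertexSeq P i (b + 1))) := by
  rw [vertexSeq_succ, vertexSeq_succ]
  refine disjoint_segment_toComplex (disjoint_edge_of_isSimple h ?_ ?_ ?_)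
  · exact fun heq => natCast_ne_natCast_of_lt (by omega) (by omega) (add_left_cancel heq)
  · rw [add_assoc, ← Nat.cast_succ]
    exact fun heq => natCast_ne_natCast_of_lt hab (by omega) (add_left_cancel heq).symm
  · rw [add_assoc, ← Nat.cast_succ]
    exact fun heq => natCast_ne_natCast_of_lt (by omega) hb (add_left_cancel heq)

lemma vertexSeq_div_mem_slitPlane (h : P.IsSimple) (i : Fin n) {k : ℕ} (hk : 1 ≤ k)
    (hkn : k + 1 < n) :
    (vertexSeq P i (k + 1) - vertexSeq P i 0) / (vertexSeq P i k - vertexSeq P i 0) ∈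
      Complex.slitPlane := by
  have hne {l : ℕ} (hl : 0 < l) (hln : l < n) : i ≠ i + (l : Fin n) := by
    rw [Ne, left_eq_add, ← Nat.cast_zero, eq_comm]
    exact natCast_ne_natCast_of_lt hl (by omega)
  rw [vertexSeq_zero, vertexSeq_succ, vertexSeq, ← notMem_segment_iff_toComplex]
  refine vertex_notMem_edge_of_isSimple h (hne hk (by omega)) ?_
  rw [add_assoc, ← Nat.cast_succ]
  exact hne k.succ_pos hkn

lemma sum_turn_eq (h : P.IsSimple) (hbend : Bends P) (i : Fin n) :
    ∑ j, turn P j = 2 * sweptAngle (vertexSeq P i) 0 (n - 1) + 2 * turn P i := by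
  obtain ⟨m, rfl⟩ : ∃ m, n = m + 1 := Nat.exists_eq_succ_of_ne_zero (NeZero.ne n)
  have hm : 3 ≤ m + 1 := h.1
  have hlast : turnAngle (vertexSeq P i) m = turn P i := by
    rw [turnAngle_vertexSeq, add_assoc, ← Nat.cast_succ, CharP.cast_eq_zero, add_zero]
  rw [← sum_turnAngle_vertexSeq P i, sum_turnAngle_eq (by omega), hlast, Nat.add_sub_cancel]
  · simpa using vertexSeq_add_self P i 0
  · rw [← vertexSeq_add_self P i 1, Nat.add_comm 1, Nat.add_right_comm]
  · exact fun a b hab hbm hne => disjoint_segment_vertexSeq h i hab (by omega)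
  · intro k _
    rw [vertexSeq_div_eq]
    exact hbend _

/-- The lowest vertex `i` sees all others in a half plane, so its swept angle is a difference of two
arguments and cancels the turning angle at `i` up to `π`. -/
theorem exists_sum_turn_eq (h : P.IsSimple) (hbend : Bends P) :
    ∃ ε : ℝ, (ε = 1 ∨ ε = -1) ∧ ∑ j, turn P j = 2 * Real.pi * ε := by
  obtain ⟨i, hi⟩ := Finite.exists_min fun i => P i 1
  have hn : 3 ≤ n := h.1
  have him (k : ℕ) : 0 ≤ ((vertexSeq P i k - vertexSeq P i 0) / 1).im := by
    rw [div_one, vertexSeq_zero, vertexSeq]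
    simpa using hi _
  have hswept : sweptAngle (vertexSeq P i) 0 (n - 1) =
      Complex.arg (vertexSeq P i (n - 1) - vertexSeq P i 0) -
        Complex.arg (vertexSeq P i 1 - vertexSeq P i 0) := by
    simpa only [div_one, sweptAngle, zero_add] using sum_arg_div_of_im_nonneg (u := 1) one_ne_zero
      (fun k => vertexSeq P i k - vertexSeq P i 0) (show 1 ≤ n - 1 by omega)
      (fun k _ _ => him k) (fun k hk hkn => vertexSeq_div_mem_slitPlane h i hk (by omega))
  set r := (vertexSeq P i 1 - vertexSeq P i 0) / (vertexSeq P i (n - 1) - vertexSeq P i 0) with hr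
  have hratio : toComplex (P (i + 1) - P i) / toComplex (P i - P (i - 1)) = -r := by
    rw [hr, vertexSeq_zero, vertexSeq_one, vertexSeq_pred P i (show n - 1 + 1 = n by omega),
      map_sub, map_sub, ← div_neg, neg_sub]
  have hr_im : r.im ≠ 0 := neg_ne_zero.1 (by rw [← Complex.neg_im, ← hratio]; exact hbend i)
  have harg := arg_div_of_im_nonneg one_ne_zero (him (n - 1)) (him 1) (Or.inr hr_im)
  rw [← hr, div_one, div_one] at harg
  rw [sum_turn_eq h hbend i, hswept, turn, hratio]
  rcases hr_im.lt_or_gt with hneg | hpos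
  · exact ⟨1, Or.inl rfl, by rw [Complex.arg_neg_eq_arg_add_pi_of_im_neg hneg, harg]; ring⟩
  · exact ⟨-1, Or.inr rfl, by rw [Complex.arg_neg_eq_arg_sub_pi_of_im_pos hpos, harg]; ring⟩

end Orientation

section NearEdge

open Complex Filter

lemma tendsto_arg_of_eq_pos_mul {f g : ℝ → ℂ} (hg : ContinuousAt g 0) (hslit : g 0 ∈ slitPlane)
    (hf : ∀ t, 0 < t → ∃ c : ℝ, 0 < c ∧ f t = c * g t) :
    Tendsto (fun t => arg (f t)) (𝓝[>] 0) (𝓝 (arg (g 0))) ∧ ∀ᶠ t in 𝓝[>] 0, f t ∈ slitPlane := by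
  have hlim : Tendsto g (𝓝[>] 0) (𝓝 (g 0)) := hg.tendsto.mono_left nhdsWithin_le_nhds
  constructor
  · refine ((continuousAt_arg hslit).tendsto.comp hlim).congr' ?_
    filter_upwards [self_mem_nhdsWithin] with t ht
    obtain ⟨c, hc, heq⟩ := hf t ht
    rw [heq, arg_real_mul _ hc, Function.comp_apply]
  · filter_upwards [self_mem_nhdsWithin, hlim (isOpen_slitPlane.mem_nhds hslit)] with t ht hgt
    obtain ⟨c, hc, heq⟩ := hf t ht
    rw [Set.mem_preimage, mem_slitPlane_iff_arg] at hgt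
    rw [mem_slitPlane_iff_arg, heq, arg_real_mul _ hc]
    exact ⟨hgt.1, mul_ne_zero (ofReal_ne_zero.2 hc.ne') hgt.2⟩

variable {z w s : ℂ}

lemma tendsto_arg_near_start (h : w / s ∈ slitPlane) :
    Tendsto (fun t : ℝ => arg ((w + t * s) / (t * s))) (𝓝[>] 0) (𝓝 (arg (w / s))) ∧
      ∀ᶠ t : ℝ in 𝓝[>] 0, (w + t * s) / (t * s) ∈ slitPlane := by
  have hlim := tendsto_arg_of_eq_pos_mul (f := fun t : ℝ => (w + t * s) / (t * s))
    (g := fun t : ℝ => (w + t * s) / s) (by fun_prop) (by simpa using h) fun t ht => by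
      refine ⟨t⁻¹, inv_pos.2 ht, ?_⟩
      rw [ofReal_inv, mul_comm (t : ℂ), div_mul_eq_div_div, div_eq_inv_mul _ (t : ℂ)]
  simpa using hlim

lemma tendsto_arg_near_end (h : s / z ∈ slitPlane) :
    Tendsto (fun t : ℝ => arg (t * s / (z + t * s))) (𝓝[>] 0) (𝓝 (arg (s / z))) ∧
      ∀ᶠ t : ℝ in 𝓝[>] 0, t * s / (z + t * s) ∈ slitPlane := by
  have hz := (ne_zero_and_ne_zero_of_div_mem_slitPlane h).1
  have hlim := tendsto_arg_of_eq_pos_mul (f := fun t : ℝ => t * s / (z + t * s))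
    (g := fun t : ℝ => s / (z + t * s)) (ContinuousAt.div (by fun_prop) (by fun_prop) (by simpa))
    (by simpa using h) fun t ht => ⟨t, ht, mul_div_assoc _ _ _⟩
  simpa using hlim

lemma tendsto_arg_off_edge (h : w / z ∈ slitPlane) :
    Tendsto (fun t : ℝ => arg ((w + t * s) / (z + t * s))) (𝓝[>] 0) (𝓝 (arg (w / z))) ∧
      ∀ᶠ t : ℝ in 𝓝[>] 0, (w + t * s) / (z + t * s) ∈ slitPlane := by
  have hz := (ne_zero_and_ne_zero_of_div_mem_slitPlane h).1
  have hlim := tendsto_arg_of_eq_pos_mul (f := fun t : ℝ => (w + t * s) / (z + t * s))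
    (g := fun t : ℝ => (w + t * s) / (z + t * s))
    (ContinuousAt.div (by fun_prop) (by fun_prop) (by simpa))
    (by simpa using h) fun t _ => ⟨1, one_pos, by simp⟩
  simpa using hlim

end NearEdge

section LocalOrientation

open Fin.CommRing Filter

variable {n : ℕ} [NeZero n] {P : Polygon Plane n}

/-- The points on the median at a vertex, used to test on which side of the boundary the region
lies. -/
noncomputable def medianPoint (P : Polygon Plane n) (i : Fin n) (t : ℝ) : Plane :=
  P i + t • ((P (i - 1) - P i) + (P (i + 1) - P i))

/-- The complex number whose argument is the angle under which the `k`-th edge after `P i` is seen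
from `medianPoint P i t`. -/
noncomputable def medianRatio (P : Polygon Plane n) (i : Fin n) (k : ℕ) (t : ℝ) : ℂ :=
  (vertexSeq P i (k + 1) - toComplex (medianPoint P i t)) /
    (vertexSeq P i k - toComplex (medianPoint P i t))

/-- Up to a positive factor, the limit of `medianRatio P i k t` as `t` tends to `0` from the right.
The first and the last edge contain `P i`, so they are seen under the angles which they form with
the median. -/
noncomputable def medianRatioLimit (P : Polygon Plane n) (i : Fin n) (k : ℕ) : ℂ :=
  if k = 0 then
    toComplex (P (i + 1) - P i) /
      (toComplex (P i - P (i - 1)) - toComplex (P (i + 1) - P i))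
  else if k + 1 = n then
    (toComplex (P i - P (i - 1)) - toComplex (P (i + 1) - P i)) / -toComplex (P i - P (i - 1))
  else (vertexSeq P i (k + 1) - vertexSeq P i 0) / (vertexSeq P i k - vertexSeq P i 0)

lemma medianRatio_eq (P : Polygon Plane n) (i : Fin n) (k : ℕ) (t : ℝ) :
    medianRatio P i k t =
      (vertexSeq P i (k + 1) - vertexSeq P i 0 +
          t * (toComplex (P i - P (i - 1)) - toComplex (P (i + 1) - P i))) /
        (vertexSeq P i k - vertexSeq P i 0 +
          t * (toComplex (P i - P (i - 1)) - toComplex (P (i + 1) - P i))) := by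
  have hpoint : toComplex (medianPoint P i t) = vertexSeq P i 0 -
      t * (toComplex (P i - P (i - 1)) - toComplex (P (i + 1) - P i)) := by
    simp only [medianPoint, vertexSeq_zero, map_add, map_sub, map_smul, Complex.real_smul]
    ring
  rw [medianRatio, hpoint, sub_sub_eq_add_sub, sub_sub_eq_add_sub, add_sub_right_comm,
    add_sub_right_comm]

lemma tendsto_arg_medianRatio (h : P.IsSimple) (hbend : Bends P) (i : Fin n) {k : ℕ} (hk : k < n) :
    Tendsto (fun t => Complex.arg (medianRatio P i k t)) (𝓝[>] 0)
        (𝓝 (Complex.arg (medianRatioLimit P i k))) ∧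
      ∀ᶠ t in 𝓝[>] 0, medianRatio P i k t ∈ Complex.slitPlane := by
  have : 3 ≤ n := h.1
  simp only [medianRatio_eq, medianRatioLimit]
  split_ifs with hfirst hlast
  · obtain ⟨r, hr, him⟩ := exists_pos_im_div_sub_eq (hbend i)
    subst hfirst
    rw [zero_add, vertexSeq_zero, vertexSeq_one, ← map_sub, sub_self]
    simp only [zero_add]
    exact tendsto_arg_near_start (Or.inr (him ▸ mul_ne_zero hr.ne' (hbend i)))
  · have hclose : vertexSeq P i (k + 1) = vertexSeq P i 0 := by
      simpa [hlast] using vertexSeq_add_self P i 0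
    rw [hclose, vertexSeq_pred P i hlast, vertexSeq_zero, sub_self,
      ← neg_sub (toComplex (P i)) (toComplex (P (i - 1))),
      ← map_sub toComplex (P i) (P (i - 1))]
    simp only [zero_add]
    have ha : toComplex (P i - P (i - 1)) ≠ 0 := fun ha => hbend i (by simp [ha])
    refine tendsto_arg_near_end (Or.inr ?_)
    rw [div_neg, sub_div, div_self ha]
    simpa only [Complex.neg_im, Complex.sub_im, Complex.one_im, zero_sub, neg_neg] using hbend i
  · exact tendsto_arg_off_edge (vertexSeq_div_mem_slitPlane h i (by omega) (by omega))

lemma sum_arg_medianRatioLimit (hn : 2 ≤ n) (hbend : Bends P) (i : Fin n) :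
    ∑ k ∈ Finset.range n, Complex.arg (medianRatioLimit P i k) =
      sweptAngle (vertexSeq P i) 0 (n - 1) +
        if 0 < turn P i then turn P i + Real.pi else turn P i - Real.pi := by
  obtain ⟨m, rfl⟩ : ∃ m, n = m + 1 := Nat.exists_eq_succ_of_ne_zero (NeZero.ne n)
  have hmiddle : ∑ k ∈ Finset.Ico 1 m, Complex.arg (medianRatioLimit P i k) =
      sweptAngle (vertexSeq P i) 0 m := by
    refine Finset.sum_congr rfl fun k hk => ?_
    rw [Finset.mem_Ico] at hk
    rw [medianRatioLimit, if_neg (by omega), if_neg (by omega)]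
  rw [Finset.sum_range_succ, Finset.range_eq_Ico, Finset.sum_eq_sum_Ico_succ_bot (by omega),
    zero_add, hmiddle, Nat.add_sub_cancel, turn, ← arg_add_arg_outer (hbend i), medianRatioLimit,
    medianRatioLimit, if_pos rfl, if_neg (by omega), if_pos rfl]
  ring

lemma tendsto_windingAngle_medianPoint (h : P.IsSimple) (hbend : Bends P) (i : Fin n) :
    Tendsto (fun t => windingAngle P (medianPoint P i t)) (𝓝[>] 0)
      (𝓝 (sweptAngle (vertexSeq P i) 0 (n - 1) +
        if 0 < turn P i then turn P i + Real.pi else turn P i - Real.pi)) := by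
  have hsum (t : ℝ) : windingAngle P (medianPoint P i t) =
      ∑ k ∈ Finset.range n, Complex.arg (medianRatio P i k t) := by
    rw [windingAngle, ← sum_add_natCast i]
    exact Finset.sum_congr rfl fun k _ => by rw [medianRatio, vertexSeq_succ, vertexSeq]
  simp only [hsum, ← sum_arg_medianRatioLimit ((show 2 ≤ 3 by norm_num).trans h.1) hbend i]
  exact tendsto_finsetSum _ fun k hk =>
    (tendsto_arg_medianRatio h hbend i (Finset.mem_range.1 hk)).1

lemma eventually_medianPoint_notMem_boundary (h : P.IsSimple) (hbend : Bends P) (i : Fin n) :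
    ∀ᶠ t in 𝓝[>] 0, medianPoint P i t ∉ P.boundary ℝ := by
  have hslit := (eventually_all_finset (Finset.range n)).2 fun k hk =>
    (tendsto_arg_medianRatio h hbend i (Finset.mem_range.1 hk)).2
  filter_upwards [hslit] with t ht
  refine notMem_boundary_iff.2 fun j => notMem_segment_iff_toComplex.2 ?_
  have hj := ht (j - i).val (Finset.mem_range.2 (j - i).isLt)
  rw [medianRatio, vertexSeq_succ, vertexSeq, Fin.cast_val_eq_self] at hj
  simpa using hj

lemma eventually_medianPoint_mem_region_iff (h : P.IsSimple) (hbend : Bends P) (i : Fin n) {l : ℤ}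
    (hl : sweptAngle (vertexSeq P i) 0 (n - 1) +
      (if 0 < turn P i then turn P i + Real.pi else turn P i - Real.pi) = 2 * Real.pi * l) :
    ∀ᶠ t in 𝓝[>] 0, (medianPoint P i t ∈ P.region ↔ Odd l) := by
  have hlim := tendsto_windingAngle_medianPoint h hbend i
  rw [hl] at hlim
  filter_upwards [eventually_medianPoint_notMem_boundary h hbend i,
    hlim (Metric.ball_mem_nhds _ Real.two_pi_pos)] with t hboundary hnear
  obtain ⟨k, hk, hodd⟩ := exists_windingAngle_eq hboundary
  rw [Set.mem_preimage, Metric.mem_ball, Real.dist_eq, hk, ← mul_sub, abs_mul,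
    abs_of_pos Real.two_pi_pos, mul_lt_iff_lt_one_right Real.two_pi_pos] at hnear
  have hkl : k = l := by
    rw [← sub_eq_zero, ← Int.abs_lt_one_iff]
    exact_mod_cast hnear
  rw [hodd, hkl]

/-- Just inside the corner at `P i` the winding number is `ε` or `0`, according to the sign of
`ε * turn P i`. -/
theorem exists_orientation (h : P.IsSimple) (hbend : Bends P) :
    ∃ ε : ℝ, (ε = 1 ∨ ε = -1) ∧ ∑ j, turn P j = 2 * Real.pi * ε ∧
      ∀ i, (P.IsConvexVertex i → 0 < ε * turn P i) ∧ (P.IsReflexVertex i → ε * turn P i < 0) := by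
  obtain ⟨ε, hε, hsum⟩ := exists_sum_turn_eq h hbend
  refine ⟨ε, hε, hsum, fun i => ?_⟩
  have hturn : turn P i ≠ 0 := fun hzero => hbend i (Complex.arg_eq_zero_iff.1 hzero).2
  have hεturn : ε * turn P i ≠ 0 := mul_ne_zero (by rcases hε with rfl | rfl <;> norm_num) hturn
  obtain ⟨l, hl, hodd⟩ : ∃ l : ℤ, sweptAngle (vertexSeq P i) 0 (n - 1) +
      (if 0 < turn P i then turn P i + Real.pi else turn P i - Real.pi) = 2 * Real.pi * l ∧
      (Odd l ↔ 0 < ε * turn P i) := by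
    rw [sum_turn_eq h hbend i] at hsum
    rcases hε with rfl | rfl <;> rcases hturn.lt_or_gt with hneg | hpos
    · exact ⟨0, by rw [if_neg hneg.not_gt]; push_cast; linarith, by simp [hneg.le]⟩
    · exact ⟨1, by rw [if_pos hpos]; push_cast; linarith, by simp [hpos]⟩
    · exact ⟨-1, by rw [if_neg hneg.not_gt]; push_cast; linarith, by simp [hneg]⟩
    · exact ⟨0, by rw [if_pos hpos]; push_cast; linarith, by simp [hpos.le]⟩
  have hregion := eventually_medianPoint_mem_region_iff h hbend i hl
  rw [hodd] at hregion
  constructor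
  · rintro ⟨-, hconvex⟩
    obtain ⟨t, hiff, hmem⟩ := (hregion.and hconvex).exists
    exact hiff.1 hmem
  · rintro ⟨-, hreflex⟩
    obtain ⟨t, hiff, hnotMem⟩ := (hregion.and hreflex).exists
    exact (not_lt.1 fun hpos => hnotMem (hiff.2 hpos)).lt_of_ne hεturn

end LocalOrientation

section Chains

/-- The edge vectors of a sequence of points. -/
def step (p : ℤ → Plane) (k : ℤ) : Plane := p (k + 1) - p k

/-- A closed polygonal line of period `n` composed of three chains, from `p 0` to `p β`, from `p β`
to `p γ` and from `p γ` to `p n = p 0`, to which the sides of a pseudo-triangle are reduced. Each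
chain bends strictly to one side, and every edge of a chain is turned to the other side, by less
than a straight angle, against every edge of the preceding chain. The sign `ε` records the
orientation. -/
structure TriChain (ε : ℝ) (p : ℤ → Plane) (β γ n : ℤ) : Prop where
  sign : ε = 1 ∨ ε = -1
  corners_lt : 0 < β ∧ β < γ ∧ γ < n
  periodic : ∀ k, p (k + n) = p k
  pos₁₂ : ∀ i j, 0 ≤ i → i < β → β ≤ j → j < γ → 0 < wedge ε (step p i) (step p j)
  pos₂₃ : ∀ i j, β ≤ i → i < γ → γ ≤ j → j < n → 0 < wedge ε (step p i) (step p j)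
  pos₃₁ : ∀ i j, γ ≤ i → i < n → 0 ≤ j → j < β → 0 < wedge ε (step p i) (step p j)
  neg₁ : ∀ i j, 0 ≤ i → i < j → j < β → wedge ε (step p i) (step p j) < 0
  neg₂ : ∀ i j, β ≤ i → i < j → j < γ → wedge ε (step p i) (step p j) < 0
  neg₃ : ∀ i j, γ ≤ i → i < j → j < n → wedge ε (step p i) (step p j) < 0

end Chains

section Unroll

open Fin.CommRing Finset

variable {n : ℕ} [NeZero n] {P : Polygon Plane n} {a b c : Fin n} {ε : ℝ}

/-- The vertices of a polygon, read off periodically from a given one. Indexing them by `ℤ` makes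
the position of an index on a side-chain a matter of linear arithmetic. -/
def unroll (P : Polygon Plane n) (a : Fin n) (k : ℤ) : Plane := P (a + (k : Fin n))

lemma unroll_add_period (P : Polygon Plane n) (a : Fin n) (k : ℤ) :
    unroll P a (k + n) = unroll P a k := by
  simp [unroll]

lemma unroll_succ (P : Polygon Plane n) (a : Fin n) (k : ℤ) :
    unroll P a (k + 1) = P (a + (k : Fin n) + 1) := by
  rw [unroll, Int.cast_add, Int.cast_one, add_assoc]

lemma unroll_pred (P : Polygon Plane n) (a : Fin n) (k : ℤ) :
    unroll P a (k - 1) = P (a + (k : Fin n) - 1) := by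
  rw [unroll, Int.cast_sub, Int.cast_one, add_sub_assoc]

lemma exists_div_eq_mul_exp {z : ℕ → ℂ} (hz : ∀ k, z k ≠ 0) {i j : ℕ} (hij : i ≤ j) :
    ∃ r : ℝ, 0 < r ∧
      z j / z i = r * Complex.exp ((∑ k ∈ Ioc i j, Complex.arg (z k / z (k - 1)) : ℝ) *
        Complex.I) := by
  induction j, hij using Nat.le_induction with
  | base => exact ⟨1, one_pos, by simp [hz]⟩
  | succ j hj ih =>
    obtain ⟨r, hr, h⟩ := ih
    refine ⟨r * ‖z (j + 1) / z j‖, mul_pos hr (norm_pos_iff.2 (div_ne_zero (hz _) (hz _))), ?_⟩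
    rw [← insert_Ioc_right_eq_Ioc_add_one hj, sum_insert (by simp), ← div_mul_div_cancel₀ (hz j), h]
    conv_lhs => rw [← Complex.norm_mul_exp_arg_mul_I (z (j + 1) / z j)]
    push_cast
    rw [add_mul, Complex.exp_add]
    ring

lemma turn_add_natCast (P : Polygon Plane n) (a : Fin n) {k : ℕ} (hk : 0 < k) :
    turn P (a + (k : Fin n)) = Complex.arg (toComplex (step (unroll P a) k) /
      toComplex (step (unroll P a) ((k - 1 : ℕ) : ℤ))) := by
  obtain ⟨k, rfl⟩ := Nat.exists_eq_add_of_lt hk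
  have hprev : a + ((0 + k + 1 : ℕ) : Fin n) - 1 = a + (k : Fin n) := by push_cast; ring
  rw [turn, hprev, step, step, unroll_succ, unroll_succ, unroll, unroll, Nat.add_sub_cancel,
    Int.cast_natCast, Int.cast_natCast, zero_add, Nat.cast_succ, ← add_assoc]

lemma exists_wedge_step_unroll_eq (hbend : Bends P) (a : Fin n) (hε : ε = 1 ∨ ε = -1) {i j : ℕ}
    (hij : i ≤ j) :
    ∃ r : ℝ, 0 < r ∧ wedge ε (step (unroll P a) i) (step (unroll P a) j) =
      r * Real.sin (∑ k ∈ Ioc i j, ε * turn P (a + (k : Fin n))) := by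
  set z : ℕ → ℂ := fun k => toComplex (step (unroll P a) k) with hz
  have hz0 : ∀ k, z k ≠ 0 := fun k hzero => hbend (a + (k : Fin n)) (by
    simp only [hz, step, unroll_succ] at hzero
    rw [unroll, Int.cast_natCast] at hzero
    rw [hzero, zero_div, Complex.zero_im])
  obtain ⟨r, hr, h⟩ := exists_div_eq_mul_exp hz0 hij
  have hnorm := Complex.normSq_pos.2 (hz0 i)
  refine ⟨r * Complex.normSq (z i), mul_pos hr hnorm, ?_⟩
  rw [sum_congr rfl fun k hk => (turn_add_natCast P a (by have := mem_Ioc.1 hk; omega)).symm] at h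
  have him := congrArg Complex.im h
  rw [Complex.im_ofReal_mul, Complex.exp_ofReal_mul_I_im, Complex.div_im, ← sub_div,
    div_eq_iff hnorm.ne'] at him
  rw [← mul_sum, wedge_apply]
  simp only [hz, toComplex_re, toComplex_im] at him ⊢
  rcases hε with rfl | rfl
  · rw [one_mul, one_mul]; linarith
  · rw [neg_one_mul, neg_one_mul, Real.sin_neg]; linarith

/-! ### The three side-chains of a pseudo-triangle -/

-- Both a set of indices and its complement are bounded from above by `π` for each of their corners.
lemma sum_mem_Ioo_of_sum_eq {ι : Type*} [DecidableEq ι] {s C A : Finset ι} {t : ι → ℝ}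
    (hC : C ⊆ s) (hcard : #C = 3) (hlt : ∀ k ∈ C, t k < Real.pi) (hneg : ∀ k ∈ s, k ∉ C → t k < 0)
    (hsum : ∑ k ∈ s, t k = 2 * Real.pi) (hAs : A ⊂ s) (hA : A.Nonempty) :
    ∑ k ∈ A, t k ∈ Set.Ioo ((#(A ∩ C) - 1) * Real.pi) (#(A ∩ C) * Real.pi) := by
  have hlt_card : ∀ B ⊆ s, B.Nonempty → ∑ k ∈ B, t k < #(B ∩ C) * Real.pi := fun B hBs hB =>
    calc ∑ k ∈ B, t k < ∑ k ∈ B, if k ∈ C then Real.pi else 0 := sum_lt_sum_of_nonempty hB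
          fun k hk => by split_ifs with hkC; exacts [hlt k hkC, hneg k (hBs hk) hkC]
      _ = #(B ∩ C) * Real.pi := by rw [sum_ite_mem, sum_const, nsmul_eq_mul]
  have hcompl := hlt_card (s \ A) sdiff_subset (sdiff_nonempty.2 hAs.2)
  have hcards : (#(A ∩ C) : ℝ) + #((s \ A) ∩ C) = 3 := by
    rw [inter_comm A, inter_comm (s \ A), ← inter_sdiff_assoc, inter_eq_left.2 hC]
    exact_mod_cast (card_inter_add_card_sdiff C A).trans hcard
  have hsums := sum_sdiff (f := t) hAs.1
  refine ⟨?_, hlt_card A hAs.1 hA⟩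
  rw [eq_sub_of_add_eq' hcards] at hcompl
  linarith

lemma not_collinear_of_isPseudoTriangle (h : P.IsPseudoTriangle a b c) (i : Fin n) :
    ¬ Collinear ℝ {P (i - 1), P i, P (i + 1)} := by
  obtain ⟨-, -, -, ha, hb, hc, hreflex⟩ := h
  by_cases hia : i = a
  · exact hia ▸ ha.1
  by_cases hib : i = b
  · exact hib ▸ hb.1
  by_cases hic : i = c
  · exact hic ▸ hc.1
  exact (hreflex i hia hib hic).1

lemma mul_turn_lt_pi (hbend : Bends P) (hε : ε = 1 ∨ ε = -1) (i : Fin n) :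
    ε * turn P i < Real.pi := by
  rcases hε with rfl | rfl
  · rw [one_mul]
    exact (Complex.arg_le_pi _).lt_of_ne fun h => hbend i (Complex.arg_eq_pi_iff.1 h).2
  · rw [neg_one_mul, neg_lt]
    exact Complex.neg_pi_lt_arg _

lemma sum_turn_Ioc_mem_Ioo (h : P.IsPseudoTriangle a b c) (hε : ε = 1 ∨ ε = -1)
    (htotal : ∑ i, turn P i = 2 * Real.pi * ε)
    (hreflex : ∀ i, P.IsReflexVertex i → ε * turn P i < 0) {i j : ℕ} (hij : i < j) (hjn : j < n) :
    ∑ k ∈ Ioc i j, ε * turn P (a + (k : Fin n)) ∈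
      Set.Ioo ((#(Ioc i j ∩ {(b - a).val, (c - a).val, n}) - 1) * Real.pi)
        (#(Ioc i j ∩ {(b - a).val, (c - a).val, n}) * Real.pi) := by
  have hbend := bends_of_not_collinear (not_collinear_of_isPseudoTriangle h)
  have hab : 0 < (b - a).val := h.2.1
  have hbc : (b - a).val < (c - a).val := h.2.2.1
  have hcn : (c - a).val < n := (c - a).isLt
  have hval : ∀ d : Fin n, d = a + ((d - a).val : Fin n) := fun d => by
    rw [Fin.cast_val_eq_self, add_sub_cancel]
  refine sum_mem_Ioo_of_sum_eq (s := Ioc 0 n) ?_ ?_ (fun k _ => mul_turn_lt_pi hbend hε _) ?_ ?_ ?_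
    (nonempty_Ioc.2 hij)
  · intro k hk
    simp only [mem_insert, mem_singleton] at hk
    exact mem_Ioc.2 (by omega)
  · rw [card_eq_three]
    exact ⟨_, _, _, hbc.ne, (hbc.trans hcn).ne, hcn.ne, rfl⟩
  · intro k hk hkC
    simp only [mem_insert, mem_singleton, not_or] at hkC
    have hkn := mem_Ioc.1 hk
    have hne : ∀ l < n, k ≠ l → (k : Fin n) ≠ (l : Fin n) := fun l hl hkl => by
      rcases hkl.lt_or_gt with hlt | hgt
      · exact natCast_ne_natCast_of_lt hlt (by omega)
      · exact (natCast_ne_natCast_of_lt hgt (by omega)).symm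
    refine hreflex _ (h.2.2.2.2.2.2 _ (fun hka => ?_) (fun hkb => ?_) (fun hkc => ?_))
    · exact hne 0 (by omega) (by omega) (by simpa using hka)
    · exact hne _ (by omega) hkC.1 (add_left_cancel (hkb.trans (hval b)))
    · exact hne _ (by omega) hkC.2.1 (add_left_cancel (hkc.trans (hval c)))
  · calc ∑ k ∈ Ioc 0 n, ε * turn P (a + (k : Fin n))
        = ∑ k ∈ range n, ε * turn P (a + 1 + (k : Fin n)) := by
          rw [← Ico_add_one_add_one_eq_Ioc, ← sum_Ico_add' _ 0 n 1, range_eq_Ico]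
          exact sum_congr rfl fun k _ => by push_cast; ring_nf
      _ = ε * ∑ i, turn P i := by rw [← mul_sum, sum_add_natCast (a + 1) (turn P)]
      _ = 2 * Real.pi := by rw [htotal]; rcases hε with rfl | rfl <;> ring
  · exact (ssubset_iff_of_subset (Ioc_subset_Ioc (Nat.zero_le i) hjn.le)).2
      ⟨n, mem_Ioc.2 (by omega), fun hn => by have := mem_Ioc.1 hn; omega⟩

lemma exists_wedge_step_sign (h : P.IsPseudoTriangle a b c) :
    ∃ ε : ℝ, (ε = 1 ∨ ε = -1) ∧ ∀ i j : ℕ, i < j → j < n →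
      (#(Ioc i j ∩ {(b - a).val, (c - a).val, n}) = 1 →
        0 < wedge ε (step (unroll P a) i) (step (unroll P a) j)) ∧
      (#(Ioc i j ∩ {(b - a).val, (c - a).val, n}) = 0 ∨
          #(Ioc i j ∩ {(b - a).val, (c - a).val, n}) = 2 →
        wedge ε (step (unroll P a) i) (step (unroll P a) j) < 0) := by
  have hbend := bends_of_not_collinear (not_collinear_of_isPseudoTriangle h)
  obtain ⟨ε, hε, htotal, hlocal⟩ := exists_orientation h.1 hbend
  refine ⟨ε, hε, fun i j hij hjn => ?_⟩
  obtain ⟨hlower, hupper⟩ := sum_turn_Ioc_mem_Ioo h hε htotal (fun i => (hlocal i).2) hij hjn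
  obtain ⟨r, hr, hwedge⟩ := exists_wedge_step_unroll_eq hbend a hε hij.le
  rw [hwedge]
  refine ⟨fun hone => mul_pos hr (Real.sin_pos_of_pos_of_lt_pi ?_ ?_), ?_⟩
  · simpa [hone] using hlower
  · simpa [hone] using hupper
  rintro (hzero | htwo) <;> refine mul_neg_of_pos_of_neg hr ?_
  · exact Real.sin_neg_of_neg_of_neg_pi_lt (by simpa [hzero] using hupper)
      (by simpa [hzero] using hlower)
  · rw [← Real.sin_sub_two_pi]
    rw [htwo] at hlower hupper
    push_cast at hlower hupper
    exact Real.sin_neg_of_neg_of_neg_pi_lt (by linarith) (by linarith)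

theorem exists_triChain (h : P.IsPseudoTriangle a b c) :
    ∃ ε, TriChain ε (unroll P a) ((b - a).val : ℤ) ((c - a).val : ℤ) n := by
  obtain ⟨ε, hε, hsign⟩ := exists_wedge_step_sign h
  have hab : 0 < (b - a).val := h.2.1
  have hbc : (b - a).val < (c - a).val := h.2.2.1
  have hcn : (c - a).val < n := (c - a).isLt
  generalize (b - a).val = β at *
  generalize (c - a).val = γ at *
  refine ⟨ε, hε, by omega, unroll_add_period P a, ?_, ?_, ?_, ?_, ?_, ?_⟩ <;>
    intro i j <;> intros <;>
    obtain ⟨i, rfl⟩ := Int.eq_ofNat_of_zero_le (show 0 ≤ i by omega) <;>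
    obtain ⟨j, rfl⟩ := Int.eq_ofNat_of_zero_le (show 0 ≤ j by omega)
  · refine (hsign i j (by omega) (by omega)).1 (card_eq_one.2 ⟨β, ext fun k => ?_⟩)
    simp only [mem_inter, mem_Ioc, mem_insert, mem_singleton]
    omega
  · refine (hsign i j (by omega) (by omega)).1 (card_eq_one.2 ⟨γ, ext fun k => ?_⟩)
    simp only [mem_inter, mem_Ioc, mem_insert, mem_singleton]
    omega
  · rw [wedge_swap, Left.neg_pos_iff]
    refine (hsign j i (by omega) (by omega)).2
      (Or.inr (card_eq_two.2 ⟨β, γ, by omega, ext fun k => ?_⟩))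
    simp only [mem_inter, mem_Ioc, mem_insert, mem_singleton]
    omega
  all_goals
    refine (hsign i j (by omega) (by omega)).2 (Or.inl (card_eq_zero.2 (ext fun k => ?_)))
    simp only [mem_inter, mem_Ioc, mem_insert, mem_singleton, notMem_empty, iff_false]
    omega

end Unroll

section Step

variable {ε : ℝ} {p : ℤ → Plane} {y : Plane} {l u : ℤ}

lemma map_sub_pos_of_step (f : Plane →ₗ[ℝ] ℝ) (hlu : l < u)
    (hf : ∀ j, l ≤ j → j < u → 0 < f (step p j)) : 0 < f (p u - p l) := by
  induction u, (show l + 1 ≤ u by omega) using Int.leInduction with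
  | base => exact hf l le_rfl (by omega)
  | succ u hlu' ih =>
    rw [← sub_add_sub_cancel, map_add]
    exact add_pos (hf u (by omega) (by omega)) (ih (by omega) fun j hj hju => hf j hj (by omega))

lemma map_sub_nonneg_of_step (f : Plane →ₗ[ℝ] ℝ) (hlu : l ≤ u)
    (hf : ∀ j, l ≤ j → j < u → 0 ≤ f (step p j)) : 0 ≤ f (p u - p l) := by
  induction u, hlu using Int.leInduction with
  | base => simp
  | succ u hlu' ih =>
    rw [← sub_add_sub_cancel, map_add]
    exact add_nonneg (hf u (by omega) (by omega)) (ih fun j hj hju => hf j hj (by omega))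

lemma wedge_sub_pos (hlu : l < u) (hf : ∀ j, l ≤ j → j < u → 0 < wedge ε y (step p j)) :
    0 < wedge ε y (p u - p l) :=
  map_sub_pos_of_step _ hlu hf

lemma wedge_sub_nonneg (hlu : l ≤ u) (hf : ∀ j, l ≤ j → j < u → 0 ≤ wedge ε y (step p j)) :
    0 ≤ wedge ε y (p u - p l) :=
  map_sub_nonneg_of_step _ hlu hf

lemma wedge_sub_left_pos (hlu : l < u) (hf : ∀ j, l ≤ j → j < u → 0 < wedge ε (step p j) y) :
    0 < wedge ε (p u - p l) y :=
  map_sub_pos_of_step ((wedge ε).flip y) hlu hf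

lemma wedge_sub_left_nonneg (hlu : l ≤ u) (hf : ∀ j, l ≤ j → j < u → 0 ≤ wedge ε (step p j) y) :
    0 ≤ wedge ε (p u - p l) y :=
  map_sub_nonneg_of_step ((wedge ε).flip y) hlu hf

lemma wedge_sub_neg (hlu : l < u) (hf : ∀ j, l ≤ j → j < u → wedge ε y (step p j) < 0) :
    wedge ε y (p u - p l) < 0 :=
  neg_pos.1 (map_sub_pos_of_step (-(wedge ε y)) hlu fun j hj hju => neg_pos.2 (hf j hj hju))

lemma wedge_sub_nonpos (hlu : l ≤ u) (hf : ∀ j, l ≤ j → j < u → wedge ε y (step p j) ≤ 0) :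
    wedge ε y (p u - p l) ≤ 0 :=
  neg_nonneg.1 (map_sub_nonneg_of_step (-(wedge ε y)) hlu fun j hj hju =>
    neg_nonneg.2 (hf j hj hju))

end Step

section Side

variable {ε : ℝ} {p : ℤ → Plane} {l u : ℤ}

/-- The side of the `j`-th edge on which a point lies: positive on the interior side. -/
noncomputable def side (ε : ℝ) (p : ℤ → Plane) (j : ℤ) (x : Plane) : ℝ :=
  wedge ε (step p j) (x - p j)

lemma side_eq (ε : ℝ) (p : ℤ → Plane) (j : ℤ) (x y : Plane) :
    side ε p j y = side ε p j x + wedge ε (step p j) (y - x) := by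
  rw [side, side, ← map_add, add_comm, sub_add_sub_cancel]

lemma side_self (ε : ℝ) (p : ℤ → Plane) (j : ℤ) : side ε p j (p j) = 0 := by simp [side]

lemma side_succ (ε : ℝ) (p : ℤ → Plane) (j : ℤ) : side ε p j (p (j + 1)) = 0 :=
  wedge_self _ _

lemma side_eq_wedge_succ (ε : ℝ) (p : ℤ → Plane) (j : ℤ) (x : Plane) :
    side ε p j x = wedge ε (step p j) (x - p (j + 1)) := by
  rw [side_eq ε p j (p (j + 1)), side_succ, zero_add]

lemma wedge_combo_sub (ε : ℝ) (d x y z : Plane) {a b : ℝ} (hab : a + b = 1) :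
    wedge ε d (a • x + b • y - z) = a * wedge ε d (x - z) + b * wedge ε d (y - z) := by
  have hsplit : a • x + b • y - z = a • (x - z) + b • (y - z) := by
    obtain rfl := eq_sub_of_add_eq hab
    module
  simp only [hsplit, map_add, map_smul, smul_eq_mul]

lemma side_combo (ε : ℝ) (p : ℤ → Plane) (j : ℤ) (x y : Plane) {a b : ℝ} (hab : a + b = 1) :
    side ε p j (a • x + b • y) = a * side ε p j x + b * side ε p j y :=
  wedge_combo_sub ε _ x y _ hab

lemma step_shift (p : ℤ → Plane) (b k : ℤ) : step (fun i => p (i + b)) k = step p (k + b) := by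
  simp only [step]; rw [add_right_comm]

lemma side_shift (ε : ℝ) (p : ℤ → Plane) (b k : ℤ) (x : Plane) :
    side ε (fun i => p (i + b)) k x = side ε p (k + b) x := by
  rw [side, side, step_shift]

lemma step_reverse (p : ℤ → Plane) (k : ℤ) : step (fun i => p (-i)) k = -step p (-k - 1) := by
  simp only [step, neg_sub, sub_add_cancel]
  rw [neg_add, sub_eq_add_neg]; rfl

lemma side_reverse (ε : ℝ) (p : ℤ → Plane) (k : ℤ) (x : Plane) :
    side (-ε) (fun i => p (-i)) k x = side ε p (-k - 1) x := by
  rw [side_eq_wedge_succ ε p, side, step_reverse, wedge_neg_sign, map_neg, LinearMap.neg_apply,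
    neg_neg, sub_add_cancel]

/-- The edges from `l` to `u` all bend strictly to one side. -/
def Bending (ε : ℝ) (p : ℤ → Plane) (l u : ℤ) : Prop :=
  ∀ i j, l ≤ i → i < j → j < u → wedge ε (step p i) (step p j) < 0

lemma Bending.side_neg (H : Bending ε p l u) {j k : ℤ} (hlj : l ≤ j) (hju : j < u) (hlk : l ≤ k)
    (hku : k ≤ u) (hkj : k ≠ j) (hkj_succ : k ≠ j + 1) : side ε p j (p k) < 0 := by
  rcases lt_or_gt_of_ne hkj with hlt | hgt
  · have : 0 < wedge ε (step p j) (p j - p k) := wedge_sub_pos hlt fun i hki hij => by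
      rw [wedge_swap]; linarith [H i j (by omega) hij hju]
    rw [side, ← neg_sub, map_neg]; linarith
  · rw [side_eq_wedge_succ]
    exact wedge_sub_neg (by omega) fun i hji hik => H j i hlj (by omega) (by omega)

lemma Bending.side_nonpos (H : Bending ε p l u) {j k : ℤ} (hlj : l ≤ j) (hju : j < u) (hlk : l ≤ k)
    (hku : k ≤ u) : side ε p j (p k) ≤ 0 := by
  by_cases hkj : k = j
  · rw [hkj, side_self]
  by_cases hkj_succ : k = j + 1
  · rw [hkj_succ, side_succ]
  exact (H.side_neg hlj hju hlk hku hkj hkj_succ).le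

lemma Bending.side_midpoint_neg (H : Bending ε p l u) {j k m : ℤ} (hlj : l ≤ j) (hju : j < u)
    (hlk : l ≤ k) (hkm : k + 2 ≤ m) (hmu : m ≤ u) :
    side ε p j ((1 / 2 : ℝ) • p k + (1 / 2 : ℝ) • p m) < 0 := by
  rw [side_combo _ _ _ _ _ (by norm_num)]
  have hk := H.side_nonpos hlj hju hlk (by omega)
  have hm := H.side_nonpos hlj hju (k := m) (by omega) hmu
  by_cases hadj : k = j ∨ k = j + 1
  · linarith [H.side_neg hlj hju (k := m) (by omega) hmu (by omega) (by omega)]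
  · linarith [H.side_neg hlj hju hlk (by omega) (by tauto) (by tauto)]

/-- `x` is not cut off by the chain from `l` to `u`: it lies on the interior side of the chord of
the chain and of at least one of its edges. -/
def ChainSide (ε : ℝ) (p : ℤ → Plane) (l u : ℤ) (x : Plane) : Prop :=
  0 ≤ wedge ε (p u - p l) (x - p l) ∧ ∃ j, l ≤ j ∧ j < u ∧ 0 ≤ side ε p j x

/-- The region enclosed by three chains, which does without winding numbers. -/
def enclosed (ε : ℝ) (p : ℤ → Plane) (β γ n : ℤ) : Set Plane :=
  {x | ChainSide ε p 0 β x ∧ ChainSide ε p β γ x ∧ ChainSide ε p γ n x}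

lemma chainSide_shift (ε : ℝ) (p : ℤ → Plane) (b l u : ℤ) (x : Plane) :
    ChainSide ε (fun i => p (i + b)) l u x ↔ ChainSide ε p (l + b) (u + b) x := by
  refine and_congr Iff.rfl ⟨?_, ?_⟩
  · rintro ⟨j, hlj, hju, hside⟩
    exact ⟨j + b, by omega, by omega, by rwa [← side_shift]⟩
  · rintro ⟨j, hlj, hju, hside⟩
    exact ⟨j - b, by omega, by omega, by rwa [side_shift, sub_add_cancel]⟩

lemma chainSide_reverse (ε : ℝ) (p : ℤ → Plane) (l u : ℤ) (x : Plane) :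
    ChainSide (-ε) (fun i => p (-i)) l u x ↔ ChainSide ε p (-u) (-l) x := by
  refine and_congr ?_ ⟨?_, ?_⟩
  · have hchord : wedge ε (p (-l) - p (-u)) (x - p (-u)) =
        -wedge ε (p (-u) - p (-l)) (x - p (-l)) := by
      rw [← LinearMap.neg_apply, ← map_neg, neg_sub,
        ← sub_add_sub_cancel x (p (-l)) (p (-u)), map_add, wedge_self, add_zero]
    rw [wedge_neg_sign, hchord]
  · rintro ⟨j, hlj, hju, hside⟩
    exact ⟨-j - 1, by omega, by omega, by rwa [← side_reverse]⟩
  · rintro ⟨j, hlj, hju, hside⟩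
    exact ⟨-j - 1, by omega, by omega, by rw [side_reverse]; convert hside using 2; ring⟩

end Side

lemma apply_emod_of_periodic {α : Type*} {f : ℤ → α} {n : ℤ} (hf : Function.Periodic f n) (k : ℤ) :
    f (k % n) = f k := by
  rw [← hf.int_mul (k / n) (k % n), Int.cast_id, mul_comm, Int.emod_add_mul_ediv]

namespace TriChain

variable {ε : ℝ} {p : ℤ → Plane} {β γ n : ℤ}

lemma step_add_period (H : TriChain ε p β γ n) (k : ℤ) : step p (k + n) = step p k := by
  rw [step, step, H.periodic, add_right_comm, H.periodic]

lemma side_add_period (H : TriChain ε p β γ n) (k : ℤ) (x : Plane) :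
    side ε p (k + n) x = side ε p k x := by
  rw [side, side, H.step_add_period, H.periodic]

lemma period (H : TriChain ε p β γ n) : p n = p 0 := by
  simpa only [zero_add] using H.periodic 0

lemma bending₁ (H : TriChain ε p β γ n) : Bending ε p 0 β := H.neg₁

lemma bending₂ (H : TriChain ε p β γ n) : Bending ε p β γ := H.neg₂

lemma bending₃ (H : TriChain ε p β γ n) : Bending ε p γ n := H.neg₃

lemma shift (H : TriChain ε p β γ n) : TriChain ε (fun i => p (i + β)) (γ - β) (n - β) n := by
  obtain ⟨hβ, hβγ, hγn⟩ := H.corners_lt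
  have hstep : ∀ k, step p (k + β) = step p (k + β - n) := fun k => by
    rw [← H.step_add_period (k + β - n), sub_add_cancel]
  refine ⟨H.sign, by omega, fun k => ?_, ?_, ?_, ?_, ?_, ?_, ?_⟩
  · rw [add_right_comm, H.periodic]
  all_goals intro i j
  all_goals intros
  all_goals rw [step_shift, step_shift]
  · exact H.pos₂₃ _ _ (by omega) (by omega) (by omega) (by omega)
  · rw [hstep j]
    exact H.pos₃₁ _ _ (by omega) (by omega) (by omega) (by omega)
  · rw [hstep i]
    exact H.pos₁₂ _ _ (by omega) (by omega) (by omega) (by omega)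
  · exact H.neg₂ _ _ (by omega) (by omega) (by omega)
  · exact H.neg₃ _ _ (by omega) (by omega) (by omega)
  · rw [hstep i, hstep j]
    exact H.neg₁ _ _ (by omega) (by omega) (by omega)

lemma reverse (H : TriChain ε p β γ n) : TriChain (-ε) (fun i => p (-i)) (n - γ) (n - β) n := by
  obtain ⟨hβ, hβγ, hγn⟩ := H.corners_lt
  have hwedge : ∀ i j, wedge (-ε) (step (fun i => p (-i)) i) (step (fun i => p (-i)) j) =
      wedge ε (step p (-j - 1 + n)) (step p (-i - 1 + n)) := fun i j => by
    rw [H.step_add_period, H.step_add_period, step_reverse, step_reverse, wedge_neg_sign, map_neg,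
      map_neg, LinearMap.neg_apply, neg_neg, wedge_swap, neg_neg]
  refine ⟨by rcases H.sign with h | h <;> simp [h], by omega, fun k => ?_, ?_, ?_, ?_, ?_, ?_, ?_⟩
  · rw [← H.periodic, neg_add, neg_add_cancel_right]
  all_goals intro i j
  all_goals intros
  all_goals rw [hwedge]
  · exact H.pos₂₃ _ _ (by omega) (by omega) (by omega) (by omega)
  · exact H.pos₁₂ _ _ (by omega) (by omega) (by omega) (by omega)
  · exact H.pos₃₁ _ _ (by omega) (by omega) (by omega) (by omega)
  · exact H.neg₃ _ _ (by omega) (by omega) (by omega)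
  · exact H.neg₂ _ _ (by omega) (by omega) (by omega)
  · exact H.neg₁ _ _ (by omega) (by omega) (by omega)

lemma chainSide_add_period (H : TriChain ε p β γ n) (l u : ℤ) (x : Plane) :
    ChainSide ε p (l + n) (u + n) x ↔ ChainSide ε p l u x := by
  rw [← chainSide_shift, funext H.periodic]

lemma enclosed_reverse (H : TriChain ε p β γ n) :
    enclosed (-ε) (fun i => p (-i)) (n - γ) (n - β) n = enclosed ε p β γ n := by
  ext x
  simp only [enclosed, Set.mem_ofPred_eq, chainSide_reverse]
  rw [← H.chainSide_add_period (-(n - γ)), ← H.chainSide_add_period (-(n - β)),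
    ← H.chainSide_add_period (-n)]
  ring_nf
  tauto

lemma wedge_chord₁_nonneg_of_le (H : TriChain ε p β γ n) {k : ℤ} (hk : 0 ≤ k) (hkn : k ≤ n) :
    0 ≤ wedge ε (p β - p 0) (p k - p 0) := by
  obtain ⟨hβ, _, _⟩ := H.corners_lt
  rcases le_or_gt k β with hkβ | hkβ
  · have hsplit : 0 ≤ wedge ε (p k - p 0) (p k - p β) := by
      refine wedge_sub_left_nonneg hk fun i hi hik => ?_
      have : wedge ε (step p i) (p β - p k) ≤ 0 := wedge_sub_nonpos hkβ fun j hkj hjβ =>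
        (H.neg₁ i j hi (by omega) hjβ).le
      rw [← neg_sub, map_neg]; linarith
    rwa [← sub_add_sub_cancel (p β) (p k) (p 0), map_add, LinearMap.add_apply, wedge_self, add_zero,
      wedge_swap, ← map_neg, neg_sub]
  rcases le_or_gt k γ with hkγ | hkγ
  · rw [← sub_add_sub_cancel (p k) (p β) (p 0), map_add, wedge_self, add_zero]
    exact wedge_sub_left_nonneg hβ.le fun i hi hiβ => wedge_sub_nonneg hkβ.le
      fun j hj hjk => (H.pos₁₂ i j hi hiβ hj (by omega)).le
  · rw [wedge_swap, ← LinearMap.neg_apply, ← map_neg, neg_sub]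
    refine wedge_sub_nonneg hβ.le fun j hj hjβ => ?_
    rw [← H.period]
    exact wedge_sub_left_nonneg hkn fun i hi hin =>
      (H.pos₃₁ i j (by omega) hin hj hjβ).le

lemma wedge_chord₁_nonneg (H : TriChain ε p β γ n) (k : ℤ) :
    0 ≤ wedge ε (p β - p 0) (p k - p 0) := by
  obtain ⟨hβ, hβγ, hγn⟩ := H.corners_lt
  rw [← apply_emod_of_periodic H.periodic k]
  exact H.wedge_chord₁_nonneg_of_le (Int.emod_nonneg _ (by omega))
    (Int.emod_lt_of_pos _ (by omega)).le

lemma wedge_chord₂_nonneg (H : TriChain ε p β γ n) (k : ℤ) :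
    0 ≤ wedge ε (p γ - p β) (p k - p β) := by
  simpa using H.shift.wedge_chord₁_nonneg (k - β)

lemma wedge_chord₃_nonneg (H : TriChain ε p β γ n) (k : ℤ) :
    0 ≤ wedge ε (p n - p γ) (p k - p γ) := by
  simpa using H.shift.wedge_chord₂_nonneg (k - β)

lemma side_last₁_nonneg (H : TriChain ε p β γ n) {k : ℤ} (hβk : β ≤ k) (hkγ : k ≤ γ) :
    0 ≤ side ε p (β - 1) (p k) := by
  have hβ := H.corners_lt.1
  rw [side_eq_wedge_succ, sub_add_cancel]
  exact wedge_sub_nonneg hβk fun j hj hjk =>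
    (H.pos₁₂ _ j (by omega) (by omega) (by omega) (by omega)).le

lemma side_first₁_pos (H : TriChain ε p β γ n) {k : ℤ} (hγk : γ ≤ k) (hkn : k < n) :
    0 < side ε p 0 (p k) := by
  have hβ := H.corners_lt.1
  rw [side, ← H.period, wedge_swap, ← LinearMap.neg_apply, ← map_neg, neg_sub]
  exact wedge_sub_left_pos hkn fun i hi hin => H.pos₃₁ i 0 (by omega) hin le_rfl hβ

lemma side_first₂_pos (H : TriChain ε p β γ n) {k : ℤ} (hnk : n ≤ k) (hk : k < n + β) :
    0 < side ε p β (p k) := by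
  have := H.shift.side_first₁_pos (k := k - β) (by omega) (by omega)
  rwa [side_shift, sub_add_cancel, zero_add] at this

lemma wedge_corners_pos (H : TriChain ε p β γ n) :
    0 < wedge ε (p β - p 0) (p γ - p β) := by
  obtain ⟨hβ, hβγ, _⟩ := H.corners_lt
  exact wedge_sub_left_pos hβ fun i hi hiβ => wedge_sub_pos hβγ fun j hj hjγ =>
    H.pos₁₂ i j hi hiβ hj hjγ

end TriChain

/-! ### The region of a polygon with three chains -/

section AreaCoordinates

variable {ε : ℝ}

lemma mul_arg_div_mem_Ioo_of_wedge_pos (hε : ε = 1 ∨ ε = -1) {y z : Plane} (h : 0 < wedge ε y z) :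
    ε * Complex.arg (toComplex z / toComplex y) ∈ Set.Ioo 0 Real.pi := by
  have hy : toComplex y ≠ 0 := fun hy => by simp [show y = 0 by simpa using hy] at h
  have hnorm := Complex.normSq_pos.2 hy
  rw [wedge_apply] at h
  have him : (toComplex z / toComplex y).im =
      (y 0 * z 1 - y 1 * z 0) / Complex.normSq (toComplex y) := by
    rw [im_div_eq, toComplex_re, toComplex_im, toComplex_re, toComplex_im]
  rcases hε with rfl | rfl
  · rw [one_mul]
    exact arg_mem_Ioo_of_im_pos (him ▸ div_pos (by linarith) hnorm)
  · have harg := arg_mem_Ioo_of_im_neg (him ▸ div_neg_of_neg_of_pos (by linarith) hnorm)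
    constructor <;> linarith [harg.1, harg.2]

lemma wedge_add_wedge_add_wedge (ε : ℝ) (x y z w : Plane) :
    wedge ε (z - y) (w - y) + wedge ε (x - z) (w - z) + wedge ε (y - x) (w - x) =
      wedge ε (y - x) (z - y) := by
  simp only [wedge_apply, PiLp.sub_apply]; ring

lemma wedge_smul_add_wedge_smul_add_wedge_smul (ε : ℝ) (x y z w : Plane) :
    wedge ε (z - y) (w - y) • x + wedge ε (x - z) (w - z) • y + wedge ε (y - x) (w - x) • z =
      wedge ε (y - x) (z - y) • w := by
  ext i
  fin_cases i <;> simp [wedge_apply] <;> ring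

lemma mem_segment_of_wedge_nonneg {x y z w : Plane} (h : 0 < wedge ε (y - x) (z - y))
    (hxy : wedge ε (y - x) (w - x) = 0) (hyz : 0 ≤ wedge ε (z - y) (w - y))
    (hzx : 0 ≤ wedge ε (x - z) (w - z)) : w ∈ segment ℝ x y := by
  have hsum := wedge_add_wedge_add_wedge ε x y z w
  have hcombo := wedge_smul_add_wedge_smul_add_wedge_smul ε x y z w
  rw [hxy, add_zero] at hsum
  rw [hxy, zero_smul, add_zero] at hcombo
  refine ⟨_, _, div_nonneg hyz h.le, div_nonneg hzx h.le, ?_, ?_⟩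
  · rw [← add_div, hsum, div_self h.ne']
  · rw [div_eq_inv_mul, div_eq_inv_mul, mul_smul, mul_smul, ← smul_add, hcombo,
      inv_smul_smul₀ h.ne']

end AreaCoordinates

section UnrollBoundary

open Fin.CommRing

variable {n : ℕ} [NeZero n] {P : Polygon Plane n}

lemma exists_unroll (P : Polygon Plane n) (a i : Fin n) :
    ∃ k : ℤ, 0 ≤ k ∧ k < n ∧ i = a + (k : Fin n) ∧ P i = unroll P a k ∧
      P (i + 1) = unroll P a (k + 1) := by
  have hi : i = a + (((i - a).val : ℤ) : Fin n) := by
    rw [Int.cast_natCast, Fin.cast_val_eq_self, add_sub_cancel]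
  refine ⟨(i - a).val, by omega, by exact_mod_cast (i - a).isLt, hi, ?_, ?_⟩
  · rw [unroll, ← hi]
  · rw [unroll_succ, ← hi]

lemma exists_of_mem_boundary {x : Plane} (a : Fin n) (hx : x ∈ P.boundary ℝ) :
    ∃ k : ℤ, 0 ≤ k ∧ k < n ∧ x ∈ segment ℝ (unroll P a k) (unroll P a (k + 1)) := by
  contrapose! hx
  refine notMem_boundary_iff.2 fun i => ?_
  obtain ⟨k, hk, hkn, -, hi, hi_succ⟩ := exists_unroll P a i
  rw [hi, hi_succ]
  exact hx k hk hkn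

lemma segment_unroll_subset_boundary (P : Polygon Plane n) (a : Fin n) (k : ℤ) :
    segment ℝ (unroll P a k) (unroll P a (k + 1)) ⊆ P.boundary ℝ := fun x hx => by
  rw [Polygon.boundary, Set.mem_iUnion]
  exact ⟨a + (k : Fin n), by rwa [edgeSet_eq_segment, ← unroll_succ, ← unroll]⟩

lemma unroll_shift (P : Polygon Plane n) (a : Fin n) (b : ℤ) :
    (fun i => unroll P a (i + b)) = unroll P (a + (b : Fin n)) := by
  funext i
  simp only [unroll, Int.cast_add]
  congr 1
  ring

end UnrollBoundary

section RegionSubset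

open Fin.CommRing

variable {n : ℕ} [NeZero n] {P : Polygon Plane n} {a : Fin n} {ε : ℝ} {β γ : ℤ} {x y : Plane}

lemma TriChain.wedge_chord₁_nonneg_of_mem_boundary (H : TriChain ε (unroll P a) β γ n)
    (hy : y ∈ P.boundary ℝ) : 0 ≤ wedge ε (unroll P a β - unroll P a 0) (y - unroll P a 0) := by
  obtain ⟨k, -, -, s, t, hs, ht, hst, rfl⟩ := exists_of_mem_boundary a hy
  rw [wedge_combo_sub _ _ _ _ _ hst]
  exact add_nonneg (mul_nonneg hs (H.wedge_chord₁_nonneg _))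
    (mul_nonneg ht (H.wedge_chord₁_nonneg _))

lemma TriChain.exists_side₁_nonneg_of_mem_boundary (H : TriChain ε (unroll P a) β γ n)
    (hy : y ∈ P.boundary ℝ) : ∃ j, 0 ≤ j ∧ j < β ∧ 0 ≤ side ε (unroll P a) j y := by
  obtain ⟨hβ, _, _⟩ := H.corners_lt
  obtain ⟨k, hk, hkn, s, t, hs, ht, hst, rfl⟩ := exists_of_mem_boundary a hy
  set p := unroll P a
  suffices ∃ j, 0 ≤ j ∧ j < β ∧ 0 ≤ side ε p j (p k) ∧ 0 ≤ side ε p j (p (k + 1)) by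
    obtain ⟨j, hj, hjβ, hside, hside_succ⟩ := this
    refine ⟨j, hj, hjβ, ?_⟩
    rw [side_combo _ _ _ _ _ hst]
    positivity
  rcases lt_or_ge k β with hkβ | hβk
  · exact ⟨k, hk, hkβ, (side_self _ _ _).ge, (side_succ _ _ _).ge⟩
  rcases lt_or_ge k γ with hkγ | hγk
  · exact ⟨β - 1, by omega, by omega, H.side_last₁_nonneg hβk (by omega),
      H.side_last₁_nonneg (by omega) (by omega)⟩
  refine ⟨0, le_rfl, hβ, (H.side_first₁_pos hγk hkn).le, ?_⟩
  rcases (show k + 1 ≤ n by omega).eq_or_lt with hlast | hlt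
  · rw [hlast, H.period, side_self]
  · exact (H.side_first₁_pos (by omega) hlt).le

lemma TriChain.notMem_region_of_wedge_chord₁_nonpos (H : TriChain ε (unroll P a) β γ n)
    (hxb : x ∉ P.boundary ℝ)
    (hx : wedge ε (unroll P a β - unroll P a 0) (x - unroll P a 0) ≤ 0) : x ∉ P.region := by
  set p := unroll P a
  have hchord : p β - p 0 ≠ 0 := fun h => by simpa [h] using H.wedge_corners_pos
  refine notMem_region_of_wedge_nonneg H.sign hxb hchord fun i => ?_
  obtain ⟨k, -, -, -, hi, -⟩ := exists_unroll P a i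
  rw [hi, ← sub_sub_sub_cancel_right _ x (p 0), map_sub]
  linarith [H.wedge_chord₁_nonneg k]

lemma convex_setOf_side_neg (ε : ℝ) (p : ℤ → Plane) (l u : ℤ) :
    Convex ℝ {z | ∀ j, l ≤ j → j < u → side ε p j z < 0} := by
  intro y hy z hz s t hs ht hst j hj hju
  rw [side_combo _ _ _ _ _ hst]
  have := hy j hj hju
  have := hz j hj hju
  rcases hs.eq_or_lt with rfl | hs
  · obtain rfl : t = 1 := by linarith
    linarith
  · nlinarith

/- A point between the first chain and its chord can be moved, without crossing the boundary, to the
midpoint of the chord, which is outside. -/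
lemma TriChain.chainSide₁_of_mem_region (H : TriChain ε (unroll P a) β γ n)
    (hx : x ∈ P.region) : ChainSide ε (unroll P a) 0 β x := by
  have hβ := H.corners_lt.1
  set p := unroll P a with hp
  by_cases hxb : x ∈ P.boundary ℝ
  · exact ⟨H.wedge_chord₁_nonneg_of_mem_boundary hxb, H.exists_side₁_nonneg_of_mem_boundary hxb⟩
  have hchord : 0 < wedge ε (p β - p 0) (x - p 0) := by
    by_contra! h
    exact H.notMem_region_of_wedge_chord₁_nonpos hxb h hx
  refine ⟨hchord.le, ?_⟩
  by_contra! hneg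
  have hβ_two : 2 ≤ β := by
    by_contra! h
    obtain rfl : β = 1 := by omega
    exact (hneg 0 le_rfl one_pos).not_gt hchord
  set m : Plane := (1 / 2 : ℝ) • p 0 + (1 / 2 : ℝ) • p β with hm
  have hm_neg : ∀ j, 0 ≤ j → j < β → side ε p j m < 0 := fun j hj hjβ =>
    H.bending₁.side_midpoint_neg hj hjβ le_rfl (by omega) le_rfl
  have hseg : ∀ z ∈ segment ℝ x m, z ∉ P.boundary ℝ := fun z hz hzb => by
    obtain ⟨j, hj, hjβ, hside⟩ := H.exists_side₁_nonneg_of_mem_boundary hzb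
    exact hside.not_gt ((convex_setOf_side_neg ε p 0 β).segment_subset hneg hm_neg hz j hj hjβ)
  refine H.notMem_region_of_wedge_chord₁_nonpos (hseg m (right_mem_segment _ _ _)) (le_of_eq ?_)
    ((mem_region_iff_of_segment hseg).1 hx)
  rw [← hp, hm, wedge_combo_sub _ _ _ _ _ (by norm_num), wedge_self, sub_self, map_zero]
  ring

lemma TriChain.region_subset_enclosed (H : TriChain ε (unroll P a) β γ n) :
    P.region ⊆ enclosed ε (unroll P a) β γ n := by
  intro x hx
  have hshift := H.shift
  rw [unroll_shift] at hshift
  have hshift_shift := hshift.shift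
  rw [unroll_shift] at hshift_shift
  have h₂ := hshift.chainSide₁_of_mem_region hx
  have h₃ := hshift_shift.chainSide₁_of_mem_region hx
  rw [← unroll_shift, chainSide_shift] at h₂
  rw [← unroll_shift, chainSide_shift, ← unroll_shift, chainSide_shift] at h₃
  ring_nf at h₂ h₃
  exact ⟨H.chainSide₁_of_mem_region hx, h₂, h₃⟩

end RegionSubset

section EnclosedSubset

variable {ε : ℝ} {p : ℤ → Plane} {x : Plane}

lemma Bending.exists_mem_edge_of_mem_chord {l u j : ℤ} (hB : Bending ε p l u) (hlj : l ≤ j)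
    (hju : j < u) (hx : x ∈ segment ℝ (p l) (p u)) (hside : 0 ≤ side ε p j x) :
    ∃ k, x ∈ segment ℝ (p k) (p (k + 1)) := by
  obtain ⟨s, t, hs, ht, hst, rfl⟩ := hx
  rcases hs.eq_or_lt with rfl | hs_pos
  · obtain rfl : t = 1 := by linarith
    exact ⟨u, by simpa using left_mem_segment ℝ (p u) (p (u + 1))⟩
  rcases ht.eq_or_lt with rfl | ht_pos
  · obtain rfl : s = 1 := by linarith
    exact ⟨l, by simpa using left_mem_segment ℝ (p l) (p (l + 1))⟩
  rw [side_combo _ _ _ _ _ hst] at hside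
  have hl := hB.side_nonpos hlj hju le_rfl (by omega)
  have hu := hB.side_nonpos hlj hju (k := u) (by omega) le_rfl
  have hl_end : l = j ∨ l = j + 1 := by
    by_contra! h
    nlinarith [hB.side_neg hlj hju le_rfl (by omega) h.1 h.2]
  have hu_end : u = j ∨ u = j + 1 := by
    by_contra! h
    nlinarith [hB.side_neg hlj hju (by omega) le_rfl h.1 h.2]
  obtain rfl : l = j := by omega
  obtain rfl : u = l + 1 := by omega
  exact ⟨l, s, t, hs, ht, hst, rfl⟩

lemma ChainSide.wedge_chord_pos {l u : ℤ} (hx : ChainSide ε p l u x) (hB : Bending ε p l u)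
    (hedge : ∀ k, x ∉ segment ℝ (p k) (p (k + 1))) {z : Plane}
    (hz : 0 < wedge ε (p u - p l) (z - p u)) (hux : 0 ≤ wedge ε (z - p u) (x - p u))
    (hxl : 0 ≤ wedge ε (p l - z) (x - z)) : 0 < wedge ε (p u - p l) (x - p l) := by
  obtain ⟨hchord, j, hlj, hju, hside⟩ := hx
  refine hchord.lt_of_ne' fun h => ?_
  obtain ⟨k, hk⟩ := hB.exists_mem_edge_of_mem_chord hlj hju
    (mem_segment_of_wedge_nonneg hz h hux hxl) hside
  exact hedge k hk

/- The chain lies on one side of a line through `x`, so it is seen from `x` under the same angle as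
its chord. -/
lemma ChainSide.mul_sum_arg_mem_Ioo {l u : ℕ} (hx : ChainSide ε p l u x) (hε : ε = 1 ∨ ε = -1)
    (hlu : l < u) (hB : Bending ε p l u) (hstep : ∀ j, step p j ≠ 0)
    (hedge : ∀ k : ℤ, x ∉ segment ℝ (p k) (p (k + 1))) {z : Plane}
    (hz : 0 < wedge ε (p u - p l) (z - p u)) (hux : 0 ≤ wedge ε (z - p u) (x - p u))
    (hxl : 0 ≤ wedge ε (p l - z) (x - z)) :
    ε * ∑ k ∈ Finset.Ico l u, Complex.arg
        ((toComplex (p (k + 1 : ℕ)) - toComplex x) / (toComplex (p k) - toComplex x)) ∈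
      Set.Ioo 0 Real.pi := by
  have hchord := hx.wedge_chord_pos hB hedge hz hux hxl
  obtain ⟨-, j, hlj, hju, hside⟩ := hx
  obtain ⟨c, hc, hc_im⟩ := exists_im_div_nonneg_of_wedge_nonneg hε (neg_ne_zero.2 (hstep j))
  have him : ∀ k : ℕ, l ≤ k → k ≤ u → 0 ≤ ((toComplex (p k) - toComplex x) / c).im := by
    intro k hlk hku
    rw [← map_sub]
    refine hc_im _ ?_
    rw [map_neg, LinearMap.neg_apply]
    linarith [side_eq ε p j x (p k),
      hB.side_nonpos hlj hju (k := k) (by omega) (by omega)]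
  have hends : 0 < wedge ε (p l - x) (p u - x) := by
    convert hchord using 1
    simp only [wedge_apply, PiLp.sub_apply]; ring
  have hslit : (toComplex (p u) - toComplex x) / (toComplex (p l) - toComplex x) ∈
      Complex.slitPlane := by
    rw [← map_sub, ← map_sub]
    refine Or.inr (im_div_toComplex_ne_zero fun h => hends.ne' ?_)
    rw [wedge_apply, one_mul] at h
    rw [wedge_apply, h, mul_zero]
  rw [sum_arg_div_of_im_nonneg hc (fun k : ℕ => toComplex (p k) - toComplex x) hlu.le him
      fun k _ _ => notMem_segment_iff_toComplex.1 (by exact_mod_cast hedge k),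
    ← arg_div_of_im_nonneg hc (him l le_rfl hlu.le) (him u hlu.le le_rfl) hslit,
    ← map_sub, ← map_sub]
  exact mul_arg_div_mem_Ioo_of_wedge_pos hε hends

end EnclosedSubset

namespace TriChain

variable {ε : ℝ} {p : ℤ → Plane} {β γ n : ℤ}

lemma step_ne_zero (H : TriChain ε p β γ n) (j : ℤ) : step p j ≠ 0 := by
  obtain ⟨hβ, hβγ, hγn⟩ := H.corners_lt
  have hperiod : ∀ i, 0 ≤ i → i < n → step p i ≠ 0 := by
    intro i hi hin h0
    rcases lt_or_ge i β with hiβ | hβi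
    · simpa [h0] using H.pos₁₂ i β hi hiβ le_rfl hβγ
    rcases lt_or_ge i γ with hiγ | hγi
    · simpa [h0] using H.pos₂₃ i γ hβi hiγ le_rfl hγn
    · simpa [h0] using H.pos₃₁ i 0 hγi hin le_rfl hβ
  rw [← apply_emod_of_periodic H.step_add_period]
  exact hperiod _ (Int.emod_nonneg _ (by omega)) (Int.emod_lt_of_pos _ (by omega))

lemma wedge_corners_pos₂ (H : TriChain ε p β γ n) : 0 < wedge ε (p γ - p β) (p 0 - p γ) := by
  have := H.shift.wedge_corners_pos
  rwa [sub_add_cancel, sub_add_cancel, zero_add, H.period] at this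

lemma wedge_corners_pos₃ (H : TriChain ε p β γ n) : 0 < wedge ε (p 0 - p γ) (p β - p 0) := by
  have := H.shift.wedge_corners_pos₂
  rwa [sub_add_cancel, sub_add_cancel, zero_add, H.period] at this

end TriChain

section RegionEq

open Fin.CommRing

variable {n : ℕ} [NeZero n] {P : Polygon Plane n} {a : Fin n} {ε : ℝ}

lemma windingAngle_eq_sum_unroll (P : Polygon Plane n) (a : Fin n) (x : Plane) :
    windingAngle P x = ∑ k ∈ Finset.range n, Complex.arg
      ((toComplex (unroll P a (k + 1 : ℕ)) - toComplex x) /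
        (toComplex (unroll P a k) - toComplex x)) := by
  rw [windingAngle, ← sum_add_natCast a]
  simp only [Nat.cast_add, Nat.cast_one, unroll_succ]
  simp only [unroll, Int.cast_natCast]

lemma odd_of_mul_two_pi_mem_Ioo (hε : ε = 1 ∨ ε = -1) {k : ℤ}
    (h : ε * (2 * Real.pi * k) ∈ Set.Ioo 0 (3 * Real.pi)) : Odd k := by
  have hpos : 0 < ε * k :=
    pos_of_mul_pos_right (b := ε * k) (by linarith [h.1]) Real.two_pi_pos.le
  have hlt : ε * k < 2 := by nlinarith [h.2, Real.pi_pos]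
  rcases hε with rfl | rfl
  · have : 0 < k := by exact_mod_cast one_mul (k : ℝ) ▸ hpos
    have : k < 2 := by exact_mod_cast one_mul (k : ℝ) ▸ hlt
    exact ⟨0, by omega⟩
  · have : k < 0 := by
      have : (k : ℝ) < 0 := by linarith
      exact_mod_cast this
    have : -2 < k := by
      have : (-2 : ℝ) < k := by linarith
      exact_mod_cast this
    exact ⟨-1, by omega⟩

/- Each chain is seen from a point of `enclosed` under an angle between `0` and `π`, so the winding
number, with the sign `ε`, is an integer between `0` and `3 / 2`. -/
lemma TriChain.enclosed_subset_region {β γ : ℕ} (H : TriChain ε (unroll P a) β γ n) :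
    enclosed ε (unroll P a) β γ n ⊆ P.region := by
  rintro x ⟨hx₁, hx₂, hx₃⟩
  by_cases hxb : x ∈ P.boundary ℝ
  · exact Or.inl hxb
  obtain ⟨hβ, hβγ, hγn⟩ := H.corners_lt
  obtain ⟨k, hk, hk_odd⟩ := exists_windingAngle_eq hxb
  rw [hk_odd]
  refine odd_of_mul_two_pi_mem_Ioo H.sign ?_
  have hedge : ∀ k : ℤ, x ∉ segment ℝ (unroll P a k) (unroll P a (k + 1)) := fun k h =>
    hxb (segment_unroll_subset_boundary P a k h)
  rw [← hk, windingAngle_eq_sum_unroll P a x]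
  set p := unroll P a
  have hchord₃ := hx₃.1
  rw [H.period] at hchord₃
  have hsum₁ := ChainSide.mul_sum_arg_mem_Ioo (l := 0) (u := β) (by exact_mod_cast hx₁) H.sign
    (by omega) (by exact_mod_cast H.bending₁) H.step_ne_zero hedge (z := p γ)
    (by exact_mod_cast H.wedge_corners_pos) hx₂.1 (by exact_mod_cast hchord₃)
  have hsum₂ := hx₂.mul_sum_arg_mem_Ioo H.sign (by omega) H.bending₂ H.step_ne_zero hedge
    H.wedge_corners_pos₂ hchord₃ hx₁.1
  have hsum₃ := hx₃.mul_sum_arg_mem_Ioo H.sign (by omega) H.bending₃ H.step_ne_zero hedge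
    (z := p β) (by rw [H.period]; exact H.wedge_corners_pos₃) (by rw [H.period]; exact hx₁.1) hx₂.1
  rw [Finset.range_eq_Ico, ← Finset.sum_Ico_consecutive _ (Nat.zero_le γ) (by omega),
    ← Finset.sum_Ico_consecutive _ (Nat.zero_le β) (by omega), mul_add, mul_add]
  constructor
  · linarith [hsum₁.1, hsum₂.1, hsum₃.1]
  · linarith [hsum₁.2, hsum₂.2, hsum₃.2]

lemma TriChain.region_eq_enclosed {β γ : ℤ} (H : TriChain ε (unroll P a) β γ n) :
    P.region = enclosed ε (unroll P a) β γ n := by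
  obtain ⟨hβ, hβγ, -⟩ := H.corners_lt
  lift β to ℕ using hβ.le
  lift γ to ℕ using (hβ.trans hβγ).le
  exact Set.Subset.antisymm H.region_subset_enclosed H.enclosed_subset_region

end RegionEq

/-! ### Three chains form a pseudo-triangle -/

section Edges

variable {ε : ℝ} {p : ℤ → Plane} {x y z : Plane} {j : ℤ}

lemma side_of_mem_edge (hx : x ∈ segment ℝ (p j) (p (j + 1))) : side ε p j x = 0 := by
  obtain ⟨s, t, -, -, hst, rfl⟩ := hx
  rw [side_combo _ _ _ _ _ hst, side_self, side_succ, mul_zero, mul_zero, add_zero]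

lemma eq_left_of_mem_segment_of_side_nonneg (hx : x ∈ segment ℝ y z) (hxj : 0 ≤ side ε p j x)
    (hy : side ε p j y ≤ 0) (hz : side ε p j z < 0) : x = y := by
  obtain ⟨s, t, hs, ht, hst, rfl⟩ := hx
  rw [side_combo _ _ _ _ _ hst] at hxj
  obtain rfl : t = 0 := ht.antisymm' (by nlinarith)
  obtain rfl : s = 1 := by linarith
  simp

lemma eq_left_of_mem_segment_of_side_nonpos (hx : x ∈ segment ℝ y z) (hxj : side ε p j x ≤ 0)
    (hy : 0 ≤ side ε p j y) (hz : 0 < side ε p j z) : x = y :=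
  eq_left_of_mem_segment_of_side_nonneg (ε := -ε) (p := p) (j := j) hx
    (by rw [side, wedge_neg_sign]; exact neg_nonneg.2 hxj)
    (by rw [side, wedge_neg_sign]; exact neg_nonpos.2 hy)
    (by rw [side, wedge_neg_sign]; exact neg_neg_of_pos hz)

lemma Bending.eq_of_mem_edges {l u i : ℤ} (hB : Bending ε p l u) (hli : l ≤ i) (hij : i < j)
    (hju : j < u) (hxi : x ∈ segment ℝ (p i) (p (i + 1)))
    (hxj : x ∈ segment ℝ (p j) (p (j + 1))) : j = i + 1 ∧ x = p j := by
  have hside : side ε p i x = 0 := side_of_mem_edge hxi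
  have hx : x = p j := eq_left_of_mem_segment_of_side_nonneg hxj hside.ge
    (hB.side_nonpos hli (by omega) (by omega) hju.le)
    (hB.side_neg hli (by omega) (by omega) (by omega) (by omega) (by omega))
  refine ⟨by_contra fun hne => ?_, hx⟩
  rw [hx] at hside
  exact (hB.side_neg hli (by omega) (by omega) hju.le (by omega) hne).ne hside

end Edges

namespace TriChain

variable {ε : ℝ} {p : ℤ → Plane} {β γ n i j k : ℤ} {x : Plane}

lemma side_last₁_pos (H : TriChain ε p β γ n) (hβk : β < k) (hkγ : k ≤ γ) :
    0 < side ε p (β - 1) (p k) := by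
  have hβ := H.corners_lt.1
  rw [side_eq_wedge_succ, sub_add_cancel]
  exact wedge_sub_pos hβk fun m hβm hmk => H.pos₁₂ _ _ (by omega) (by omega) hβm (by omega)

lemma eq_of_mem_edges₁₂ (H : TriChain ε p β γ n) (hi : 0 ≤ i) (hiβ : i < β) (hβj : β ≤ j)
    (hjγ : j < γ) (hxi : x ∈ segment ℝ (p i) (p (i + 1)))
    (hxj : x ∈ segment ℝ (p j) (p (j + 1))) : j = i + 1 ∧ x = p j := by
  have hnonpos : side ε p (β - 1) x ≤ 0 := by
    obtain ⟨s, t, hs, ht, hst, rfl⟩ := hxi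
    rw [side_combo _ _ _ _ _ hst]
    have := H.bending₁.side_nonpos (j := β - 1) (by omega) (by omega) hi hiβ.le
    have := H.bending₁.side_nonpos (j := β - 1) (k := i + 1) (by omega) (by omega) (by omega) hiβ
    nlinarith
  obtain rfl : x = p j := eq_left_of_mem_segment_of_side_nonpos hxj hnonpos
    (H.side_last₁_nonneg hβj hjγ.le) (H.side_last₁_pos (by omega) hjγ)
  obtain rfl : j = β := by
    by_contra hne
    exact hnonpos.not_gt (H.side_last₁_pos (by omega) hjγ.le)
  refine ⟨by_contra fun hne => H.step_ne_zero (j - 1) ?_, rfl⟩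
  have hlast : p j = p (j - 1) := (H.bending₁.eq_of_mem_edges hi (j := j - 1) (by omega) (by omega)
    hxi (by rw [sub_add_cancel]; exact right_mem_segment ℝ _ _)).2
  rw [step, sub_add_cancel, hlast, sub_self]

lemma eq_of_mem_edges₂₃ (H : TriChain ε p β γ n) (hβi : β ≤ i) (hiγ : i < γ) (hγj : γ ≤ j)
    (hjn : j < n) (hxi : x ∈ segment ℝ (p i) (p (i + 1)))
    (hxj : x ∈ segment ℝ (p j) (p (j + 1))) : j = i + 1 ∧ x = p j := by
  have hadd : ∀ k, k - β + 1 + β = k + 1 := fun k => by ring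
  have := H.shift.eq_of_mem_edges₁₂ (x := x) (i := i - β) (j := j - β) (by omega) (by omega)
    (by omega) (by omega) (by simpa [hadd] using hxi) (by simpa [hadd] using hxj)
  simpa using And.imp_left (fun _ => (by omega : j = i + 1)) this

lemma eq_of_mem_edges₃₁ (H : TriChain ε p β γ n) (hγi : γ ≤ i) (hin : i < n) (hnj : n ≤ j)
    (hjn : j < n + β) (hxi : x ∈ segment ℝ (p i) (p (i + 1)))
    (hxj : x ∈ segment ℝ (p j) (p (j + 1))) : j = i + 1 ∧ x = p j := by
  have hadd : ∀ k, k - β + 1 + β = k + 1 := fun k => by ring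
  have := H.shift.eq_of_mem_edges₂₃ (x := x) (i := i - β) (j := j - β) (by omega) (by omega)
    (by omega) (by omega) (by simpa [hadd] using hxi) (by simpa [hadd] using hxj)
  simpa using And.imp_left (fun _ => (by omega : j = i + 1)) this

lemma eq_of_mem_edges (H : TriChain ε p β γ n) (hi : 0 ≤ i) (hij : i < j) (hjn : j < n)
    (hxi : x ∈ segment ℝ (p i) (p (i + 1))) (hxj : x ∈ segment ℝ (p j) (p (j + 1))) :
    (j = i + 1 ∧ x = p j) ∨ (i = 0 ∧ j + 1 = n ∧ x = p i) := by
  rcases lt_or_ge j β with hjβ | hβj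
  · exact Or.inl (H.bending₁.eq_of_mem_edges hi hij hjβ hxi hxj)
  rcases lt_or_ge i β with hiβ | hβi
  · rcases lt_or_ge j γ with hjγ | hγj
    · exact Or.inl (H.eq_of_mem_edges₁₂ hi hiβ hβj hjγ hxi hxj)
    rw [← H.periodic i, ← H.periodic (i + 1), add_right_comm] at hxi
    obtain ⟨hsucc, hx⟩ := H.eq_of_mem_edges₃₁ hγj hjn (by omega) (by omega) hxj hxi
    exact Or.inr ⟨by omega, by omega, H.periodic i ▸ hx⟩
  rcases lt_or_ge j γ with hjγ | hγj
  · exact Or.inl (H.bending₂.eq_of_mem_edges hβi hij hjγ hxi hxj)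
  rcases lt_or_ge i γ with hiγ | hγi
  · exact Or.inl (H.eq_of_mem_edges₂₃ hβi hiγ hγj hjn hxi hxj)
  · exact Or.inl (H.bending₃.eq_of_mem_edges hγi hij hjn hxi hxj)

end TriChain

section PseudoTriangle

open Fin.CommRing
open scoped Topology

variable {n : ℕ} [NeZero n] {P : Polygon Plane n} {a : Fin n} {ε : ℝ} {β γ : ℕ}

lemma TriChain.shift_unroll (H : TriChain ε (unroll P a) β γ n) :
    TriChain ε (unroll P (a + (β : Fin n))) ((γ - β : ℕ) : ℤ) ((n - β : ℕ) : ℤ) n := by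
  obtain ⟨-, hβγ, hγn⟩ := H.corners_lt
  have := H.shift
  rw [unroll_shift, Int.cast_natCast] at this
  rwa [Nat.cast_sub (by omega), Nat.cast_sub (by omega)]

lemma TriChain.eq_of_mem_boundary_edges (H : TriChain ε (unroll P a) β γ n) {i j : Fin n}
    (hij : i ≠ j) {x : Plane} (hxi : x ∈ segment ℝ (P i) (P (i + 1)))
    (hxj : x ∈ segment ℝ (P j) (P (j + 1))) : (j = i + 1 ∧ x = P j) ∨ (i = j + 1 ∧ x = P i) := by
  obtain ⟨k, hk, hkn, hik, hi, hi_succ⟩ := exists_unroll P a i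
  obtain ⟨l, hl, hln, hjl, hj, hj_succ⟩ := exists_unroll P a j
  wlog hkl : k < l generalizing i j k l
  · exact (this hij.symm hxj hxi l hl hln hjl hj hj_succ k hk hkn hik hi hi_succ
      ((not_lt.1 hkl).lt_of_ne' fun h => hij (by rw [hik, hjl, h]))).symm
  rw [hi, hi_succ] at hxi
  rw [hj, hj_succ] at hxj
  rcases H.eq_of_mem_edges hk hkl hln hxi hxj with ⟨hlk, hx⟩ | ⟨hk0, hln', hx⟩
  · refine Or.inl ⟨?_, hj ▸ hx⟩
    rw [hjl, hik, hlk, Int.cast_add, Int.cast_one, add_assoc]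
  · refine Or.inr ⟨?_, hi ▸ hx⟩
    have hlast : ((l + 1 : ℤ) : Fin n) = 0 := by rw [hln', Int.cast_natCast, Fin.natCast_self]
    rw [Int.cast_add, Int.cast_one] at hlast
    rw [hik, hjl, add_assoc, hlast, hk0, Int.cast_zero]

lemma TriChain.isSimple (H : TriChain ε (unroll P a) β γ n) : P.IsSimple := by
  obtain ⟨hβ, hβγ, hγn⟩ := H.corners_lt
  have hne : ∀ i : Fin n, P i ≠ P (i + 1) := fun i hi => by
    obtain ⟨k, -, -, -, hk, hk_succ⟩ := exists_unroll P a i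
    exact H.step_ne_zero k (by rw [step, ← hk, ← hk_succ, hi, sub_self])
  refine ⟨by omega, fun i j hP => by_contra fun hij => ?_, fun i j hij x hx => ?_⟩
  · have hP : P i = P j := hP
    rcases H.eq_of_mem_boundary_edges hij (left_mem_segment ℝ (P i) _)
      (hP ▸ left_mem_segment ℝ (P j) _) with h | h
    · exact hne i (by rw [← h.1]; exact hP)
    · exact hne j (by rw [← h.1]; exact hP.symm)
  · rw [edgeSet_eq_segment, edgeSet_eq_segment] at hx
    exact H.eq_of_mem_boundary_edges hij hx.1 hx.2

lemma eventually_map_add_smul_sub_pos (f : Plane →ₗ[ℝ] ℝ) {x y : Plane} (h : 0 < f (x - y))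
    (v : Plane) : ∀ᶠ t : ℝ in 𝓝[>] 0, 0 < f (x + t • v - y) := by
  have hcont : Continuous fun t : ℝ => f (x + t • v - y) :=
    f.continuous_of_finiteDimensional.comp (by fun_prop)
  refine (hcont.tendsto 0).mono_left nhdsWithin_le_nhds (Ioi_mem_nhds ?_)
  simpa using h

lemma TriChain.eventually_mem_enclosed {p : ℤ → Plane} {β γ n : ℤ} (H : TriChain ε p β γ n) :
    ∀ᶠ t : ℝ in 𝓝[>] 0,
      p 0 + t • (p (n - 1) - p 0 + (p 1 - p 0)) ∈ enclosed ε p β γ n := by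
  obtain ⟨hβ, hβγ, hγn⟩ := H.corners_lt
  have hchord₂ : 0 < wedge ε (p γ - p β) (p 0 - p β) := by
    rw [← sub_add_sub_cancel (p 0) (p γ) (p β), map_add, wedge_self, add_zero]
    exact H.wedge_corners_pos₂
  have hside₂ : 0 < wedge ε (step p β) (p 0 - p β) :=
    H.period ▸ H.side_first₂_pos le_rfl (by omega)
  filter_upwards [self_mem_nhdsWithin, eventually_map_add_smul_sub_pos _ hchord₂ _,
    eventually_map_add_smul_sub_pos _ hside₂ _] with t (ht : 0 < t) ht_chord₂ ht_side₂
  have hnonneg : ∀ d : Plane, 0 ≤ wedge ε d (p (n - 1) - p 0) → 0 ≤ wedge ε d (p 1 - p 0) →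
      0 ≤ wedge ε d (p 0 + t • (p (n - 1) - p 0 + (p 1 - p 0)) - p 0) := fun d hpred hsucc => by
    rw [add_sub_cancel_left, map_smul, map_add]
    exact mul_nonneg ht.le (add_nonneg hpred hsucc)
  have hsub : ∀ l x, wedge ε (p n - p l) (x - p l) = wedge ε (p n - p l) (x - p 0) := fun l x => by
    rw [← sub_add_sub_cancel x (p 0) (p l), map_add, H.period, wedge_self, add_zero]
  have hstep_last : step p (n - 1) = p n - p (n - 1) := by rw [step, sub_add_cancel]
  refine ⟨⟨?_, 0, le_rfl, hβ, ?_⟩, ⟨ht_chord₂.le, β, le_rfl, hβγ, ht_side₂.le⟩,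
    ⟨?_, n - 1, by omega, by omega, ?_⟩⟩
  · exact hnonneg _ (H.wedge_chord₁_nonneg _) (H.wedge_chord₁_nonneg _)
  · exact hnonneg _ (H.side_first₁_pos (by omega) (by omega)).le (side_succ ε p 0).ge
  · rw [hsub]
    exact hnonneg _ (hsub γ _ ▸ H.wedge_chord₃_nonneg _) (hsub γ _ ▸ H.wedge_chord₃_nonneg _)
  · rw [side, hstep_last, hsub]
    refine hnonneg _ (by rw [← hsub, sub_self, map_zero]) ?_
    have := H.pos₃₁ (n - 1) 0 (by omega) (by omega) le_rfl hβ
    rw [hstep_last, step, zero_add] at this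
    exact this.le

lemma TriChain.isConvexVertex (H : TriChain ε (unroll P a) β γ n) : P.IsConvexVertex a := by
  obtain ⟨hβ, _, hγn⟩ := H.corners_lt
  have hε : ε ≠ 0 := by rcases H.sign with h | h <;> simp [h]
  have hzero : P a = unroll P a 0 := by simp [unroll]
  have hsucc : P (a + 1) = unroll P a 1 := by simp [unroll]
  have hpred : P (a - 1) = unroll P a (n - 1) := by
    rw [unroll_pred, Int.cast_natCast, Fin.natCast_self, add_zero]
  rw [Polygon.IsConvexVertex, collinear_iff_wedge hε, hzero, hsucc, hpred, H.region_eq_enclosed]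
  refine ⟨?_, H.eventually_mem_enclosed⟩
  have := H.pos₃₁ (n - 1) 0 (by omega) (by omega) le_rfl (by omega)
  rw [step, step, sub_add_cancel, H.period, zero_add] at this
  exact this.ne'

lemma TriChain.isReflexVertex (H : TriChain ε (unroll P a) β γ n) {k : ℤ} (hk : 0 < k)
    (hkβ : k < β) : P.IsReflexVertex (a + (k : Fin n)) := by
  have hε : ε ≠ 0 := by rcases H.sign with h | h <;> simp [h]
  rw [Polygon.IsReflexVertex, collinear_iff_wedge hε, ← unroll_succ, ← unroll_pred]
  change ¬ wedge ε (unroll P a k - _) (_ - unroll P a k) = 0 ∧ ∀ᶠ t : ℝ in _, unroll P a k +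
    t • (unroll P a (k - 1) - unroll P a k + (unroll P a (k + 1) - unroll P a k)) ∉ _
  set p := unroll P a with hp
  constructor
  · have := H.neg₁ (k - 1) k (by omega) (by omega) hkβ
    rw [step, sub_add_cancel] at this
    exact this.ne
  · filter_upwards [Ioc_mem_nhdsGT (show (0 : ℝ) < 1 / 2 by norm_num)] with t ⟨ht, ht_le⟩ hmem
    obtain ⟨-, j, hj, hjβ, hside⟩ := H.chainSide₁_of_mem_region hmem
    have hcombo : p k + t • (p (k - 1) - p k + (p (k + 1) - p k)) = (1 - 2 * t) • p k +
        (2 * t) • ((1 / 2 : ℝ) • p (k - 1) + (1 / 2 : ℝ) • p (k + 1)) := by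
      module
    rw [← hp, hcombo, side_combo _ _ _ _ _ (by ring)] at hside
    have := H.bending₁.side_nonpos hj hjβ hk.le hkβ.le
    have := H.bending₁.side_midpoint_neg hj hjβ (k := k - 1) (m := k + 1) (by omega) (by omega)
      (by omega)
    nlinarith

lemma isPseudoTriangle_of_triChain {b c : Fin n}
    (H : TriChain ε (unroll P a) ((b - a).val : ℤ) ((c - a).val : ℤ) n) :
    P.IsPseudoTriangle a b c := by
  obtain ⟨hβ, hβγ, _⟩ := H.corners_lt
  have H₂ := H.shift_unroll
  have H₃ := H₂.shift_unroll
  have hb : a + ((b - a).val : Fin n) = b := by rw [Fin.cast_val_eq_self, add_sub_cancel]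
  have hc : a + ((c - a).val : Fin n) = c := by rw [Fin.cast_val_eq_self, add_sub_cancel]
  have hbc : b + (((c - a).val - (b - a).val : ℕ) : Fin n) = c := by
    rw [Nat.cast_sub (by omega), Fin.cast_val_eq_self, Fin.cast_val_eq_self,
      sub_sub_sub_cancel_right, add_sub_cancel]
  rw [hb] at H₂ H₃
  rw [hbc] at H₃
  refine ⟨H.isSimple, by rw [Fin.lt_def]; exact_mod_cast hβ, by rw [Fin.lt_def]; exact_mod_cast hβγ,
    H.isConvexVertex, H₂.isConvexVertex, H₃.isConvexVertex, fun i hia hib hic => ?_⟩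
  obtain ⟨k, hk, hkn, hi, -, -⟩ := exists_unroll P a i
  have hk_ne_zero : k ≠ 0 := fun h => hia (by rw [hi, h, Int.cast_zero, add_zero])
  have hk_ne_b : k ≠ (b - a).val := fun h => hib (by rw [hi, h, Int.cast_natCast, hb])
  have hk_ne_c : k ≠ (c - a).val := fun h => hic (by rw [hi, h, Int.cast_natCast, hc])
  rcases lt_or_ge k (b - a).val with hkb | hbk
  · exact hi ▸ H.isReflexVertex (by omega) hkb
  rcases lt_or_ge k (c - a).val with hkc | hck
  · convert H₂.isReflexVertex (k := k - (b - a).val) (by omega) (by omega) using 1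
    rw [hi, Int.cast_sub, Int.cast_natCast, Fin.cast_val_eq_self]
    ring
  · convert H₃.isReflexVertex (k := k - (c - a).val) (by omega) (by omega) using 1
    rw [hi, Int.cast_sub, Int.cast_natCast, Fin.cast_val_eq_self]
    ring

end PseudoTriangle

/-! ### Visibility and tangents -/

section Visibility

variable {ε : ℝ} {p : ℤ → Plane} {β γ n : ℤ} {x y z : Plane}

/-- The segment between `p i` and `p k` stays in the region enclosed by three chains. -/
def Sees (ε : ℝ) (p : ℤ → Plane) (β γ n i k : ℤ) : Prop :=
  segment ℝ (p i) (p k) ⊆ enclosed ε p β γ n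

lemma sees_comm {i k : ℤ} : Sees ε p β γ n i k ↔ Sees ε p β γ n k i := by
  rw [Sees, Sees, segment_symm]

lemma half_smul_add_half_smul_mem_segment (x y : Plane) :
    (1 / 2 : ℝ) • x + (1 / 2 : ℝ) • y ∈ segment ℝ x y :=
  ⟨1 / 2, 1 / 2, by norm_num, by norm_num, by norm_num, rfl⟩

lemma Bending.not_chainSide_midpoint {l u k m : ℤ} (H : Bending ε p l u) (hlk : l ≤ k)
    (hkm : k + 2 ≤ m) (hmu : m ≤ u) :
    ¬ ChainSide ε p l u ((1 / 2 : ℝ) • p k + (1 / 2 : ℝ) • p m) :=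
  fun ⟨_, _, hlj, hju, hside⟩ => (H.side_midpoint_neg hlj hju hlk hkm hmu).not_ge hside

lemma wedge_sub_nonneg_of_mem_segment {d w : Plane} (hx : x ∈ segment ℝ y z)
    (hy : 0 ≤ wedge ε d (y - w)) (hz : 0 ≤ wedge ε d (z - w)) : 0 ≤ wedge ε d (x - w) := by
  obtain ⟨s, t, hs, ht, hst, rfl⟩ := hx
  rw [wedge_combo_sub _ _ _ _ _ hst]
  positivity

namespace TriChain

lemma sees_sub_period (H : TriChain ε p β γ n) (i k : ℤ) :
    Sees ε p β γ n i (k - n) ↔ Sees ε p β γ n i k := by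
  rw [Sees, Sees, ← H.periodic (k - n), sub_add_cancel]

lemma sees_reverse (H : TriChain ε p β γ n) (i k : ℤ) :
    Sees (-ε) (fun i => p (-i)) (n - γ) (n - β) n i k ↔ Sees ε p β γ n (n - i) (n - k) := by
  rw [Sees, Sees, H.enclosed_reverse, ← H.periodic (-i), ← H.periodic (-k), neg_add_eq_sub,
    neg_add_eq_sub]

lemma side_reverse (H : TriChain ε p β γ n) (k : ℤ) (x : Plane) :
    side (-ε) (fun i => p (-i)) k x = side ε p (n - k - 1) x := by
  rw [Plane.side_reverse, ← H.side_add_period]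
  congr 1
  ring

lemma apply_neg (H : TriChain ε p β γ n) (k : ℤ) : p (-k) = p (n - k) := by
  rw [← H.periodic, neg_add_eq_sub]

lemma not_sees₁ (H : TriChain ε p β γ n) {k m : ℤ} (hk : 0 ≤ k) (hkm : k + 2 ≤ m)
    (hmβ : m ≤ β) : ¬ Sees ε p β γ n k m := fun h =>
  H.bending₁.not_chainSide_midpoint hk hkm hmβ (h (half_smul_add_half_smul_mem_segment _ _)).1

lemma not_sees₂ (H : TriChain ε p β γ n) {k m : ℤ} (hβk : β ≤ k) (hkm : k + 2 ≤ m)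
    (hmγ : m ≤ γ) : ¬ Sees ε p β γ n k m := fun h =>
  H.bending₂.not_chainSide_midpoint hβk hkm hmγ (h (half_smul_add_half_smul_mem_segment _ _)).2.1

lemma not_sees₃ (H : TriChain ε p β γ n) {k m : ℤ} (hγk : γ ≤ k) (hkm : k + 2 ≤ m)
    (hmn : m ≤ n) : ¬ Sees ε p β γ n k m := fun h =>
  H.bending₃.not_chainSide_midpoint hγk hkm hmn (h (half_smul_add_half_smul_mem_segment _ _)).2.2

lemma mem_enclosed_of_mem_segment (H : TriChain ε p β γ n) {i k j₁ j₂ j₃ : ℤ}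
    (hx : x ∈ segment ℝ (p i) (p k)) (hj₁ : 0 ≤ j₁ ∧ j₁ < β) (hj₂ : β ≤ j₂ ∧ j₂ < γ)
    (hj₃ : γ ≤ j₃ ∧ j₃ < n) (hx₁ : 0 ≤ side ε p j₁ x) (hx₂ : 0 ≤ side ε p j₂ x)
    (hx₃ : 0 ≤ side ε p j₃ x) : x ∈ enclosed ε p β γ n :=
  ⟨⟨wedge_sub_nonneg_of_mem_segment hx (H.wedge_chord₁_nonneg _) (H.wedge_chord₁_nonneg _),
      j₁, hj₁.1, hj₁.2, hx₁⟩,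
    ⟨wedge_sub_nonneg_of_mem_segment hx (H.wedge_chord₂_nonneg _) (H.wedge_chord₂_nonneg _),
      j₂, hj₂.1, hj₂.2, hx₂⟩,
    ⟨wedge_sub_nonneg_of_mem_segment hx (H.wedge_chord₃_nonneg _) (H.wedge_chord₃_nonneg _),
      j₃, hj₃.1, hj₃.2, hx₃⟩⟩

lemma sees_of_sides (H : TriChain ε p β γ n) {i k j₁ j₂ j₃ : ℤ}
    (hj₁ : 0 ≤ j₁ ∧ j₁ < β) (hj₂ : β ≤ j₂ ∧ j₂ < γ) (hj₃ : γ ≤ j₃ ∧ j₃ < n)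
    (hi₁ : 0 ≤ side ε p j₁ (p i)) (hk₁ : 0 ≤ side ε p j₁ (p k))
    (hi₂ : 0 ≤ side ε p j₂ (p i)) (hk₂ : 0 ≤ side ε p j₂ (p k))
    (hi₃ : 0 ≤ side ε p j₃ (p i)) (hk₃ : 0 ≤ side ε p j₃ (p k)) : Sees ε p β γ n i k :=
  fun _ hx => H.mem_enclosed_of_mem_segment hx hj₁ hj₂ hj₃
    (wedge_sub_nonneg_of_mem_segment hx hi₁ hk₁) (wedge_sub_nonneg_of_mem_segment hx hi₂ hk₂)
    (wedge_sub_nonneg_of_mem_segment hx hi₃ hk₃)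

lemma side_last₂_nonneg (H : TriChain ε p β γ n) {k : ℤ} (hγk : γ ≤ k) (hkn : k ≤ n) :
    0 ≤ side ε p (γ - 1) (p k) := by
  have := H.shift.side_last₁_nonneg (k := k - β) (by omega) (by omega)
  rw [side_shift, sub_add_cancel] at this
  convert this using 2
  ring

lemma side_last₃_nonneg (H : TriChain ε p β γ n) {k : ℤ} (hk : 0 ≤ k) (hkβ : k ≤ β) :
    0 ≤ side ε p (n - 1) (p k) := by
  obtain ⟨_, _, hγn⟩ := H.corners_lt
  rw [side_eq_wedge_succ, sub_add_cancel, H.period]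
  exact wedge_sub_nonneg hk fun j hj hjk =>
    (H.pos₃₁ _ j (by omega) (by omega) (by omega) (by omega)).le

lemma side_first₂_one_pos (H : TriChain ε p β γ n) (hβ : 1 < β) : 0 < side ε p β (p 1) := by
  rw [← H.periodic]
  exact H.side_first₂_pos (by omega) (by omega)

lemma side_first₂_one_nonneg (H : TriChain ε p β γ n) : 0 ≤ side ε p β (p 1) := by
  rcases eq_or_lt_of_le (show 1 ≤ β from H.corners_lt.1) with rfl | hβ
  · rw [side_self]
  · exact (H.side_first₂_one_pos hβ).le

lemma exists_tangent_first (H : TriChain ε p β γ n) : ∃ m, β < m ∧ m ≤ γ ∧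
    (∀ j, β < j → j < m → 0 < side ε p j (p 1)) ∧ (m < γ → side ε p m (p 1) ≤ 0) := by
  obtain ⟨m, ⟨hβm, hmγ, hm⟩, hmin⟩ := Int.exists_least_of_bdd
    (P := fun m => β < m ∧ m ≤ γ ∧ (m < γ → side ε p m (p 1) ≤ 0))
    ⟨β, fun z hz => hz.1.le⟩ ⟨γ, H.corners_lt.2.1, le_rfl, fun h => absurd h (lt_irrefl _)⟩
  refine ⟨m, hβm, hmγ, fun j hβj hjm => ?_, hm⟩
  by_contra hj
  have := hmin j ⟨hβj, by omega, fun _ => not_lt.1 hj⟩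
  omega

lemma exists_tangent_last (H : TriChain ε p β γ n) : ∃ m, β ≤ m ∧ m < γ ∧
    (∀ j, m ≤ j → j < γ - 1 → 0 < side ε p j (p (n - 1))) ∧
    (β < m → side ε p (m - 1) (p (n - 1)) ≤ 0) := by
  obtain ⟨m, hγm, hmβ, hpos, hnonpos⟩ := H.reverse.exists_tangent_first
  simp only [H.side_reverse] at hpos hnonpos
  rw [H.apply_neg] at hnonpos
  refine ⟨n - m, by omega, by omega, fun j hmj hjγ => ?_, fun hβm => hnonpos (by omega)⟩
  have := hpos (n - j - 1) (by omega) (by omega)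
  rwa [H.apply_neg, show n - (n - j - 1) - 1 = j by ring] at this

/- Only the chain opposite to a corner can block the view between its neighbours: the two edges at
the corner have both neighbours on their inner side. -/
lemma exists_mul_side_add_mul_side_neg (H : TriChain ε p β γ n)
    (h : ¬ Sees ε p β γ n 1 (n - 1)) : ∃ s t : ℝ, 0 ≤ s ∧ 0 ≤ t ∧ s + t = 1 ∧
      ∀ j, β ≤ j → j < γ → s * side ε p j (p 1) + t * side ε p j (p (n - 1)) < 0 := by
  obtain ⟨hβ, _, hγn⟩ := H.corners_lt
  obtain ⟨x, ⟨s, t, hs, ht, hst, rfl⟩, hx⟩ := Set.not_subset.1 h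
  refine ⟨s, t, hs, ht, hst, fun j hβj hjγ => not_le.1 fun hside => hx ?_⟩
  refine H.mem_enclosed_of_mem_segment ⟨s, t, hs, ht, hst, rfl⟩ ⟨le_rfl, hβ⟩ ⟨hβj, hjγ⟩
    (j₃ := n - 1) (by omega) ?_ (by rwa [side_combo _ _ _ _ _ hst]) ?_
  · rw [side_combo _ _ _ _ _ hst, show side ε p 0 (p 1) = 0 from side_succ ε p 0]
    have := H.side_first₁_pos (k := n - 1) (by omega) (by omega)
    positivity
  · rw [side_combo _ _ _ _ _ hst, side_self]
    have := H.side_last₃_nonneg (k := 1) (by omega) (by omega)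
    positivity

end TriChain

/-- The middle chain blocks the view between the neighbours `p 1` and `p (n - 1)` of the corner
`p 0`, and `p m` and `p m'` are the vertices at which it is touched by the shortest path between
them. -/
structure Tangents (ε : ℝ) (p : ℤ → Plane) (β γ n m m' : ℤ) : Prop where
  lt_left : β < m
  le : m ≤ m'
  lt_right : m' < γ
  left_pos : ∀ j, β < j → j < m → 0 < side ε p j (p 1)
  left_nonpos : side ε p m (p 1) ≤ 0
  right_pos : ∀ j, m' ≤ j → j < γ - 1 → 0 < side ε p j (p (n - 1))
  right_nonpos : side ε p (m' - 1) (p (n - 1)) ≤ 0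
  blocked : ∃ s t : ℝ, 0 ≤ s ∧ 0 ≤ t ∧ s + t = 1 ∧ ∀ j, β ≤ j → j < γ →
    s * side ε p j (p 1) + t * side ε p j (p (n - 1)) < 0

theorem TriChain.exists_tangents (H : TriChain ε p β γ n) (h : ¬ Sees ε p β γ n 1 (n - 1)) :
    ∃ m m', Tangents ε p β γ n m m' := by
  obtain ⟨_, hβγ, hγn⟩ := H.corners_lt
  have hblocked := H.exists_mul_side_add_mul_side_neg h
  have hneg : ∀ j, β ≤ j → j < γ → 0 ≤ side ε p j (p 1) → side ε p j (p (n - 1)) < 0 := by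
    intro j hβj hjγ hj
    obtain ⟨s, t, hs, ht, -, hst⟩ := hblocked
    by_contra! hj'
    exact (hst j hβj hjγ).not_ge (by positivity)
  have hneg_last : side ε p (γ - 1) (p 1) < 0 := by
    by_contra! hj
    exact (hneg _ (by omega) (by omega) hj).not_ge (H.side_last₂_nonneg (by omega) (by omega))
  have hβγ_succ : β + 1 < γ := by
    by_contra hlt
    rw [show γ - 1 = β by omega] at hneg_last
    exact hneg_last.not_ge H.side_first₂_one_nonneg
  obtain ⟨m, hβm, hmγ, hleft_pos, hleft_nonpos⟩ := H.exists_tangent_first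
  obtain ⟨m', hβm', hmγ', hright_pos, hright_nonpos⟩ := H.exists_tangent_last
  have hmγ_lt : m < γ := by
    by_contra hlt
    exact hneg_last.not_gt (hleft_pos _ (by omega) (by omega))
  have hβm'_lt : β < m' := by
    by_contra hlt
    exact (hneg β le_rfl hβγ H.side_first₂_one_nonneg).not_gt
      (hright_pos β (by omega) (by omega))
  have hmm' : m ≤ m' := by
    by_contra hlt
    exact (hneg (m - 1) (by omega) (by omega) (hleft_pos _ (by omega) (by omega)).le).not_gt
      (hright_pos _ (by omega) (by omega))
  exact ⟨m, m', hβm, hmm', hmγ', hleft_pos, hleft_nonpos hmγ_lt, hright_pos,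
    hright_nonpos hβm'_lt, hblocked⟩

end Visibility

section Tangents

variable {ε : ℝ} {p : ℤ → Plane} {β γ n m m' : ℤ}

lemma wedge_mul_wedge_eq (ε : ℝ) (w x y z : Plane) :
    wedge ε x y * wedge ε w z = wedge ε z y * wedge ε w x + wedge ε x z * wedge ε w y := by
  simp only [wedge_apply]; ring

lemma exists_eq_smul_add_smul {x y z : Plane} (hxy : wedge ε x y < 0) (hxz : wedge ε x z ≤ 0)
    (hzy : wedge ε z y ≤ 0) : ∃ s t : ℝ, 0 ≤ s ∧ 0 ≤ t ∧ z = s • x + t • y := by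
  refine ⟨wedge ε z y / wedge ε x y, wedge ε x z / wedge ε x y,
    div_nonneg_of_nonpos hzy hxy.le, div_nonneg_of_nonpos hxz hxy.le, ?_⟩
  rw [← smul_right_inj hxy.ne, wedge_smul_eq, smul_add, smul_smul, smul_smul,
    mul_div_cancel₀ _ hxy.ne, mul_div_cancel₀ _ hxy.ne]

lemma TriChain.step_reverse (H : TriChain ε p β γ n) (k : ℤ) :
    step (fun i => p (-i)) (n - k - 1) = -step p k := by
  rw [Plane.step_reverse, ← H.step_add_period, show -(n - k - 1) - 1 + n = k by ring]

lemma side_pred (ε : ℝ) (p : ℤ → Plane) (j : ℤ) (x : Plane) :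
    side ε p (j - 1) x = wedge ε (step p (j - 1)) (x - p j) := by
  rw [side_eq_wedge_succ, sub_add_cancel]

lemma Bending.exists_mem_segment_not_chainSide {l u : ℤ} {x : Plane} (hB : Bending ε p l u)
    (hx : side ε p l x < 0) : ∃ y ∈ segment ℝ (p l) x, ¬ ChainSide ε p l u y := by
  have hnear : ∀ j ∈ Finset.Ico l u, ∀ᶠ t : ℝ in 𝓝[>] 0,
      side ε p j ((1 - t) • p l + t • x) < 0 := fun j hj => by
    obtain ⟨hlj, hju⟩ := Finset.mem_Ico.1 hj
    simp only [side_combo ε p j (p l) x (sub_add_cancel _ _)]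
    rcases eq_or_lt_of_le hlj with rfl | hlj
    · filter_upwards [self_mem_nhdsWithin] with t ht
      rw [side_self, mul_zero, zero_add]
      exact mul_neg_of_pos_of_neg ht hx
    · have hcont : Continuous fun t : ℝ => (1 - t) * side ε p j (p l) + t * side ε p j x := by
        fun_prop
      refine (hcont.tendsto 0).mono_left nhdsWithin_le_nhds (Iio_mem_nhds ?_)
      simpa using hB.side_neg hlj.le hju le_rfl (by omega) (by omega) (by omega)
  obtain ⟨t, ht, ht_pos, ht_le⟩ := (((Filter.eventually_all_finset _).2 hnear).and
    (Ioc_mem_nhdsGT (show (0 : ℝ) < 1 by norm_num))).exists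
  exact ⟨_, ⟨1 - t, t, sub_nonneg.2 ht_le, ht_pos.le, sub_add_cancel _ _, rfl⟩,
    fun ⟨_, j, hlj, hju, hside⟩ => (ht j (Finset.mem_Ico.2 ⟨hlj, hju⟩)).not_ge hside⟩

namespace Tangents

lemma reverse (T : Tangents ε p β γ n m m') (H : TriChain ε p β γ n) :
    Tangents (-ε) (fun i => p (-i)) (n - γ) (n - β) n (n - m') (n - m) := by
  have := T.lt_left
  have := T.le
  have := T.lt_right
  have hfirst : p (-1) = p (n - 1) := H.apply_neg 1
  have hlast : p (-(n - 1)) = p 1 := by rw [H.apply_neg, sub_sub_cancel]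
  refine ⟨by omega, by omega, by omega, fun j hj hjm => ?_, ?_, fun j hmj hj => ?_, ?_, ?_⟩
  · rw [H.side_reverse, hfirst]
    exact T.right_pos _ (by omega) (by omega)
  · rw [H.side_reverse, hfirst, sub_sub_cancel]
    exact T.right_nonpos
  · rw [H.side_reverse, hlast]
    exact T.left_pos _ (by omega) (by omega)
  · rw [H.side_reverse, hlast, show n - (n - m - 1) - 1 = m by ring]
    exact T.left_nonpos
  · obtain ⟨s, t, hs, ht, hst, hblocked⟩ := T.blocked
    refine ⟨t, s, ht, hs, by rwa [add_comm], fun j hj hjn => ?_⟩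
    rw [H.side_reverse, H.side_reverse, hfirst, hlast, add_comm]
    exact hblocked _ (by omega) (by omega)

lemma side_pred_pos (T : Tangents ε p β γ n m m') (H : TriChain ε p β γ n) (hβ : 1 < β) :
    0 < side ε p (m - 1) (p 1) := by
  rcases eq_or_lt_of_le (Int.le_sub_one_of_lt T.lt_left) with h | h
  · exact h ▸ H.side_first₂_one_pos hβ
  · exact T.left_pos _ h (by omega)

lemma side_pred_nonneg (T : Tangents ε p β γ n m m') (H : TriChain ε p β γ n) :
    0 ≤ side ε p (m - 1) (p 1) := by
  rcases eq_or_lt_of_le (Int.le_sub_one_of_lt T.lt_left) with h | h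
  · exact h ▸ H.side_first₂_one_nonneg
  · exact (T.left_pos _ h (by omega)).le

lemma side_first₂_neg (T : Tangents ε p β γ n m m') (H : TriChain ε p β γ n) :
    side ε p β (p (n - 1)) < 0 := by
  obtain ⟨s, t, hs, ht, -, hblocked⟩ := T.blocked
  have := H.side_first₂_one_nonneg
  by_contra! hside
  exact (hblocked β le_rfl H.corners_lt.2.1).not_ge (by positivity)

lemma ne_one (T : Tangents ε p β γ n m m') (H : TriChain ε p β γ n) : p m ≠ p 1 := fun h => by
  have := T.lt_left
  have := T.le
  have := T.lt_right
  rcases eq_or_lt_of_le (show 1 ≤ β from H.corners_lt.1) with hβ | hβ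
  · have := H.bending₂.side_neg (j := m) (k := β) (by omega) (by omega) le_rfl (by omega)
      (by omega) (by omega)
    rw [← hβ, ← h, side_self] at this
    exact lt_irrefl _ this
  · have := T.side_pred_pos H hβ
    rw [side_pred, h, sub_self, map_zero] at this
    exact lt_irrefl _ this

lemma exists_first_eq (T : Tangents ε p β γ n m m') (H : TriChain ε p β γ n) :
    ∃ s t : ℝ, 0 ≤ s ∧ 0 ≤ t ∧ 0 < s + t ∧ p m - p 1 = s • step p (m - 1) + t • step p m := by
  have := T.lt_left
  have := T.le
  have := T.lt_right
  have hpred := T.side_pred_nonneg H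
  have hm := T.left_nonpos
  rw [side_pred, ← neg_sub (p m) (p 1), map_neg] at hpred
  rw [side, ← neg_sub (p m) (p 1), map_neg, ← wedge_swap] at hm
  obtain ⟨s, t, hs, ht, heq⟩ := exists_eq_smul_add_smul
    (H.neg₂ (m - 1) m (by omega) (by omega) (by omega)) (neg_nonneg.1 hpred) hm
  refine ⟨s, t, hs, ht, (add_nonneg hs ht).lt_of_ne fun hst => T.ne_one H ?_, heq⟩
  obtain ⟨rfl, rfl⟩ := (add_eq_zero_iff_of_nonneg hs ht).1 hst.symm
  rwa [zero_smul, zero_smul, add_zero, sub_eq_zero] at heq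

lemma map_first_nonneg (T : Tangents ε p β γ n m m') (H : TriChain ε p β γ n)
    (f : Plane →ₗ[ℝ] ℝ) (hpred : 0 ≤ f (step p (m - 1))) (hm : 0 ≤ f (step p m)) :
    0 ≤ f (p m - p 1) := by
  obtain ⟨s, t, hs, ht, -, heq⟩ := T.exists_first_eq H
  rw [heq, map_add, map_smul, map_smul]
  exact add_nonneg (mul_nonneg hs hpred) (mul_nonneg ht hm)

lemma map_first_pos (T : Tangents ε p β γ n m m') (H : TriChain ε p β γ n)
    (f : Plane →ₗ[ℝ] ℝ) (hpred : 0 < f (step p (m - 1))) (hm : 0 < f (step p m)) :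
    0 < f (p m - p 1) := by
  obtain ⟨s, t, hs, ht, hst, heq⟩ := T.exists_first_eq H
  rw [heq, map_add, map_smul, map_smul, smul_eq_mul, smul_eq_mul]
  rcases hs.eq_or_lt with rfl | hs
  · rw [zero_add] at hst
    positivity
  · positivity

lemma map_last_nonneg (T : Tangents ε p β γ n m m') (H : TriChain ε p β γ n)
    (f : Plane →ₗ[ℝ] ℝ) (hpred : 0 ≤ f (step p (m' - 1))) (hm : 0 ≤ f (step p m')) :
    0 ≤ f (p (n - 1) - p m') := by
  have := (T.reverse H).map_first_nonneg H.reverse (-f) (by simpa [H.step_reverse] using hm)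
    (by rw [show n - m' = n - (m' - 1) - 1 by ring, H.step_reverse]; simpa using hpred)
  rwa [H.apply_neg, H.apply_neg, sub_sub_cancel, LinearMap.neg_apply, ← map_neg, neg_sub] at this

lemma map_last_pos (T : Tangents ε p β γ n m m') (H : TriChain ε p β γ n)
    (f : Plane →ₗ[ℝ] ℝ) (hpred : 0 < f (step p (m' - 1))) (hm : 0 < f (step p m')) :
    0 < f (p (n - 1) - p m') := by
  have := (T.reverse H).map_first_pos H.reverse (-f) (by simpa [H.step_reverse] using hm)
    (by rw [show n - m' = n - (m' - 1) - 1 by ring, H.step_reverse]; simpa using hpred)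
  rwa [H.apply_neg, H.apply_neg, sub_sub_cancel, LinearMap.neg_apply, ← map_neg, neg_sub] at this

lemma wedge_first_pos (T : Tangents ε p β γ n m m') (H : TriChain ε p β γ n) {i : ℤ} (hi : 0 ≤ i)
    (hiβ : i < β) : 0 < wedge ε (step p i) (p m - p 1) := by
  have := T.lt_left
  have := T.le
  have := T.lt_right
  exact T.map_first_pos H _ (H.pos₁₂ i (m - 1) hi hiβ (by omega) (by omega))
    (H.pos₁₂ i m hi hiβ (by omega) (by omega))

lemma wedge_middle_pos (T : Tangents ε p β γ n m m') (H : TriChain ε p β γ n) (hβ : 1 < β) {i : ℤ}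
    (hβi : β ≤ i) (him : i < m) : 0 < wedge ε (step p i) (p 1 - p m) := by
  have := T.le
  have := T.lt_right
  rcases eq_or_lt_of_le (Int.le_sub_one_of_lt him) with rfl | him
  · exact side_pred ε p m _ ▸ T.side_pred_pos H hβ
  · rw [← neg_sub, map_neg]
    exact T.map_first_pos H (-wedge ε (step p i))
      (neg_pos.2 (H.neg₂ i (m - 1) hβi him (by omega)))
      (neg_pos.2 (H.neg₂ i m hβi (by omega) (by omega)))

lemma side_first₁_pos (T : Tangents ε p β γ n m m') (H : TriChain ε p β γ n) :
    0 < side ε p 0 (p m) := by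
  rw [side_eq_wedge_succ, zero_add]
  exact T.wedge_first_pos H le_rfl H.corners_lt.1

lemma side_last₃_nonneg (T : Tangents ε p β γ n m m') (H : TriChain ε p β γ n) {k : ℤ}
    (hk : 0 ≤ k) (hkm : k ≤ m') : 0 ≤ side ε p (n - 1) (p k) := by
  have := H.corners_lt.2.2
  have := T.lt_right
  rcases le_or_gt k β with hkβ | hβk
  · exact H.side_last₃_nonneg hk hkβ
  · have hm' := (T.reverse H).side_first₁_pos H.reverse
    rw [H.side_reverse, H.apply_neg, sub_zero, sub_sub_cancel] at hm'
    have hkm' : wedge ε (step p (n - 1)) (p m' - p k) ≤ 0 := wedge_sub_nonpos hkm fun j hj hjm => by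
      rw [wedge_swap]
      linarith [H.pos₂₃ j (n - 1) (by omega) (by omega) (by omega) (by omega)]
    rw [side_eq ε p (n - 1) (p m'), ← neg_sub (p m') (p k), map_neg]
    linarith

lemma sees_first (T : Tangents ε p β γ n m m') (H : TriChain ε p β γ n) : Sees ε p β γ n 1 m := by
  obtain ⟨hβ, -, hγn⟩ := H.corners_lt
  have := T.lt_left
  have := T.le
  have := T.lt_right
  exact H.sees_of_sides (j₁ := 0) (j₂ := m - 1) (j₃ := n - 1) (by omega) (by omega) (by omega)
    (side_succ ε p 0).ge (T.side_first₁_pos H).le (T.side_pred_nonneg H)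
    (by rw [side_pred, sub_self, map_zero]) (T.side_last₃_nonneg H (by omega) (by omega))
    (T.side_last₃_nonneg H (by omega) (by omega))

lemma sees_last (T : Tangents ε p β γ n m m') (H : TriChain ε p β γ n) :
    Sees ε p β γ n (n - 1) m' := by
  have := (T.reverse H).sees_first H.reverse
  rwa [H.sees_reverse, sub_sub_cancel] at this

lemma sees_around_left (T : Tangents ε p β γ n m m') (H : TriChain ε p β γ n) :
    Sees ε p β γ n (β - 1) (β + 1) := by
  obtain ⟨hβ, -, hγn⟩ := H.corners_lt
  have := T.lt_left
  have := T.le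
  have := T.lt_right
  refine H.sees_of_sides (j₁ := β - 1) (j₂ := β) (j₃ := n - 1) (by omega) (by omega) (by omega)
    (side_self _ _ _).ge (H.side_last₁_nonneg (by omega) (by omega)) ?_
    (side_succ _ _ _).ge (T.side_last₃_nonneg H (by omega) (by omega))
    (T.side_last₃_nonneg H (by omega) (by omega))
  have hstep : p (β - 1) - p β = -step p (β - 1) := by rw [step, sub_add_cancel, neg_sub]
  rw [side, hstep, map_neg, ← wedge_swap]
  exact (H.pos₁₂ _ _ (by omega) (by omega) le_rfl (by omega)).le

lemma sees_around_right (T : Tangents ε p β γ n m m') (H : TriChain ε p β γ n) :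
    Sees ε p β γ n (γ + 1) (γ - 1) := by
  have := (T.reverse H).sees_around_left H.reverse
  rwa [H.sees_reverse, ← sub_add, sub_sub_cancel, ← sub_sub, sub_sub_cancel] at this

lemma not_sees_left (T : Tangents ε p β γ n m m') (H : TriChain ε p β γ n) {k : ℤ} (hγk : γ < k)
    (hkn : k < n) : ¬ Sees ε p β γ n β k := by
  have hβγ := H.corners_lt.2.1
  have hneg : side ε p β (p k) < 0 := by
    rw [side_eq ε p β (p (n - 1)), ← neg_sub (p (n - 1)) (p k), map_neg]
    have : 0 ≤ wedge ε (step p β) (p (n - 1) - p k) := wedge_sub_nonneg (by omega) fun j hkj hjn =>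
      (H.pos₂₃ β j le_rfl (by omega) (by omega) (by omega)).le
    linarith [T.side_first₂_neg H]
  obtain ⟨x, hx, hnot⟩ := H.bending₂.exists_mem_segment_not_chainSide hneg
  exact fun h => hnot (h hx).2.1

lemma not_sees_right (T : Tangents ε p β γ n m m') (H : TriChain ε p β γ n) {k : ℤ} (hk : 0 < k)
    (hkβ : k < β) : ¬ Sees ε p β γ n γ k := by
  have := (T.reverse H).not_sees_left H.reverse (k := n - k) (by omega) (by omega)
  rwa [H.sees_reverse, sub_sub_cancel, sub_sub_cancel] at this

end Tangents

end Tangents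

/-! ### Towers -/

section Towers

variable {ε : ℝ} {p : ℤ → Plane} {β γ n : ℤ}

lemma wedge_sub_sub_rotate (ε : ℝ) (x y z : Plane) :
    wedge ε (y - x) (z - x) = wedge ε (z - y) (x - y) := by
  simp only [wedge_apply, PiLp.sub_apply]; ring

lemma Bending.wedge_apex_pos {l u k : ℤ} (hB : Bending ε p l u) (hlk : l < k) (hku : k < u) :
    0 < wedge ε (p l - p k) (p u - p k) := by
  rw [← neg_sub (p k), map_neg, LinearMap.neg_apply, ← map_neg, neg_sub]
  refine wedge_sub_left_pos hlk fun i hli hik => ?_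
  rw [← neg_sub, map_neg, neg_pos]
  exact wedge_sub_neg hku fun j hkj hju => hB i j hli (by omega) hju

namespace TriChain

/- Otherwise the edge would separate `p γ` from both ends of its chain, although the vertex `p k`
lies in the triangle of the corners. -/
lemma side₁_corner_nonneg (H : TriChain ε p β γ n) {k : ℤ} (hk : 0 < k) (hkβ : k < β) :
    0 ≤ side ε p k (p γ) := by
  have hchord₁ : 0 < wedge ε (p 0 - p k) (p β - p k) := H.bending₁.wedge_apex_pos hk hkβ
  have hchord₂ : 0 ≤ wedge ε (p β - p k) (p γ - p k) := by
    rw [wedge_sub_sub_rotate]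
    exact H.wedge_chord₂_nonneg k
  have hchord₃ : 0 ≤ wedge ε (p γ - p k) (p 0 - p k) := by
    rw [wedge_sub_sub_rotate, ← H.period]
    exact H.wedge_chord₃_nonneg k
  rw [wedge_swap] at hchord₂ hchord₃
  have hzero : side ε p k (p 0) ≤ 0 := H.bending₁.side_nonpos hk.le hkβ le_rfl (by omega)
  have hβ : side ε p k (p β) ≤ 0 := H.bending₁.side_nonpos hk.le hkβ (by omega) le_rfl
  refine nonneg_of_mul_nonneg_right ?_ hchord₁
  rw [side, wedge_mul_wedge_eq]
  exact add_nonneg (mul_nonneg_of_nonpos_of_nonpos (by linarith) hzero)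
    (mul_nonneg_of_nonpos_of_nonpos (by linarith) hβ)

lemma side₁_nonneg_of_side₃_pred_nonpos (H : TriChain ε p β γ n) {k l : ℤ} (hk : 0 ≤ k)
    (hkβ : k < β) (hγl : γ < l) (hln : l < n) (hpred : side ε p (l - 1) (p k) ≤ 0)
    (hl : 0 ≤ side ε p l (p k)) : 0 ≤ side ε p k (p l) := by
  rw [side_pred] at hpred
  rw [side, wedge_swap, neg_nonneg] at hl
  obtain ⟨s, t, hs, ht, heq⟩ := exists_eq_smul_add_smul
    (H.neg₃ (l - 1) l (by omega) (by omega) hln) hpred hl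
  have hpos_pred := H.pos₃₁ (l - 1) k (by omega) (by omega) hk hkβ
  have hpos := H.pos₃₁ l k hγl.le hln hk hkβ
  rw [side, ← neg_sub, map_neg, ← wedge_swap, heq, map_add, map_smul, map_smul,
    LinearMap.add_apply, LinearMap.smul_apply, LinearMap.smul_apply]
  positivity

lemma exists_sees_chain₃ (H : TriChain ε p β (β + 1) n) {k : ℤ} (hk : 0 < k) (hkβ : k < β) :
    ∃ l, β < l ∧ l < n ∧ Sees ε p β (β + 1) n k l := by
  have := H.corners_lt.2.2
  have hlast : 0 < side ε p (n - 1) (p k) := by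
    rw [side_eq_wedge_succ, sub_add_cancel, H.period]
    exact wedge_sub_pos hk fun j hj hjk =>
      H.pos₃₁ _ _ (by omega) (by omega) hj (by omega)
  obtain ⟨l, ⟨hβl, hln, hl⟩, hmin⟩ := Int.exists_least_of_bdd
    (P := fun l => β < l ∧ l < n ∧ 0 < side ε p l (p k))
    ⟨β, fun z hz => hz.1.le⟩ ⟨n - 1, by omega, by omega, hlast⟩
  refine ⟨l, hβl, hln, H.sees_of_sides (j₁ := k) (j₂ := β) (j₃ := l) (by omega) (by omega)
    (by omega) (side_self _ _ _).ge ?_ (H.wedge_chord₂_nonneg k) (H.wedge_chord₂_nonneg l) hl.le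
    (side_self _ _ _).ge⟩
  rcases eq_or_lt_of_le (show β + 1 ≤ l by omega) with rfl | hβl
  · exact H.side₁_corner_nonneg hk hkβ
  · refine H.side₁_nonneg_of_side₃_pred_nonpos hk.le hkβ hβl hln (not_lt.1 fun hpred => ?_) hl.le
    have := hmin (l - 1) ⟨by omega, by omega, hpred⟩
    omega

lemma exists_sees_chain₁ (H : TriChain ε p β (β + 1) n) {k : ℤ} (hβk : β + 1 < k) (hkn : k < n) :
    ∃ l, 0 < l ∧ l ≤ β ∧ Sees ε p β (β + 1) n k l := by
  have H' := H.reverse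
  rw [show n - β = n - (β + 1) + 1 by ring] at H'
  obtain ⟨l, hl, hln, hsees⟩ := H'.exists_sees_chain₃ (k := n - k) (by omega) (by omega)
  rw [show n - (β + 1) + 1 = n - β by ring, H.sees_reverse, sub_sub_cancel] at hsees
  exact ⟨n - l, by omega, by omega, hsees⟩

lemma eq_one_or_eq_of_sees_zero (H : TriChain ε p β (β + 1) n) {k : ℤ} (hk : 0 < k) (hkn : k < n)
    (h : Sees ε p β (β + 1) n 0 k) : k = 1 ∨ k = n - 1 := by
  by_contra! hne
  rcases le_or_gt k β with hkβ | hβk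
  · exact H.not_sees₁ le_rfl (by omega) hkβ h
  · refine H.not_sees₃ (k := k) (m := n) (by omega) (by omega) le_rfl ?_
    rwa [Sees, segment_symm, H.period]

end TriChain

/-- The chord between `p l` and `p r` and the chains from `p l` to `p c` and from `p c` to `p r`
satisfy the turning conditions of a tower with corner `p c`. -/
structure CutsCorner (ε : ℝ) (p : ℤ → Plane) (l c r : ℤ) : Prop where
  sign : ε = 1 ∨ ε = -1
  lt_corner : l < c
  corner_lt : c < r
  bending_left : Bending ε p l c
  bending_right : Bending ε p c r
  corner_pos : ∀ i j, l ≤ i → i < c → c ≤ j → j < r → 0 < wedge ε (step p i) (step p j)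
  left_pos : ∀ i, l ≤ i → i < c → 0 < wedge ε (p l - p r) (step p i)
  right_pos : ∀ j, c ≤ j → j < r → 0 < wedge ε (step p j) (p l - p r)

lemma CutsCorner.triChain {l c r : ℤ} (C : CutsCorner ε p l c r) {q : ℤ → Plane}
    (hq : ∀ k, q (k + (r - l + 1)) = q k) (hq_right : ∀ k, 0 ≤ k → k ≤ r - c → q k = p (c + k))
    (hq_left : ∀ k, r - c < k → k ≤ r - l + 1 → q k = p (c + k - (r - l + 1))) :
    TriChain ε q (r - c) (r - c + 1) (r - l + 1) := by
  have hlc := C.lt_corner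
  have hcr := C.corner_lt
  have hstep_right : ∀ k, 0 ≤ k → k < r - c → step q k = step p (c + k) := fun k hk hkr => by
    rw [step, step, hq_right _ hk (by omega), hq_right _ (by omega) (by omega), add_assoc]
  have hstep_left : ∀ k, r - c < k → k < r - l + 1 → step q k = step p (c + k - (r - l + 1)) :=
    fun k hk hkl => by
      rw [step, step, hq_left _ hk (by omega), hq_left _ (by omega) (by omega)]
      congr 2
      ring
  have hstep_base : step q (r - c) = p l - p r := by
    rw [step, hq_right _ (by omega) le_rfl, hq_left _ (by omega) (by omega)]
    congr 2 <;> ring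
  refine ⟨C.sign, by omega, hq, fun i j hi hir hrj hjr => ?_, fun i j hri hir hrj hjl => ?_,
    fun i j hri hil hj hjr => ?_, fun i j hi hij hjr => ?_, fun i j hri hij hjr => by omega,
    fun i j hri hij hjl => ?_⟩
  · obtain rfl : j = r - c := by omega
    rw [hstep_base, hstep_right i hi hir]
    exact C.right_pos _ (by omega) (by omega)
  · obtain rfl : i = r - c := by omega
    rw [hstep_base, hstep_left j (by omega) hjl]
    exact C.left_pos _ (by omega) (by omega)
  · rw [hstep_left i (by omega) hil, hstep_right j hj hjr]
    exact C.corner_pos _ _ (by omega) (by omega) (by omega) (by omega)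
  · rw [hstep_right i hi (by omega), hstep_right j (by omega) hjr]
    exact C.bending_right _ _ (by omega) (by omega) (by omega)
  · rw [hstep_left i (by omega) (by omega), hstep_left j (by omega) hjl]
    exact C.bending_left _ _ (by omega) (by omega) (by omega)

end Towers

section TowerPolygons

open Fin.CommRing

lemma val_add_intCast {n : ℕ} [NeZero n] (a : Fin n) {k : ℤ} (hk : 0 ≤ k) (hkn : k < n) :
    (((a + (k : Fin n)).val : ℕ) : ℤ) = if a.val + k < n then a.val + k else a.val + k - n := by
  lift k to ℕ using hk
  have ha := a.isLt
  rw [Int.cast_natCast, Fin.val_add, Fin.val_natCast, Nat.mod_eq_of_lt (by omega : k < n)]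
  split_ifs with h
  · rw [Nat.mod_eq_of_lt (by omega), Nat.cast_add]
  · rw [Nat.mod_eq_sub_mod (by omega), Nat.mod_eq_of_lt (by omega), Nat.cast_sub (by omega),
      Nat.cast_add]

variable {n : ℕ} [NeZero n] {P : Polygon Plane n} {a : Fin n} {ε : ℝ} {β γ : ℤ}

namespace TriChain

lemma visibilityGraph_adj_iff (H : TriChain ε (unroll P a) β γ n) {k l : ℤ} :
    P.visibilityGraph.Adj (a + (k : Fin n)) (a + (l : Fin n)) ↔
      a + (k : Fin n) ≠ a + (l : Fin n) ∧ Sees ε (unroll P a) β γ n k l := by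
  rw [Sees, ← H.region_eq_enclosed]
  rfl

lemma sees_succ (H : TriChain ε (unroll P a) β γ n) (k : ℤ) :
    Sees ε (unroll P a) β γ n k (k + 1) := by
  rw [Sees, ← H.region_eq_enclosed]
  exact (segment_unroll_subset_boundary P a k).trans Set.subset_union_left

lemma exists_sees_across (H : TriChain ε (unroll P a) β (β + 1) n) {k : ℤ} (hk : 0 < k)
    (hkn : k < n) : ∃ l : ℤ, 0 < l ∧ l < n ∧ ((k ≤ β ∧ β < l) ∨ (l ≤ β ∧ β < k)) ∧
      Sees ε (unroll P a) β (β + 1) n k l := by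
  obtain ⟨hβ, -, hβn⟩ := H.corners_lt
  rcases lt_trichotomy k β with hkβ | rfl | hβk
  · obtain ⟨l, hβl, hln, hsees⟩ := H.exists_sees_chain₃ hk hkβ
    exact ⟨l, by omega, hln, Or.inl ⟨hkβ.le, hβl⟩, hsees⟩
  · exact ⟨k + 1, by omega, hβn, Or.inl ⟨le_rfl, by omega⟩, H.sees_succ k⟩
  · rcases eq_or_lt_of_le (show β + 1 ≤ k by omega) with rfl | hβk
    · exact ⟨β, hβ, by omega, Or.inr ⟨le_rfl, by omega⟩, sees_comm.1 (H.sees_succ β)⟩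
    · obtain ⟨l, hl, hlβ, hsees⟩ := H.exists_sees_chain₁ hβk hkn
      exact ⟨l, hl, by omega, Or.inr ⟨hlβ, by omega⟩, hsees⟩

end TriChain

section Base

variable {N : ℕ} {Q : Polygon Plane (N + 1)} {x : Fin (N + 1)}

lemma TriChain.isTower (H : TriChain ε (unroll Q x) (N - x.val : ℤ) (N - x.val + 1 : ℤ)
    (N + 1 : ℕ)) : Q.IsTower x (Fin.last N) 0 := by
  have hxN := x.isLt
  have hlt := H.corners_lt.2.2
  have hlast : (Fin.last N - x).val = N - x.val := Fin.sub_val_of_le (Fin.le_last x)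
  have hzero : (0 - x).val = N - x.val + 1 := by
    rw [Fin.val_sub, Fin.val_zero, add_zero, Nat.mod_eq_of_lt (by omega)]
    omega
  refine ⟨isPseudoTriangle_of_triChain (ε := ε) ?_, (Fin.last_add_one N).symm⟩
  rw [hlast, hzero, Nat.cast_add, Nat.cast_sub (by omega), Nat.cast_one]
  exact H

lemma TriChain.isIsolated_sdiff_pathGraph_iff (H : TriChain ε (unroll Q x) (N - x.val : ℤ)
    (N - x.val + 1 : ℤ) (N + 1 : ℕ)) {y : Fin (N + 1)} :
    (Q.visibilityGraph \ SimpleGraph.pathGraph _).IsIsolated y ↔ y = x := by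
  have := x.isLt
  obtain ⟨hβ, -, hlt⟩ := H.corners_lt
  obtain ⟨k, hk, hkN, rfl, -, -⟩ := exists_unroll Q x y
  have hval_k := val_add_intCast x hk hkN
  constructor
  · intro hiso
    by_contra hne
    have hk_ne : k ≠ 0 := fun h => hne (by rw [h, Int.cast_zero, add_zero])
    obtain ⟨l, hl, hlN, hside, hsees⟩ := H.exists_sees_across (by omega) hkN
    have hval_l := val_add_intCast x hl.le hlN
    have hdist : (x + (k : Fin (N + 1))).val + 1 < (x + (l : Fin (N + 1))).val ∨
        (x + (l : Fin (N + 1))).val + 1 < (x + (k : Fin (N + 1))).val := by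
      split_ifs at hval_k hval_l <;> omega
    refine hiso (x + (l : Fin (N + 1))) ?_
    rw [SimpleGraph.sdiff_adj, H.visibilityGraph_adj_iff, SimpleGraph.pathGraph_adj]
    exact ⟨⟨fun h => by rw [h] at hdist; omega, hsees⟩, by omega⟩
  · intro hy z hz
    have hk_zero : k = 0 := by
      have := congrArg (fun i : Fin (N + 1) => (i.val : ℤ)) hy
      split_ifs at hval_k <;> omega
    subst hk_zero
    obtain ⟨l, hl, hlN, rfl, -, -⟩ := exists_unroll Q x z
    have hval_l := val_add_intCast x hl hlN
    rw [SimpleGraph.sdiff_adj, H.visibilityGraph_adj_iff, SimpleGraph.pathGraph_adj] at hz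
    have hl_ne : l ≠ 0 := fun h => hz.1.1 (by rw [h])
    refine hz.2 ?_
    rcases H.eq_one_or_eq_of_sees_zero (by omega) hlN hz.1.2 with h | h <;>
      split_ifs at hval_k hval_l <;> omega

end Base

lemma unroll_subPolygon {i j : Fin n} {p : ℤ → Plane} {l : ℤ}
    (hp : ∀ k : ℕ, P (i + (k : Fin n)) = p (l + k)) (y : Fin ((j - i).val + 1)) {k : ℤ}
    (hk : 0 ≤ k) (hkn : k < ((j - i).val + 1 : ℕ)) :
    unroll (P.subPolygon i j) y k = p (l + if y.val + k < ((j - i).val + 1 : ℕ) then y.val + k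
      else y.val + k - ((j - i).val + 1 : ℕ)) := by
  rw [← val_add_intCast y hk hkn, ← hp]
  rfl

lemma CutsCorner.cutsOffTower {i x j : Fin n} {p : ℤ → Plane} {l c r : ℤ}
    (C : CutsCorner ε p l c r) (hp : ∀ k : ℕ, P (i + (k : Fin n)) = p (l + k))
    (hx : ((x - i).val : ℤ) = c - l) (hj : ((j - i).val : ℤ) = r - l) : P.CutsOffTower i j x := by
  have hlc := C.lt_corner
  have hcr := C.corner_lt
  have hval : (Fin.ofNat ((j - i).val + 1) (x - i).val).val = (x - i).val := by
    rw [Fin.val_ofNat, Nat.mod_eq_of_lt (by omega)]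
  set y := Fin.ofNat ((j - i).val + 1) (x - i).val
  have hperiod := unroll_add_period (P.subPolygon i j) y
  have H : TriChain ε (unroll (P.subPolygon i j) y) (r - c) (r - c + 1) (r - l + 1) := by
    refine C.triChain (fun k => ?_) (fun k hk hkr => ?_) fun k hrk hkl => ?_
    · rw [← hperiod k]
      congr 1
      omega
    · rw [unroll_subPolygon hp y hk (by omega), if_pos (by omega)]
      congr 1
      omega
    · rcases eq_or_lt_of_le hkl with hkl | hkl
      · have hk : k = 0 + (((j - i).val + 1 : ℕ) : ℤ) := by omega
        rw [hk, hperiod, unroll_subPolygon hp y le_rfl (by omega), if_pos (by omega)]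
        congr 1
        omega
      · rw [unroll_subPolygon hp y (by omega) (by omega), if_neg (by omega)]
        congr 1
        omega
  have H' : TriChain ε (unroll (P.subPolygon i j) y) ((j - i).val - y.val : ℤ)
      ((j - i).val - y.val + 1 : ℤ) ((j - i).val + 1 : ℕ) := by
    convert H using 1 <;> omega
  exact ⟨by rw [Fin.le_def]; omega, H'.isTower, fun _ => H'.isIsolated_sdiff_pathGraph_iff⟩

end TowerPolygons

/-! ### Shortest paths around a chain -/

section ShortestPath

variable {ε : ℝ} {S : Set Plane} {v M : Plane} {f : ℝ → Plane} {q : ℕ → Plane} {r : ℕ}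

lemma exists_last_zero {h : ℝ → ℝ} {a b : ℝ} (hab : a ≤ b) (hh : ContinuousOn h (Set.Icc a b))
    (ha : 0 ≤ h a) (hb : h b ≤ 0) :
    ∃ t ∈ Set.Icc a b, h t = 0 ∧ ∀ t', t < t' → t' ≤ b → h t' < 0 := by
  obtain ⟨t, ⟨htI, ht⟩, hmax⟩ := (isCompact_Icc.of_isClosed_subset
    (hh.preimage_isClosed_of_isClosed isClosed_Icc isClosed_Ici)
    Set.inter_subset_left).exists_isGreatest ⟨a, ⟨le_rfl, hab⟩, ha⟩
  have hafter : ∀ t', t < t' → t' ≤ b → h t' < 0 := fun t' htt' ht'b => not_le.1 fun ht' =>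
    (hmax ⟨⟨htI.1.trans htt'.le, ht'b⟩, ht'⟩).not_gt htt'
  obtain ⟨t', ht'I, ht'⟩ := intermediate_value_Icc' htI.2
    (hh.mono (Set.Icc_subset_Icc_left htI.1)) ⟨hb, ht⟩
  obtain rfl : t = t' := (eq_or_lt_of_le ht'I.1).resolve_right fun hlt =>
    (hafter t' hlt ht'I.2).ne ht'
  exact ⟨t, htI, ht', hafter⟩

lemma eq_smul_of_wedge_eq_zero {x y z : Plane} (hxy : wedge ε x y ≠ 0) (hxz : wedge ε x z = 0) :
    z = (wedge ε z y / wedge ε x y) • x := by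
  have := wedge_smul_eq ε x y z
  rw [hxz, zero_smul, add_zero] at this
  rw [div_eq_inv_mul, mul_smul, ← this, inv_smul_smul₀ hxy]

lemma wedge_sub_tip (ε : ℝ) (x y z : Plane) :
    wedge ε (y - x) (z - x) = wedge ε (y - x) (z - y) := by
  rw [← sub_add_sub_cancel z y x, map_add, wedge_self, add_zero]

/- The ray from `y` through `M` and the line of `g` bound a wedge containing the end of the curve. A
curve that enters it across the line does so on the ray from `y` in direction `g`, as it cannot
cross the ray through `M`. -/
lemma exists_eq_add_smul_of_curve {g y : Plane} {a b : ℝ} (hab : a ≤ b)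
    (hf : ContinuousOn f (Set.Icc a b)) (hfS : Set.MapsTo f (Set.Icc a b) S)
    (hstart : 0 ≤ wedge ε g (f a - y)) (hend : wedge ε g (f b - y) ≤ 0)
    (hMend : 0 < wedge ε (M - y) (f b - y)) (hM : wedge ε g (M - y) < 0)
    (hray : ∀ s : ℝ, 0 < s → y + s • (M - y) ∉ S) :
    ∃ t ∈ Set.Icc a b, ∃ s : ℝ, 0 ≤ s ∧ f t = y + s • g := by
  have hcont : ∀ x, ContinuousOn (fun t => wedge ε x (f t - y)) (Set.Icc a b) := fun x =>
    (continuous_wedge ε x).comp_continuousOn (hf.sub continuousOn_const)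
  obtain ⟨t, htI, ht, hafter⟩ := exists_last_zero hab (hcont g) hstart hend
  have hsub : Set.Icc t b ⊆ Set.Icc a b := Set.Icc_subset_Icc_left htI.1
  have hft := eq_smul_of_wedge_eq_zero hM.ne ht
  set s := wedge ε (f t - y) (M - y) / wedge ε g (M - y)
  refine ⟨t, htI, s, not_lt.1 fun hs => ?_, by rw [← hft, add_sub_cancel]⟩
  have hMg : 0 < wedge ε (M - y) g := by rwa [wedge_swap, neg_pos]
  have hMt : wedge ε (M - y) (f t - y) < 0 := by
    rw [hft, map_smul]
    exact mul_neg_of_neg_of_pos hs hMg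
  obtain ⟨t', ht'I, ht'⟩ := intermediate_value_Icc htI.2 ((hcont (M - y)).mono hsub)
    ⟨hMt.le, hMend.le⟩
  have hft' := eq_smul_of_wedge_eq_zero hMg.ne' ht'
  have hlt : t < t' := ht'I.1.lt_of_ne fun h => hMt.ne (h ▸ ht')
  refine hray (wedge ε (f t' - y) g / wedge ε (M - y) g) (div_pos ?_ hMg) ?_
  · rw [wedge_swap, neg_pos]
    exact hafter t' hlt ht'I.2
  · rw [← hft', add_sub_cancel]
    exact hfS (hsub ht'I)

/-- The path `q 0, …, q r, v` wraps around an obstacle of `S`: at each of `q 1, …, q r` it turns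
towards the side of `M`, and there the ray towards `M` leaves `S` at once and for good. -/
structure WrapsAround (ε : ℝ) (S : Set Plane) (M v : Plane) (q : ℕ → Plane) (r : ℕ) : Prop where
  turn_nonpos : ∀ k, k + 1 < r → wedge ε (q (k + 1) - q k) (q (k + 2) - q (k + 1)) ≤ 0
  end_nonpos : ∀ k < r, wedge ε (q (k + 1) - q k) (v - q (k + 1)) ≤ 0
  center_neg : ∀ k < r, wedge ε (q (k + 1) - q k) (M - q (k + 1)) < 0
  center_end_pos : ∀ k < r, 0 < wedge ε (M - q (k + 1)) (v - q (k + 1))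
  ray_notMem : ∀ k < r, ∀ s : ℝ, 0 < s → q (k + 1) + s • (M - q (k + 1)) ∉ S

lemma WrapsAround.tail (W : WrapsAround ε S M v q (r + 1)) :
    WrapsAround ε S M v (fun k => q (k + 1)) r where
  turn_nonpos k hk := W.turn_nonpos (k + 1) (Nat.succ_lt_succ hk)
  end_nonpos k hk := W.end_nonpos (k + 1) (Nat.succ_lt_succ hk)
  center_neg k hk := W.center_neg (k + 1) (Nat.succ_lt_succ hk)
  center_end_pos k hk := W.center_end_pos (k + 1) (Nat.succ_lt_succ hk)
  ray_notMem k hk := W.ray_notMem (k + 1) (Nat.succ_lt_succ hk)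

lemma edist_add_smul_sub (x y : Plane) {s : ℝ} (hs : 0 ≤ s) :
    edist x (y + s • (y - x)) = edist x y + edist y (y + s • (y - x)) := by
  have hdist : dist x (y + s • (y - x)) = dist x y + dist y (y + s • (y - x)) := by
    rw [dist_eq_norm', dist_eq_norm', dist_eq_norm', add_sub_right_comm, add_sub_cancel_left]
    exact (SameRay.sameRay_nonneg_smul_right _ hs).norm_add
  rw [edist_dist, edist_dist, edist_dist, hdist, ENNReal.ofReal_add dist_nonneg dist_nonneg]

lemma map_range_succ_append {α : Type*} (q : ℕ → α) (r : ℕ) (l : List α) :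
    (List.range (r + 1)).map q ++ l = q 0 :: ((List.range r).map (fun i => q (i + 1)) ++ l) := by
  rw [List.range_succ_eq_map, List.map_cons, List.map_map, List.cons_append]
  rfl

lemma polylineLength_map_range_succ (q : ℕ → Plane) (r : ℕ) (v : Plane) :
    polylineLength ((List.range (r + 2)).map q ++ [v]) = edist (q 0) (q 1) +
      polylineLength ((List.range (r + 1)).map (fun i => q (i + 1)) ++ [v]) := by
  rw [map_range_succ_append, map_range_succ_append, polylineLength,
    ← map_range_succ_append fun i => q (i + 1)]

lemma isChain_map_range_append {α : Type*} {R : α → α → Prop} {q : ℕ → α} {r : ℕ} {v : α}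
    (hq : ∀ k < r, R (q k) (q (k + 1))) (hv : R (q r) v) :
    ((List.range (r + 1)).map q ++ [v]).IsChain R := by
  induction r generalizing q with
  | zero => simpa using hv
  | succ r ih =>
    rw [map_range_succ_append, map_range_succ_append, List.isChain_cons_cons,
      ← map_range_succ_append fun i => q (i + 1)]
    exact ⟨hq 0 r.succ_pos, ih (fun k hk => hq (k + 1) (Nat.succ_lt_succ hk)) hv⟩

/- Induction on the number of edges: the curve is cut at a point where it meets the line of the
first edge beyond the end of that edge. -/
lemma WrapsAround.polylineLength_le (W : WrapsAround ε S M v q r) {a b : ℝ} (hab : a ≤ b)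
    (hf : ContinuousOn f (Set.Icc a b)) (hfS : Set.MapsTo f (Set.Icc a b) S) (hfb : f b = v)
    (hstart : 0 < r → 0 ≤ wedge ε (q 1 - q 0) (f a - q 0)) :
    polylineLength ((List.range (r + 1)).map q ++ [v]) ≤
      eVariationOn f (Set.Icc a b) + edist (q 0) (f a) := by
  induction r generalizing q a with
  | zero =>
    have hpoly : polylineLength ((List.range 1).map q ++ [v]) = edist (q 0) v := by
      simp [polylineLength]
    rw [hpoly, ← hfb, add_comm]
    exact (edist_triangle _ (f a) _).trans
      (by gcongr; exact eVariationOn.edist_le f ⟨le_rfl, hab⟩ ⟨hab, le_rfl⟩)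
  | succ r ih =>
    subst hfb
    obtain ⟨t, ht, s, hs, hft⟩ := exists_eq_add_smul_of_curve hab hf hfS
      (wedge_sub_tip ε (q 0) (q 1) (f a) ▸ hstart r.succ_pos) (W.end_nonpos 0 r.succ_pos)
      (W.center_end_pos 0 r.succ_pos) (W.center_neg 0 r.succ_pos) (W.ray_notMem 0 r.succ_pos)
    have hsub : Set.Icc t b ⊆ Set.Icc a b := Set.Icc_subset_Icc_left ht.1
    have hrest : polylineLength ((List.range (r + 1)).map (fun i => q (i + 1)) ++ [f b]) ≤
        eVariationOn f (Set.Icc t b) + edist (q 1) (f t) := by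
      refine ih W.tail ht.2 (hf.mono hsub) (hfS.mono_left hsub) fun hr => ?_
      rw [hft, zero_add, add_sub_cancel_left, map_smul, wedge_swap]
      exact mul_nonneg hs (neg_nonneg.2 (W.turn_nonpos 0 (Nat.succ_lt_succ hr)))
    have hvar : eVariationOn f (Set.Icc a t) + eVariationOn f (Set.Icc t b) =
        eVariationOn f (Set.Icc a b) := by
      simpa only [Set.univ_inter] using eVariationOn.Icc_add_Icc f ht.1 ht.2 (Set.mem_univ t)
    have hcut : edist (q 0) (f t) ≤ edist (q 0) (f a) + eVariationOn f (Set.Icc a t) :=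
      (edist_triangle _ (f a) _).trans
        (by gcongr; exact eVariationOn.edist_le f ⟨le_rfl, ht.1⟩ ⟨ht.1, le_rfl⟩)
    calc polylineLength ((List.range (r + 2)).map q ++ [f b])
        ≤ edist (q 0) (q 1) + (eVariationOn f (Set.Icc t b) + edist (q 1) (f t)) := by
          rw [polylineLength_map_range_succ]
          gcongr
      _ = eVariationOn f (Set.Icc t b) + edist (q 0) (f t) := by
          rw [hft, edist_add_smul_sub _ _ hs, add_left_comm]
      _ ≤ eVariationOn f (Set.Icc t b) + (edist (q 0) (f a) + eVariationOn f (Set.Icc a t)) := by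
          gcongr
      _ = eVariationOn f (Set.Icc a b) + edist (q 0) (f a) := by
          rw [← hvar]
          ring

theorem WrapsAround.isShortestPath (W : WrapsAround ε S M v q r)
    (hq : ∀ k < r, segment ℝ (q k) (q (k + 1)) ⊆ S) (hv : segment ℝ (q r) v ⊆ S) :
    IsShortestPath S (q 0) v ((List.range (r + 1)).map q ++ [v]) := by
  refine ⟨by rw [map_range_succ_append, List.head?_cons], List.getLast?_concat,
    isChain_map_range_append hq hv, fun f hf hf0 hf1 hfS => ?_⟩
  have := W.polylineLength_le zero_le_one hf hfS hf1
    fun _ => by rw [hf0, sub_self, map_zero]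
  rwa [hf0, edist_self, add_zero] at this

end ShortestPath

section Obstacle

variable {ε : ℝ} {p : ℤ → Plane} {β γ n m m' : ℤ}

lemma Bending.wedge_step_nonpos {l u i j : ℤ} (hB : Bending ε p l u) (hli : l ≤ i) (hij : i ≤ j)
    (hju : j < u) : wedge ε (step p i) (step p j) ≤ 0 := by
  rcases hij.eq_or_lt with rfl | hij
  · rw [wedge_self]
  · exact (hB i j hli hij hju).le

/- The ray does not return across the chord from `p l` to `p u`, and up to there it stays within the
hull of the chain. -/
lemma Bending.ray_not_chainSide {l u k : ℤ} (hB : Bending ε p l u) (hlk : l < k) (hku : k < u)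
    {s : ℝ} (hs : 0 < s) :
    ¬ ChainSide ε p l u (p k + s • ((1 / 2 : ℝ) • p l + (1 / 2 : ℝ) • p u - p k)) := by
  rintro ⟨hchord, j, hlj, hju, hside⟩
  set M := (1 / 2 : ℝ) • p l + (1 / 2 : ℝ) • p u with hM
  have hcombo : p k + s • (M - p k) = (1 - s) • p k + s • M := by module
  have hMl : M - p l = (1 / 2 : ℝ) • (p u - p l) := by rw [hM]; module
  rw [hcombo, wedge_combo_sub _ _ _ _ _ (by ring), hMl, map_smul, wedge_self, smul_zero, mul_zero,
    add_zero] at hchord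
  rw [hcombo, side_combo _ _ _ _ _ (by ring)] at hside
  have hk : 0 < wedge ε (p u - p l) (p k - p l) := by
    rw [wedge_sub_sub_rotate, wedge_sub_sub_rotate]
    exact hB.wedge_apex_pos hlk hku
  have hs1 : 0 ≤ 1 - s := nonneg_of_mul_nonneg_left hchord hk
  have hMside := hB.side_midpoint_neg hlj hju le_rfl (show l + 2 ≤ u by omega) le_rfl
  have hkside := hB.side_nonpos hlj hju (k := k) hlk.le hku.le
  linarith [mul_nonpos_of_nonneg_of_nonpos hs1 hkside, mul_neg_of_pos_of_neg hs hMside]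

namespace Tangents

lemma wedge_first_step_nonpos (T : Tangents ε p β γ n m m') (H : TriChain ε p β γ n) {j : ℤ}
    (hmj : m ≤ j) (hjγ : j < γ) : wedge ε (p m - p 1) (step p j) ≤ 0 := by
  have := T.lt_left
  exact neg_nonneg.1 (T.map_first_nonneg H (-(wedge ε).flip (step p j))
    (neg_nonneg.2 (H.bending₂.wedge_step_nonpos (by omega) (by omega) hjγ))
    (neg_nonneg.2 (H.bending₂.wedge_step_nonpos (by omega) hmj hjγ)))

lemma wedge_end_nonpos (T : Tangents ε p β γ n m m') (H : TriChain ε p β γ n) {k : ℤ} {y : Plane}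
    (hkm : k ≤ m') (hy : ∀ j, k ≤ j → j ≤ m' → wedge ε y (step p j) ≤ 0)
    (hpred : wedge ε y (step p (m' - 1)) ≤ 0) : wedge ε y (p (n - 1) - p k) ≤ 0 := by
  have hlast := T.map_last_nonneg H (-wedge ε y) (neg_nonneg.2 hpred)
    (neg_nonneg.2 (hy m' hkm le_rfl))
  have hmiddle := wedge_sub_nonpos hkm fun j hkj hjm => hy j hkj hjm.le
  rw [← sub_add_sub_cancel _ (p m'), map_add]
  exact add_nonpos (neg_nonneg.1 hlast) hmiddle

lemma wedge_step_end_nonpos (T : Tangents ε p β γ n m m') (H : TriChain ε p β γ n) {k : ℤ}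
    (hβk : β ≤ k) (hkm : k < m') : wedge ε (step p k) (p (n - 1) - p (k + 1)) ≤ 0 := by
  have := T.lt_right
  have hneg : ∀ j, k ≤ j → j ≤ m' → wedge ε (step p k) (step p j) ≤ 0 := fun j hkj hjm =>
    H.bending₂.wedge_step_nonpos hβk hkj (by omega)
  exact T.wedge_end_nonpos H (by omega) (fun j hkj hjm => hneg j (by omega) hjm)
    (hneg _ (by omega) (by omega))

/- If the path has a single inner vertex, then it is there that the middle chain blocks the view
between its ends. -/
lemma wedge_first_last_nonpos (T : Tangents ε p β γ n m m) (H : TriChain ε p β γ n) :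
    wedge ε (p m - p 1) (p (n - 1) - p m) ≤ 0 := by
  have := T.lt_left
  have := T.lt_right
  obtain ⟨s, t, hs, ht, -, hblocked⟩ := T.blocked
  have hpred := hblocked (m - 1) (by omega) (by omega)
  have hm := hblocked m (by omega) (by omega)
  have hs_side := mul_nonneg hs (T.side_pred_nonneg H)
  have ht_pos : 0 < t := ht.lt_of_ne fun h0 => by
    rw [← h0, zero_mul, add_zero] at hpred
    exact hpred.not_ge hs_side
  set e := t • (p (n - 1) - p m) - s • (p m - p 1) with he
  have he_wedge : ∀ d, wedge ε d e =
      s * wedge ε d (p 1 - p m) + t * wedge ε d (p (n - 1) - p m) := fun d => by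
    rw [he, ← neg_sub (p m) (p 1), map_sub, map_neg, map_smul, map_smul, smul_eq_mul, smul_eq_mul]
    ring
  rw [side_pred, side_pred, ← he_wedge] at hpred
  rw [side, side, ← he_wedge] at hm
  have hfirst := T.map_first_nonneg H (-(wedge ε).flip e) (neg_nonneg.2 hpred.le)
    (neg_nonneg.2 hm.le)
  have : wedge ε (p m - p 1) e = t * wedge ε (p m - p 1) (p (n - 1) - p m) := by
    rw [he, map_sub, map_smul, map_smul, wedge_self, smul_zero, sub_zero, smul_eq_mul]
  exact nonpos_of_mul_nonpos_right (this ▸ neg_nonneg.1 hfirst) ht_pos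

lemma wedge_first_end_nonpos (T : Tangents ε p β γ n m m') (H : TriChain ε p β γ n) :
    wedge ε (p m - p 1) (p (n - 1) - p m) ≤ 0 := by
  have := T.lt_right
  rcases T.le.eq_or_lt with rfl | hlt
  · exact T.wedge_first_last_nonpos H
  · exact T.wedge_end_nonpos H hlt.le
      (fun j hmj hjm => T.wedge_first_step_nonpos H hmj (by omega))
      (T.wedge_first_step_nonpos H (by omega) (by omega))

lemma wedge_corner_end_pos (T : Tangents ε p β γ n m m') (H : TriChain ε p β γ n) {k : ℤ}
    (hmk : m ≤ k) (hkm : k ≤ m') : 0 < wedge ε (p β - p k) (p (n - 1) - p k) := by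
  have := T.lt_left
  have := T.lt_right
  have hstep : ∀ j, k ≤ j → j ≤ m' → 0 < wedge ε (p β - p k) (step p j) := fun j hkj hjm => by
    rw [wedge_swap, ← LinearMap.map_neg, neg_sub]
    exact wedge_sub_pos (by omega) fun i hβi hik => by
      rw [wedge_swap, neg_pos]
      exact H.neg₂ i j hβi (by omega) (by omega)
  have hpred : β < k - 1 → 0 < wedge ε (p β - p k) (step p (k - 1)) := fun hβk => by
    rw [wedge_swap, neg_pos, ← side_pred]
    exact H.bending₂.side_neg (by omega) (by omega) le_rfl (by omega) (by omega) (by omega)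
  rcases hkm.eq_or_lt with rfl | hlt
  · rcases (show β ≤ k - 1 by omega).eq_or_lt with hβk | hβk
    · obtain rfl : k = β + 1 := by omega
      rw [← neg_sub, map_neg, LinearMap.neg_apply, neg_pos]
      exact side_eq_wedge_succ ε p β _ ▸ T.side_first₂_neg H
    · exact T.map_last_pos H _ (hpred hβk) (hstep k le_rfl le_rfl)
  · rw [← sub_add_sub_cancel (p (n - 1)) (p m') (p k), map_add]
    exact add_pos
      (T.map_last_pos H _ (hstep _ (by omega) (by omega)) (hstep _ (by omega) (by omega)))
      (wedge_sub_pos hlt fun j hkj hjm => hstep j hkj hjm.le)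

lemma wedge_midpoint_end_pos (T : Tangents ε p β γ n m m') (H : TriChain ε p β γ n) {k : ℤ}
    (hmk : m ≤ k) (hkm : k ≤ m') :
    0 < wedge ε ((1 / 2 : ℝ) • p β + (1 / 2 : ℝ) • p γ - p k) (p (n - 1) - p k) := by
  have := T.lt_left
  have := T.lt_right
  have := H.corners_lt.2.2
  have hγ : 0 ≤ wedge ε (p γ - p k) (p (n - 1) - p k) := by
    rw [wedge_sub_tip]
    exact wedge_sub_left_nonneg (by omega) fun i hki hiγ => wedge_sub_nonneg (by omega)
      fun j hγj hjn => (H.pos₂₃ i j (by omega) hiγ hγj (by omega)).le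
  have hsplit : (1 / 2 : ℝ) • p β + (1 / 2 : ℝ) • p γ - p k =
      (1 / 2 : ℝ) • (p β - p k) + (1 / 2 : ℝ) • (p γ - p k) := by module
  rw [hsplit, map_add, map_smul, map_smul, LinearMap.add_apply]
  exact add_pos_of_pos_of_nonneg (mul_pos one_half_pos (T.wedge_corner_end_pos H hmk hkm))
    (mul_nonneg one_half_pos.le hγ)

lemma wedge_first_midpoint_neg (T : Tangents ε p β γ n m m') (H : TriChain ε p β γ n) :
    wedge ε (p m - p 1) ((1 / 2 : ℝ) • p β + (1 / 2 : ℝ) • p γ - p m) < 0 := by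
  have := T.lt_left
  have := T.le
  have := T.lt_right
  have hside : ∀ j, β ≤ j → j < γ →
      side ε p j ((1 / 2 : ℝ) • p β + (1 / 2 : ℝ) • p γ) < 0 := fun j hβj hjγ =>
    H.bending₂.side_midpoint_neg hβj hjγ le_rfl (by omega) le_rfl
  exact neg_pos.1 (T.map_first_pos H (-(wedge ε).flip _)
    (neg_pos.2 (side_pred ε p m _ ▸ hside _ (by omega) (by omega)))
    (neg_pos.2 (hside m (by omega) (by omega))))

/- The midpoint of the two corners lies within the hull of the middle chain, that is, in the
obstacle around which the path wraps. -/
lemma wrapsAround (T : Tangents ε p β γ n m m') (H : TriChain ε p β γ n) {r : ℕ} {q : ℕ → Plane}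
    (hr : m' - m = r) (hq₀ : q 0 = p 1) (hq : ∀ k : ℕ, q (k + 1) = p (m + k)) :
    WrapsAround ε (enclosed ε p β γ n) ((1 / 2 : ℝ) • p β + (1 / 2 : ℝ) • p γ) (p (n - 1)) q
      (r + 1) := by
  have := T.lt_left
  have := T.lt_right
  have hfirst : q (0 + 1) - q 0 = p m - p 1 := by rw [hq, hq₀, Nat.cast_zero, add_zero]
  have hsucc : ∀ k : ℕ, q (k + 1 + 1) = p (m + k + 1) := fun k => by
    rw [hq, Nat.cast_succ, add_assoc]
  have hstep : ∀ k : ℕ, q (k + 1 + 1) - q (k + 1) = step p (m + k) := fun k => by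
    rw [hsucc, hq, step]
  refine ⟨?_, ?_, ?_, fun k hk => ?_, fun k hk s hs => ?_⟩
  · rintro (_ | k) hk
    · rw [hfirst, hstep]
      exact T.wedge_first_step_nonpos H (by omega) (by omega)
    · rw [hstep, hstep]
      exact (H.neg₂ _ _ (by omega) (by omega) (by omega)).le
  · rintro (_ | k) hk
    · rw [hfirst, hq, Nat.cast_zero, add_zero]
      exact T.wedge_first_end_nonpos H
    · rw [hstep, hsucc]
      exact T.wedge_step_end_nonpos H (by omega) (by omega)
  · rintro (_ | k) hk
    · rw [hfirst, hq, Nat.cast_zero, add_zero]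
      exact T.wedge_first_midpoint_neg H
    · rw [hstep, hsucc, ← side_eq_wedge_succ]
      exact H.bending₂.side_midpoint_neg (by omega) (by omega) le_rfl (by omega) le_rfl
  · rw [hq]
    exact T.wedge_midpoint_end_pos H (by omega) (by omega)
  · rw [hq]
    exact fun h => H.bending₂.ray_not_chainSide (by omega) (by omega) hs h.2.1

theorem isShortestPath (T : Tangents ε p β γ n m m') (H : TriChain ε p β γ n)
    (hedge : ∀ k, Sees ε p β γ n k (k + 1)) {r : ℕ} {q : ℕ → Plane} (hr : m' - m = r)
    (hq₀ : q 0 = p 1) (hq : ∀ k : ℕ, q (k + 1) = p (m + k)) :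
    IsShortestPath (enclosed ε p β γ n) (p 1) (p (n - 1))
      ((List.range (r + 2)).map q ++ [p (n - 1)]) := by
  rw [← hq₀]
  refine (T.wrapsAround H hr hq₀ hq).isShortestPath ?_ ?_
  · rintro (_ | k) _
    · rw [hq, hq₀, Nat.cast_zero, add_zero]
      exact T.sees_first H
    · rw [hq, hq, Nat.cast_succ, ← add_assoc]
      exact hedge _
  · rw [hq, ← hr, add_sub_cancel, segment_symm]
    exact T.sees_last H

end Tangents

end Obstacle

/-! ### Visibility graphs of pseudo-triangles -/

section CutCorners

namespace Tangents

variable {ε : ℝ} {p : ℤ → Plane} {β γ n m m' : ℤ}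

lemma cutsCorner_left (T : Tangents ε p β γ n m m') (H : TriChain ε p β γ n) (hβ : 1 < β) :
    CutsCorner ε p 1 β m where
  sign := H.sign
  lt_corner := hβ
  corner_lt := T.lt_left
  bending_left i j hi hij hj := H.neg₁ i j (by omega) hij hj
  bending_right i j hi hij hj := H.neg₂ i j hi hij (hj.trans (T.le.trans_lt T.lt_right))
  corner_pos i j hi hiβ hj hjm :=
    H.pos₁₂ i j (by omega) hiβ hj (hjm.trans (T.le.trans_lt T.lt_right))
  left_pos i hi hiβ := by
    rw [← neg_sub, map_neg, LinearMap.neg_apply, wedge_swap, neg_neg]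
    exact T.wedge_first_pos H (by omega) hiβ
  right_pos _ hj hjm := T.wedge_middle_pos H hβ hj hjm

lemma cutsCorner_right (T : Tangents ε p β γ n m m') (H : TriChain ε p β γ n) (hγ : γ < n - 1) :
    CutsCorner ε p m' γ (n - 1) := by
  obtain ⟨_, _, -⟩ := H.corners_lt
  have hβm := T.lt_left.trans_le T.le
  have hmγ := T.lt_right
  have hlast : p (-1) = p (n - 1) := H.apply_neg 1
  have hm : p (-(n - m')) = p m' := by rw [H.apply_neg, sub_sub_cancel]
  refine ⟨H.sign, hmγ, hγ, ?_, ?_, ?_, fun i hmi hiγ => ?_, fun j hγj hjn => ?_⟩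
  · exact fun i j hi hij hj => H.neg₂ i j (by omega) hij hj
  · exact fun i j hi hij hj => H.neg₃ i j hi hij (by omega)
  · exact fun i j hi hiγ hj hjn => H.pos₂₃ i j (by omega) hiγ hj (by omega)
  · have := (T.reverse H).wedge_middle_pos H.reverse (by omega) (i := n - i - 1) (by omega)
      (by omega)
    rwa [H.step_reverse, hlast, hm, wedge_neg_sign, map_neg, LinearMap.neg_apply, neg_neg,
      ← neg_sub, map_neg, ← wedge_swap] at this
  · have := (T.reverse H).wedge_first_pos H.reverse (i := n - j - 1) (by omega) (by omega)
    rwa [H.step_reverse, hlast, hm, wedge_neg_sign, map_neg, LinearMap.neg_apply, neg_neg] at this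

lemma left_eq_of_corner_eq_one (T : Tangents ε p β γ n m m') (H : TriChain ε p β γ n)
    (hβ : β = 1) : m = β + 1 := by
  have := T.lt_left
  have := T.le
  have := T.lt_right
  by_contra hne
  have hpos := T.left_pos (β + 1) (by omega) (by omega)
  have hneg := H.bending₂.side_neg (j := β + 1) (k := β) (by omega) (by omega) le_rfl (by omega)
    (by omega) (by omega)
  rw [hβ] at hpos hneg
  exact lt_asymm hpos hneg

lemma right_eq_of_corner_eq_last (T : Tangents ε p β γ n m m') (H : TriChain ε p β γ n)
    (hγ : γ = n - 1) : m' = γ - 1 := by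
  have := T.lt_left
  have := T.le
  have := T.lt_right
  by_contra hne
  have hpos := T.right_pos (γ - 2) (by omega) (by omega)
  have hneg := H.bending₂.side_neg (j := γ - 2) (k := γ) (by omega) (by omega) (by omega) le_rfl
    (by omega) (by omega)
  rw [← hγ] at hpos
  exact lt_asymm hpos hneg

end Tangents

end CutCorners

section VisibilityGraph

open Fin.CommRing

variable {n : ℕ} [NeZero n]

lemma val_add_intCast_sub (a : Fin n) {k l : ℤ} (hkl : k ≤ l) (hln : l - k < n) :
    ((a + (l : Fin n) - (a + (k : Fin n))).val : ℤ) = l - k := by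
  have hsub : a + (l : Fin n) - (a + (k : Fin n)) = 0 + ((l - k : ℤ) : Fin n) := by
    push_cast
    ring
  rw [hsub, val_add_intCast 0 (by omega) hln, Fin.val_zero, Nat.cast_zero, zero_add, if_pos hln]

lemma add_intCast_ne (a : Fin n) {k l : ℤ} (hkl : k < l) (hln : l - k < n) :
    a + (k : Fin n) ≠ a + (l : Fin n) := fun h => by
  have := val_add_intCast_sub a hkl.le hln
  rw [h, sub_self, Fin.val_zero] at this
  omega

lemma add_one_eq_add_intCast (a : Fin n) : a + 1 = a + ((1 : ℤ) : Fin n) := by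
  rw [Int.cast_one]

lemma sub_one_eq_add_intCast (a : Fin n) : a - 1 = a + ((n - 1 : ℤ) : Fin n) := by
  rw [Int.cast_sub, Int.cast_natCast, Fin.natCast_self, Int.cast_one, zero_sub, sub_eq_add_neg]

lemma cycleGraph_adj_iff_eq (hn : 2 ≤ n) {x y : Fin n} :
    (SimpleGraph.cycleGraph n).Adj x y ↔ y = x + 1 ∨ y = x - 1 := by
  have hval : ∀ z : Fin n, z.val = 1 ↔ z = 1 := fun z => by
    rw [Fin.ext_iff, Fin.val_one', Nat.mod_eq_of_lt (by omega)]
  rw [SimpleGraph.cycleGraph_adj', hval, hval, or_comm, sub_eq_iff_eq_add', sub_eq_iff_eq_add',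
    eq_sub_iff_add_eq, add_comm y, eq_comm (a := x)]

lemma mem_detected_cycleGraph_iff (hn : 3 ≤ n) {G : SimpleGraph (Fin n)} {x : Fin n} :
    x ∈ detected G (SimpleGraph.cycleGraph n) ↔ G.Adj (x - 1) (x + 1) := by
  have hne : x - 1 ≠ x + 1 := by
    have := add_intCast_ne x (k := -1) (l := 1) (by omega) (by omega)
    rwa [Int.cast_neg, Int.cast_one, ← sub_eq_add_neg] at this
  simp only [detected, Set.mem_ofPred_eq, cycleGraph_adj_iff_eq (n := n) (by omega)]
  constructor
  · rintro ⟨y, z, hyz, rfl | rfl, rfl | rfl, hadj⟩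
    · exact absurd rfl hyz
    · exact hadj.symm
    · exact hadj
    · exact absurd rfl hyz
  · intro hadj
    exact ⟨x - 1, x + 1, hne, Or.inr rfl, Or.inl rfl, hadj⟩

variable {P : Polygon Plane n} {a b c : Fin n} {ε : ℝ} {β γ m m' : ℤ}

namespace TriChain

lemma mem_detected_iff_sees (H : TriChain ε (unroll P a) β γ n) (k : ℤ) :
    a + (k : Fin n) ∈ detected P.visibilityGraph (SimpleGraph.cycleGraph n) ↔
      Sees ε (unroll P a) β γ n (k - 1) (k + 1) := by
  obtain ⟨hβ, hβγ, hγn⟩ := H.corners_lt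
  have hpred : a + (k : Fin n) - 1 = a + ((k - 1 : ℤ) : Fin n) := by
    push_cast
    ring
  have hsucc : a + (k : Fin n) + 1 = a + ((k + 1 : ℤ) : Fin n) := by
    push_cast
    ring
  rw [mem_detected_cycleGraph_iff (by omega), hpred, hsucc, H.visibilityGraph_adj_iff]
  exact and_iff_right (add_intCast_ne a (by omega) (by omega))

lemma mem_detected_base_iff_sees (H : TriChain ε (unroll P a) β γ n) :
    a ∈ detected P.visibilityGraph (SimpleGraph.cycleGraph n) ↔
      Sees ε (unroll P a) β γ n 1 (n - 1) := by
  have := H.mem_detected_iff_sees 0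
  rwa [Int.cast_zero, add_zero, zero_add, zero_sub, sees_comm, Sees, H.apply_neg] at this

lemma eq_corner_of_sees_around (H : TriChain ε (unroll P a) β γ n) {k : ℤ} (hk : 0 ≤ k)
    (hkn : k < n) (hsees : Sees ε (unroll P a) β γ n (k - 1) (k + 1)) :
    k = 0 ∨ k = β ∨ k = γ := by
  by_contra! hne
  obtain ⟨hzero, hβ, hγ⟩ := hne
  rcases lt_or_gt_of_ne hβ with hkβ | hβk
  · exact H.not_sees₁ (by omega) (by omega) (by omega) hsees
  · rcases lt_or_gt_of_ne hγ with hkγ | hγk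
    · exact H.not_sees₂ (by omega) (by omega) (by omega) hsees
    · exact H.not_sees₃ (by omega) (by omega) (by omega) hsees

lemma isIsolated_sdiff_cycleGraph (H : TriChain ε (unroll P a) β γ n) {k : ℤ}
    (hk : ∀ l, k + 2 ≤ l → l ≤ k + n - 2 → ¬ Sees ε (unroll P a) β γ n k l) :
    (P.visibilityGraph \ SimpleGraph.cycleGraph n).IsIsolated (a + (k : Fin n)) := by
  obtain ⟨hβ, hβγ, hγn⟩ := H.corners_lt
  intro z hz
  obtain ⟨j, hj, hjn, rfl, -, -⟩ := exists_unroll P (a + (k : Fin n)) z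
  rw [add_assoc, ← Int.cast_add, SimpleGraph.sdiff_adj, H.visibilityGraph_adj_iff,
    cycleGraph_adj_iff_eq (by omega), not_or] at hz
  obtain ⟨⟨hne, hsees⟩, hsucc, hpred⟩ := hz
  have hj_zero : j ≠ 0 := fun h => hne (by rw [h, add_zero])
  have hj_one : j ≠ 1 := fun h => hsucc (by rw [h, Int.cast_add, Int.cast_one, add_assoc])
  have hj_last : j ≠ n - 1 := fun h => hpred (by
    rw [h, Int.cast_add, ← add_assoc, ← sub_one_eq_add_intCast])
  exact hk (k + j) (by omega) (by omega) hsees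

end TriChain

lemma exists_triChain_corners (h : P.IsPseudoTriangle a b c) :
    ∃ ε, ∃ β γ : ℤ, TriChain ε (unroll P a) β γ n ∧ b = a + (β : Fin n) ∧ c = a + (γ : Fin n) := by
  obtain ⟨ε, H⟩ := exists_triChain h
  exact ⟨ε, _, _, H, by rw [Int.cast_natCast, Fin.cast_val_eq_self, add_sub_cancel],
    by rw [Int.cast_natCast, Fin.cast_val_eq_self, add_sub_cancel]⟩

lemma detected_subset (h : P.IsPseudoTriangle a b c) :
    detected P.visibilityGraph (SimpleGraph.cycleGraph n) ⊆ {a, b, c} := by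
  obtain ⟨ε, β, γ, H, rfl, rfl⟩ := exists_triChain_corners h
  intro i hi
  obtain ⟨k, hk, hkn, rfl, -, -⟩ := exists_unroll P a i
  rcases H.eq_corner_of_sees_around hk hkn ((H.mem_detected_iff_sees k).1 hi) with rfl | rfl | rfl
  · exact Or.inl (by rw [Int.cast_zero, add_zero])
  · exact Or.inr (Or.inl rfl)
  · exact Or.inr (Or.inr rfl)

namespace Tangents

lemma mem_detected_left (T : Tangents ε (unroll P a) β γ n m m')
    (H : TriChain ε (unroll P a) β γ n) :
    a + (β : Fin n) ∈ detected P.visibilityGraph (SimpleGraph.cycleGraph n) :=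
  (H.mem_detected_iff_sees β).2 (T.sees_around_left H)

lemma mem_detected_right (T : Tangents ε (unroll P a) β γ n m m')
    (H : TriChain ε (unroll P a) β γ n) :
    a + (γ : Fin n) ∈ detected P.visibilityGraph (SimpleGraph.cycleGraph n) :=
  (H.mem_detected_iff_sees γ).2 (sees_comm.1 (T.sees_around_right H))

lemma isIsolated_left (T : Tangents ε (unroll P a) β γ n m m')
    (H : TriChain ε (unroll P a) β γ n) :
    (P.visibilityGraph \ SimpleGraph.cycleGraph n).IsIsolated (a + (β : Fin n)) := by
  refine H.isIsolated_sdiff_cycleGraph fun l hβl hlβ hsees => ?_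
  rcases le_or_gt l γ with hlγ | hγl
  · exact H.not_sees₂ le_rfl hβl hlγ hsees
  rcases lt_or_ge l n with hln | hnl
  · exact T.not_sees_left H hγl hln hsees
  · rw [← H.sees_sub_period] at hsees
    exact H.not_sees₁ (by omega) (by omega) le_rfl (sees_comm.1 hsees)

lemma isIsolated_right (T : Tangents ε (unroll P a) β γ n m m')
    (H : TriChain ε (unroll P a) β γ n) :
    (P.visibilityGraph \ SimpleGraph.cycleGraph n).IsIsolated (a + (γ : Fin n)) := by
  refine H.isIsolated_sdiff_cycleGraph fun l hγl hlγ hsees => ?_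
  rcases le_or_gt l n with hln | hnl
  · exact H.not_sees₃ le_rfl hγl hln hsees
  rw [← H.sees_sub_period] at hsees
  rcases lt_or_ge (l - n) β with hlβ | hβl
  · exact T.not_sees_right H (by omega) hlβ hsees
  · exact H.not_sees₂ hβl (by omega) le_rfl (sees_comm.1 hsees)

lemma visibilityGraph_adj_first (T : Tangents ε (unroll P a) β γ n m m')
    (H : TriChain ε (unroll P a) β γ n) : P.visibilityGraph.Adj (a + 1) (a + (m : Fin n)) := by
  obtain ⟨hβ, _, hγn⟩ := H.corners_lt
  have := T.lt_left
  have := T.le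
  have := T.lt_right
  rw [add_one_eq_add_intCast, H.visibilityGraph_adj_iff]
  exact ⟨add_intCast_ne a (by omega) (by omega), T.sees_first H⟩

lemma visibilityGraph_adj_last (T : Tangents ε (unroll P a) β γ n m m')
    (H : TriChain ε (unroll P a) β γ n) : P.visibilityGraph.Adj (a + (m' : Fin n)) (a - 1) := by
  obtain ⟨hβ, _, hγn⟩ := H.corners_lt
  have := T.lt_left
  have := T.le
  have := T.lt_right
  rw [sub_one_eq_add_intCast, H.visibilityGraph_adj_iff]
  exact ⟨add_intCast_ne a (by omega) (by omega), sees_comm.1 (T.sees_last H)⟩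

lemma exists_eq_corner_add (T : Tangents ε (unroll P a) β γ n m m')
    (H : TriChain ε (unroll P a) β γ n) :
    ∃ s t : ℕ, 0 < s ∧ s ≤ t ∧ t < (a + (γ : Fin n) - (a + (β : Fin n))).val ∧
      a + (m : Fin n) = a + (β : Fin n) + Fin.ofNat n s ∧
      a + (m' : Fin n) = a + (β : Fin n) + Fin.ofNat n t := by
  obtain ⟨hβ, hβγ, hγn⟩ := H.corners_lt
  have := T.lt_left
  have := T.le
  have := T.lt_right
  have hval := val_add_intCast_sub a hβγ.le (by omega)
  obtain ⟨s, rfl⟩ : ∃ s : ℕ, m = β + s := ⟨(m - β).toNat, by omega⟩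
  obtain ⟨t, rfl⟩ : ∃ t : ℕ, m' = β + t := ⟨(m' - β).toNat, by omega⟩
  refine ⟨s, t, by omega, by omega, by omega, ?_, ?_⟩ <;>
    rw [Int.cast_add, Int.cast_natCast, Fin.ofNat_eq_cast, add_assoc]

lemma cutsOffTower_left (T : Tangents ε (unroll P a) β γ n m m')
    (H : TriChain ε (unroll P a) β γ n) :
    (a + (β : Fin n) ≠ a + 1 ∧ P.CutsOffTower (a + 1) (a + (m : Fin n)) (a + (β : Fin n))) ∨
      (a + (β : Fin n) = a + 1 ∧ a + (m : Fin n) = a + (β : Fin n) + 1) := by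
  obtain ⟨hβ, hβγ, hγn⟩ := H.corners_lt
  have := T.lt_left
  have := T.le
  have := T.lt_right
  rw [add_one_eq_add_intCast a]
  rcases eq_or_lt_of_le (show 1 ≤ β from hβ) with h | h
  · refine Or.inr ⟨by rw [← h], ?_⟩
    rw [T.left_eq_of_corner_eq_one H h.symm, Int.cast_add, Int.cast_one, add_assoc]
  · refine Or.inl ⟨(add_intCast_ne a h (by omega)).symm,
      (T.cutsCorner_left H h).cutsOffTower (fun k => ?_) (val_add_intCast_sub a h.le (by omega))
      (val_add_intCast_sub a (by omega) (by omega))⟩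
    rw [unroll, Int.cast_add, Int.cast_natCast, add_assoc]

lemma cutsOffTower_right (T : Tangents ε (unroll P a) β γ n m m')
    (H : TriChain ε (unroll P a) β γ n) :
    (a + (γ : Fin n) ≠ a - 1 ∧ P.CutsOffTower (a + (m' : Fin n)) (a - 1) (a + (γ : Fin n))) ∨
      (a + (γ : Fin n) = a - 1 ∧ a + (m' : Fin n) = a + (γ : Fin n) - 1) := by
  obtain ⟨hβ, _, hγn⟩ := H.corners_lt
  have := T.lt_left
  have := T.le
  have hmγ := T.lt_right
  rw [sub_one_eq_add_intCast a]
  rcases eq_or_lt_of_le (show γ ≤ n - 1 by omega) with h | h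
  · refine Or.inr ⟨by rw [← h], ?_⟩
    rw [T.right_eq_of_corner_eq_last H h, Int.cast_sub, Int.cast_one, add_sub_assoc]
  · refine Or.inl ⟨add_intCast_ne a h (by omega),
      (T.cutsCorner_right H h).cutsOffTower (fun k => ?_)
      (val_add_intCast_sub a hmγ.le (by omega)) (val_add_intCast_sub a (by omega) (by omega))⟩
    rw [unroll, Int.cast_add, Int.cast_natCast, add_assoc]

lemma isShortestPath_region (T : Tangents ε (unroll P a) β γ n m m')
    (H : TriChain ε (unroll P a) β γ n) :
    IsShortestPath P.region (P (a + 1)) (P (a - 1))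
      (P (a + 1) :: P.boundaryChain (a + (m : Fin n)) (a + (m' : Fin n)) ++ [P (a - 1)]) := by
  have := H.corners_lt
  have := T.lt_left
  have := T.lt_right
  have hfirst : P (a + 1) = unroll P a 1 := by rw [unroll, add_one_eq_add_intCast]
  have hlast : P (a - 1) = unroll P a (n - 1) := by rw [unroll, sub_one_eq_add_intCast]
  have hpath := T.isShortestPath H H.sees_succ
    (r := (a + (m' : Fin n) - (a + (m : Fin n))).val)
    (q := fun i => unroll P a (if i = 0 then 1 else m + (i - 1 : ℕ)))
    (val_add_intCast_sub a T.le (by omega)).symm (by rw [if_pos rfl])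
    fun k => by rw [if_neg k.succ_ne_zero, Nat.add_sub_cancel]
  rw [map_range_succ_append, ← H.region_eq_enclosed] at hpath
  rw [hfirst, hlast]
  convert hpath using 1
  rw [Polygon.boundaryChain, List.cons_append]
  congr 2
  refine List.map_congr_left fun k _ => ?_
  rw [if_neg k.succ_ne_zero, unroll, Nat.add_sub_cancel, Int.cast_add, Int.cast_natCast,
    ← add_assoc]
  rfl

end Tangents

lemma mem_detected_of_notMem_detected (h : P.IsPseudoTriangle a b c)
    (ha : a ∉ detected P.visibilityGraph (SimpleGraph.cycleGraph n)) :
    b ∈ detected P.visibilityGraph (SimpleGraph.cycleGraph n) ∧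
      c ∈ detected P.visibilityGraph (SimpleGraph.cycleGraph n) := by
  obtain ⟨ε, β, γ, H, rfl, rfl⟩ := exists_triChain_corners h
  obtain ⟨m, m', T⟩ := H.exists_tangents (mt H.mem_detected_base_iff_sees.2 ha)
  exact ⟨T.mem_detected_left H, T.mem_detected_right H⟩

lemma isPseudoTriangle_rotate (h : P.IsPseudoTriangle a b c) : P.IsPseudoTriangle b c a := by
  obtain ⟨hsimple, hab, hbc, ha, hb, hc, hreflex⟩ := h
  rw [Fin.lt_def] at hbc
  rw [Fin.lt_def, Fin.val_zero] at hab
  have hcb : (c - b).val = (c - a).val - (b - a).val := by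
    rw [← Fin.sub_val_of_le hbc.le, sub_sub_sub_cancel_right]
  have hba : (a - b).val = n - (b - a).val := by
    rw [← neg_sub, Fin.val_neg, if_neg fun h => hab.ne' (by rw [h, Fin.val_zero])]
  have := (c - a).isLt
  refine ⟨hsimple, ?_, ?_, hb, hc, ha, fun i hib hic hia => hreflex i hia hib hic⟩
  · rw [Fin.lt_def, Fin.val_zero, hcb]
    omega
  · rw [Fin.lt_def, hcb, hba]
    omega

lemma two_le_ncard_detected (h : P.IsPseudoTriangle a b c) :
    2 ≤ (detected P.visibilityGraph (SimpleGraph.cycleGraph n)).ncard := by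
  have hbc := isPseudoTriangle_rotate h
  have hne : ∀ {x y z : Fin n}, P.IsPseudoTriangle x y z → x ≠ y := fun h hxy => by
    simpa [hxy] using h.2.1
  refine Nat.succ_le_of_lt ((Set.one_lt_ncard (Set.toFinite _)).2 ?_)
  by_cases ha : a ∈ detected P.visibilityGraph (SimpleGraph.cycleGraph n)
  · by_cases hb : b ∈ detected P.visibilityGraph (SimpleGraph.cycleGraph n)
    · exact ⟨a, ha, b, hb, hne h⟩
    · obtain ⟨hc, -⟩ := mem_detected_of_notMem_detected hbc hb
      exact ⟨c, hc, a, ha, hne (isPseudoTriangle_rotate hbc)⟩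
  · obtain ⟨hb, hc⟩ := mem_detected_of_notMem_detected h ha
    exact ⟨b, hb, c, hc, hne hbc⟩

end VisibilityGraph

end Plane

/-- `P` is any pseudo-triangle, `G` its visibility graph and `H` its boundary cycle. The hypothesis is
invariant under rotating `a`, `b`, `c`, so the last part applies to each of the three corners.
There `a + 1` and `a - 1` are the boundary neighbours of the missed corner `a`, and `b + s`, `b + t`
are interior vertices of the side-chain from `b` to `c`. -/
theorem lemma1 {n : ℕ} [NeZero n] (P : Polygon Plane n) (a b c : Fin n)
    (hP : P.IsPseudoTriangle a b c) (G H : SimpleGraph (Fin n))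
    (hG : G = P.visibilityGraph) (hH : H = SimpleGraph.cycleGraph n) :
    detected G H ⊆ {a, b, c} ∧
    2 ≤ (detected G H).ncard ∧
    (a ∉ detected G H →
      b ∈ detected G H ∧ c ∈ detected G H ∧
      (G \ H).IsIsolated b ∧ (G \ H).IsIsolated c ∧
      ∃ s t : ℕ, 0 < s ∧ s ≤ t ∧ t < (c - b).val ∧
        ∃ w w' : Fin n, w = b + Fin.ofNat n s ∧ w' = b + Fin.ofNat n t ∧
          G.Adj (a + 1) w ∧ G.Adj w' (a - 1) ∧
          IsShortestPath P.region (P (a + 1)) (P (a - 1))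
            (P (a + 1) :: P.boundaryChain w w' ++ [P (a - 1)]) ∧
          ((b ≠ a + 1 ∧ P.CutsOffTower (a + 1) w b) ∨ (b = a + 1 ∧ w = b + 1)) ∧
          ((c ≠ a - 1 ∧ P.CutsOffTower w' (a - 1) c) ∨ (c = a - 1 ∧ w' = c - 1))) := by
  subst hG hH
  refine ⟨Plane.detected_subset hP, Plane.two_le_ncard_detected hP, fun ha => ?_⟩
  obtain ⟨ε, β, γ, H, rfl, rfl⟩ := Plane.exists_triChain_corners hP
  obtain ⟨m, m', T⟩ := H.exists_tangents (mt H.mem_detected_base_iff_sees.2 ha)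
  obtain ⟨s, t, hs, hst, ht, hw, hw'⟩ := T.exists_eq_corner_add H
  exact ⟨T.mem_detected_left H, T.mem_detected_right H, T.isIsolated_left H, T.isIsolated_right H,
    s, t, hs, hst, ht, _, _, hw, hw', T.visibilityGraph_adj_first H, T.visibilityGraph_adj_last H,
    T.isShortestPath_region H, T.cutsOffTower_left H, T.cutsOffTower_right H⟩
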